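/- **Cell complexes.** A *cell complex* (cc) $K$ is a set of non-empty subsets (*cells*) of a finite set $S$ with a rank function $\mathrm{rk}_K:K\to\mathbb N$ such that the cells of rank $0$ are exactly the singletons $\{v\}$, $v\in S$ (the *vertices*, identified with the elements of $S$), and for all $x,y\in K$: (i) $x\subsetneq y$ implies $\mathrm{rk}(x)<\mathrm{rk}(y)$; (ii) $x\cap y\in K\cup\{\emptyset\}$; (iii) if $x\subsetneq y$, some cell $z$ with $x\subset z\subset y$ has $\mathrm{rk}(z)=\mathrm{rk}(x)+1$; (iv) if $x\subset y$ and $\mathrm{rk}(x)=\mathrm{rk}(y)-2$, exactly two cells $z$ of rank $\mathrm{rk}(x)+1$ satisfy $x\subset z\subset y$. Write $K^{[r]}$ for the set of cells of rank $r$, $\mathrm{Rk}(K)$ for the maximal rank (the rank of $K$), and $K\cap A=\{x\in K: x\subset A\}$ for $A\subset K^{[0]}$. Write $J\le K$ if $J$ is a cc with $J\subset K$ and $\mathrm{rk}_J=\mathrm{rk}_K|_J$. Let $R=\mathrm{Rk}(K)$. The *co-faces* of $x$ are the cells of rank $\mathrm{rk}(x)+1$ containing $x$. $K$ is *pure* if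 all maximal cells have rank $R$; its *boundary* $\partial K$ is then the set of cells contained in some $y\in K^{[R-1]}$ with exactly one co-face. $K$ is *graph-based* if every edge ($1$-cell) has two vertices, *non-singular* if it is graph-based, pure and every $y\in K^{[R-1]}$ has at most two co-faces, and *closed* if moreover $\partial K=\emptyset$. It is *connected* if it is graph-based and its graph of vertices and edges is connected, *cell-connected* if it is graph-based and $K\cap x$ is connected for each $x\in K$, and *local* if it is connected and cell-connected. **Duals.** For non-empty $A\subset K^{[0]}$ let $A^{*_K}=\{z\in K^{[R]}: A\subset z\}$, and let $A^{\sim}=A^{*_K}\cup A^{*_{\partial K}}$ (with $A^{*_{\partial K}}=\emptyset$ if $A\not\subset(\partial K)^{[0]}$). The *dual* of a pure cc $K$ is $K^*=\{x^{*_K}:x\in K\}$, with $x^{*_K}$ given rank $R-\mathrm{rk}_K(x)$. The *dual graph* of a non-singular $K$ has vertex set $K^{[R]}$ and edges $y^{*_K}$, $y\in (K\setminus\partial K)^{[R-1]}$; a *$K$-pinch* is a cell $x$ such that the subgraph induced on $x^{*_K}$ is not connected, and $K$ is *non-pinching* if there is neither a $K$-pinch nor a $\partial K$-pinch. Let $\mathsf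 C$ be the class of non-singular non-pinching local cc, and $\mathsf B^{r}$ the class of closed non-pinching cell-connected cc of rank $r$, together with the empty cc. **Relative cc.** Let $J\le K$. $(K,J)$ is *non-degenerate* if no cell $x\in K\setminus J$ satisfies $x\subset J^{[0]}$. Let $K_J=\{x\in K:\emptyset\ne x\cap J^{[0]}\ne x\}$, let $\mathcal E_J^x$ be the set of edges in $K_J$ contained in $x$, and let the *midsection* $M_J^K=\{\mathcal E_J^x: x\in K_J\}$ have rank function $\mathcal E^x_J\mapsto \mathrm{rk}_K(x)-1$. $(K,J)$ is *local* if it is non-degenerate, $K$ is local and, for every connected component $J_0$ of $J$, $J_0\cap x$ is connected for all $x\in K_{J_0}$ and $M_{J_0}^K$ is cell-connected. A non-degenerate $(K,J)$ is *exactly collared* if $\mathcal E_J^x\mapsto J\cap x$ (that is, the cell with vertex set $x\cap J^{[0]}$) is a cc-isomorphism $M_J^K\to J$. A *cc-homomorphism* $\phi:J\to K$ is an inclusion-preserving map such that every $y\in\phi(J)$ is the image of some $x$ with $\mathrm{rk}_J(x)=\mathrm{rk}_K(y)$; a *cc-isomorphism* ($\cong$) is a bijective cc-homomorphism whose inverse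 is a cc-homomorphism. **Cobordisms.** A *cobordism* $(K-J)$ consists of $K\in\mathsf C$ and $J\le\partial K$ with $J\in\mathsf B^{\mathrm{Rk}(K)-1}$ and $(K,J)$ non-degenerate and local. Its boundary is $\partial K$. It is exactly collared if $(K,J)$ is. $(K-J)\cong(K'-J')$ means that there is a cc-isomorphism $K\to K'$ mapping $J$ onto $J'$. With $(\partial K\setminus J)^*=\{x^{*_{\partial K}}:x\in\partial K\setminus J\}$, where $x^{*_{\partial K}}$ has rank $\mathrm{Rk}(\partial K)-\mathrm{rk}_K(x)$, and $(K\setminus J)^\sim=\{x^\sim:x\in K\setminus J\}$, where $x^\sim$ has rank $\mathrm{Rk}(K)-\mathrm{rk}_K(x)$, the *dual* of $(K-J)$ is $$(K-J)^*=\Big(\big((K\setminus J)^\sim\sqcup(\partial K\setminus J)^*\big)-(\partial K\setminus J)^*\Big).$$ **Statement.** Let $(K-J)$ be an exactly collared cobordism. Then 1. $(K-J)^*$ is an exactly collared cobordism; 2. $J^*$ and $(\partial K\setminus J)^*$ are disjoint and $\partial (K-J)^*\cong J^*\sqcup(\partial K\setminus J)^*$; 3. $(K-J)^{**}\cong (K-J)$.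 In particular duality is, up to isomorphism, an involution on exactly collared cobordisms. -/

import Mathlib

/-- Raw data of a ranked family of subsets of `V`: a collection of subsets (the cells) and a
rank function, of which only the values on cells matter. A vertex `v` is the cell `{v}`. -/
structure RankedFamily (V : Type*) where
  cells : Set (Set V)
  rk : Set V → ℕ

namespace RankedFamily

variable {V W : Type*}

/-- The faces of a cell `x`. -/
def faces (K : RankedFamily V) (x : Set V) : Set (Set V) :=
  {y | y ∈ K.cells ∧ y ⊆ x ∧ K.rk y + 1 = K.rk x}

/-- The co-faces of a cell `x`. -/
def cofaces (K : RankedFamily V) (x : Set V) : Set (Set V) :=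
  {y | y ∈ K.cells ∧ x ⊆ y ∧ K.rk y = K.rk x + 1}

/-- The vertex set `K^[0]`, as a subset of `V`. -/
def verts (K : RankedFamily V) : Set V := {v | {v} ∈ K.cells}

/-- (Combinatorial) cell complexes. The first four fields say that the cells are non-empty
subsets of a finite set whose elements (as singletons) are exactly the cells of rank zero. -/
structure IsCC (K : RankedFamily V) : Prop where
  finite_verts : K.verts.Finite
  nonempty_of_mem : ∀ x ∈ K.cells, x.Nonempty
  subset_verts : ∀ x ∈ K.cells, x ⊆ K.verts
  rk_eq_zero_iff : ∀ x ∈ K.cells, K.rk x = 0 ↔ ∃ v, x = {v}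
  rk_lt_rk : ∀ x ∈ K.cells, ∀ y ∈ K.cells, x ⊂ y → K.rk x < K.rk y
  inter_mem : ∀ x ∈ K.cells, ∀ y ∈ K.cells, (x ∩ y).Nonempty → x ∩ y ∈ K.cells
  exists_coface : ∀ x ∈ K.cells, ∀ y ∈ K.cells, x ⊂ y → ∃ z ∈ K.cofaces x, z ⊆ y
  diamond : ∀ x ∈ K.cells, ∀ y ∈ K.cells, x ⊆ y → K.rk x + 2 = K.rk y →
    ∃ z₁ z₂, z₁ ≠ z₂ ∧ K.cofaces x ∩ K.faces y = {z₁, z₂}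

/-- The rank (dimension) `Rk K`: the least `R` such that all cells have rank at most `R`. -/
noncomputable def rank (K : RankedFamily V) : ℕ := sInf {R | ∀ x ∈ K.cells, K.rk x ≤ R}

/-- The restriction `K ∩ A` of `K` to a set `A` of vertices. -/
def restrict (K : RankedFamily V) (A : Set V) : RankedFamily V where
  cells := {x | x ∈ K.cells ∧ x ⊆ A}
  rk := K.rk

/-- `J ≤ K` (for cell complexes `J` and `K`): same rank function, fewer cells. -/
def IsSub (J K : RankedFamily V) : Prop :=
  J.cells ⊆ K.cells ∧ ∀ x ∈ J.cells, J.rk x = K.rk x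

/-- Every maximal cell has rank `Rk K`. -/
def Pure (K : RankedFamily V) : Prop :=
  ∀ x ∈ K.cells, (∀ y ∈ K.cells, x ⊆ y → y = x) → K.rk x = K.rank

/-- The boundary `∂K`: the cells contained in a sub-maximal cell that has exactly one
co-face. -/
def boundary (K : RankedFamily V) : RankedFamily V where
  cells := {x | x ∈ K.cells ∧
    ∃ y ∈ K.cells, K.rk y + 1 = K.rank ∧ (∃ z, K.cofaces y = {z}) ∧ x ⊆ y}
  rk := K.rk

/-- Every edge has exactly two vertices. -/
def GraphBased (K : RankedFamily V) : Prop :=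
  ∀ e ∈ K.cells, K.rk e = 1 → e.encard = 2

/-- Non-singular cell complexes: graph-based, pure and non-branching. -/
structure NonSingular (K : RankedFamily V) : Prop where
  isCC : K.IsCC
  graphBased : K.GraphBased
  pure : K.Pure
  nonBranching : ∀ y ∈ K.cells, K.rk y + 1 = K.rank → (K.cofaces y).encard ≤ 2

/-- Closed cell complexes: non-singular with empty boundary. -/
def Closed (K : RankedFamily V) : Prop :=
  K.NonSingular ∧ K.boundary.cells = ∅

/-- The graph of vertices and edges of (a graph-based) `K`. -/
def graph (K : RankedFamily V) : SimpleGraph V where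
  Adj v w := v ≠ w ∧ {v, w} ∈ K.cells ∧ K.rk {v, w} = 1
  symm := ⟨fun v w h => by
    rw [Set.pair_comm w v]
    exact ⟨h.1.symm, h.2⟩⟩
  loopless := ⟨fun _ h => h.1 rfl⟩

/-- `K` is graph-based and any two of its vertices are linked by a path of edges. -/
def Connected (K : RankedFamily V) : Prop :=
  K.GraphBased ∧ ∀ v ∈ K.verts, ∀ w ∈ K.verts, K.graph.Reachable v w

/-- `K` is graph-based and `K ∩ x` is connected for every cell `x`. -/
def CellConnected (K : RankedFamily V) : Prop :=
  K.GraphBased ∧ ∀ x ∈ K.cells, (K.restrict x).Connected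

/-- Local cell complexes: connected and cell-connected. -/
structure IsLocal (K : RankedFamily V) : Prop where
  isCC : K.IsCC
  connected : K.Connected
  cellConnected : K.CellConnected

/-- The dual set of `A` with respect to `K`: the cells of rank `Rk K` that contain `A`. -/
def dualSet (K : RankedFamily V) (A : Set V) : Set (Set V) :=
  {z | z ∈ K.cells ∧ K.rk z = K.rank ∧ A ⊆ z}

/-- The dual graph of `K`, with the cells of rank `Rk K` as vertices and with one edge, the
dual set of `y`, for each sub-maximal cell `y` outside the boundary. -/
def dualGraph (K : RankedFamily V) : SimpleGraph (Set V) where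
  Adj z w := z ≠ w ∧
    ∃ y ∈ K.cells \ K.boundary.cells, K.rk y + 1 = K.rank ∧ K.dualSet y = {z, w}
  symm := ⟨fun z w h => by
    rw [Set.pair_comm w z]
    exact ⟨h.1.symm, h.2⟩⟩
  loopless := ⟨fun _ h => h.1 rfl⟩

/-- `x` is a `K`-pinch if the dual graph restricted to the dual set of `x` is not connected. -/
def IsPinch (K : RankedFamily V) (x : Set V) : Prop :=
  x ∈ K.cells ∧ ¬ (K.dualGraph.induce (K.dualSet x)).Preconnected

/-- There is no `K`-pinch and no `∂K`-pinch. -/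
def NonPinching (K : RankedFamily V) : Prop :=
  (∀ x, ¬ K.IsPinch x) ∧ ∀ x, ¬ K.boundary.IsPinch x

/-- The class `C` of non-singular non-pinching local cell complexes. -/
structure InC (K : RankedFamily V) : Prop where
  nonSingular : K.NonSingular
  nonPinching : K.NonPinching
  isLocal : K.IsLocal

/-- The class `B` of closed non-pinching cell-connected cell complexes. The empty complex
belongs to it. -/
structure InB (J : RankedFamily V) : Prop where
  closed : J.Closed
  nonPinching : J.NonPinching
  cellConnected : J.CellConnected

/-- The connected component of the vertex `v` in `J`. -/
def component (J : RankedFamily V) (v : V) : RankedFamily V :=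
  J.restrict {w | J.graph.Reachable v w}

/-- The image of a collection `s` of cells under `f`, where `f x` receives the rank `r x`
(meaningful if `r x` depends only on `f x`, in particular if `f` is injective on `s`). -/
noncomputable def ofImage (s : Set (Set V)) (f : Set V → Set W) (r : Set V → ℕ) :
    RankedFamily W where
  cells := f '' s
  rk := fun b => sInf {n | ∃ x ∈ s, f x = b ∧ r x = n}

open scoped Classical in
/-- The union of two families without common cells, with the induced rank function. -/
noncomputable def disjUnion (A B : RankedFamily V) : RankedFamily V where
  cells := A.cells ∪ B.cells
  rk := fun x => if x ∈ A.cells then A.rk x else B.rk x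

/-- The collar `K_J` of (the vertex set of) `J` in `K`. -/
def collar (K J : RankedFamily V) : Set (Set V) :=
  {x | x ∈ K.cells ∧ (x ∩ J.verts).Nonempty ∧ x ∩ J.verts ≠ x}

/-- The set of edges of the collar `K_J` that are contained in `x`. -/
def collarEdges (K J : RankedFamily V) (x : Set V) : Set (Set V) :=
  {e | e ∈ K.collar J ∧ K.rk e = 1 ∧ e ⊆ x}

/-- The midsection of `J` in `K`. -/
noncomputable def midsection (K J : RankedFamily V) : RankedFamily (Set V) :=
  ofImage (K.collar J) (K.collarEdges J) (fun x => K.rk x - 1)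

/-- The family of the dual sets with respect to `K` of a collection `s` of cells of `K`. -/
noncomputable def dualOn (K : RankedFamily V) (s : Set (Set V)) : RankedFamily (Set V) :=
  ofImage s K.dualSet (fun x => K.rank - K.rk x)

/-- The dual of `K`. -/
noncomputable def dual (K : RankedFamily V) : RankedFamily (Set V) := K.dualOn K.cells

/-- The generalized dual set of `A`: the union of the dual sets of `A` with respect to `K` and
with respect to `∂K`. -/
def bdualSet (K : RankedFamily V) (A : Set V) : Set (Set V) :=
  K.dualSet A ∪ K.boundary.dualSet A

/-- The family of the generalized dual sets of a collection `s` of cells of `K`. -/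
noncomputable def bdualOn (K : RankedFamily V) (s : Set (Set V)) : RankedFamily (Set V) :=
  ofImage s K.bdualSet (fun x => K.rank - K.rk x)

/-- Homomorphisms of cell complexes `J → K`. -/
structure IsHom (J : RankedFamily V) (K : RankedFamily W) (φ : Set V → Set W) : Prop where
  mapsTo : ∀ x ∈ J.cells, φ x ∈ K.cells
  mono : ∀ x ∈ J.cells, ∀ y ∈ J.cells, x ⊆ y → φ x ⊆ φ y
  exists_rk_eq : ∀ y ∈ φ '' J.cells, ∃ x ∈ J.cells, J.rk x = K.rk y ∧ φ x = y

/-- Isomorphisms of cell complexes `J → K`: homomorphisms with an inverse (on the cells)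
that is a homomorphism. -/
def IsIso (J : RankedFamily V) (K : RankedFamily W) (φ : Set V → Set W) : Prop :=
  IsHom J K φ ∧ ∃ ψ : Set W → Set V, IsHom K J ψ ∧ Set.InvOn ψ φ J.cells K.cells

/-- `J ≅ K`. -/
def Isomorphic (J : RankedFamily V) (K : RankedFamily W) : Prop := ∃ φ, IsIso J K φ

end RankedFamily

/-- Raw data of a pair `(K - J)`: `total` is `K`, `removed` is `J`. -/
structure RelFamily (V : Type*) where
  total : RankedFamily V
  removed : RankedFamily V

namespace RelFamily

variable {V W : Type*}

/-- `(K, J)` is a relative cell complex: `K` and `J` are cell complexes and `J ≤ K`. -/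
structure IsRelCC (X : RelFamily V) : Prop where
  total_isCC : X.total.IsCC
  removed_isCC : X.removed.IsCC
  isSub : X.removed.IsSub X.total

/-- No cell outside `J` has all its vertices in `J`. -/
structure NonDegenerate (X : RelFamily V) : Prop where
  isRelCC : X.IsRelCC
  not_subset : ∀ x ∈ X.total.cells \ X.removed.cells, ¬ x ⊆ X.removed.verts

/-- Local relative cell complexes: `(K, J)` is non-degenerate, `K` is local, and every
connected component `J₀` of `J` meets each cell of its collar in a connected complex and has
a cell-connected midsection. -/
structure IsLocal (X : RelFamily V) : Prop where
  nonDegenerate : X.NonDegenerate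
  total_isLocal : X.total.IsLocal
  inter_connected : ∀ v ∈ X.removed.verts, ∀ x ∈ X.total.collar (X.removed.component v),
    ((X.removed.component v).restrict x).Connected
  midsection_cellConnected : ∀ v ∈ X.removed.verts,
    (X.total.midsection (X.removed.component v)).CellConnected

/-- `(K, J)` is exactly collared: it is non-degenerate and the midsection is isomorphic to `J`
through the map that sends the cell given by `x` in the collar to the cell `J ∩ x`. -/
structure ExactlyCollared (X : RelFamily V) : Prop where
  nonDegenerate : X.NonDegenerate
  exists_iso : ∃ φ, RankedFamily.IsIso (X.total.midsection X.removed) X.removed φ ∧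
    ∀ x ∈ X.total.collar X.removed,
      φ (X.total.collarEdges X.removed x) = x ∩ X.removed.verts

/-- Cobordisms `(K - J)`: `K` belongs to the class `C`, `J ≤ ∂K` belongs to the class `B` and
has rank `Rk K - 1` unless it is empty, and `(K, J)` is non-degenerate and local. -/
structure IsCobordism (X : RelFamily V) : Prop where
  total_mem : X.total.InC
  removed_isSub : X.removed.IsSub X.total.boundary
  removed_mem : X.removed.InB
  removed_rank : X.removed.cells.Nonempty → X.removed.rank + 1 = X.total.rank
  nonDegenerate : X.NonDegenerate
  isLocal : X.IsLocal

/-- The boundary of `(K - J)` is `∂K`. -/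
def boundary (X : RelFamily V) : RankedFamily V := X.total.boundary

/-- The dual `(∂K ∖ J)*` of the outgoing boundary (dual sets are taken in `∂K`). -/
noncomputable def outgoingDual (X : RelFamily V) : RankedFamily (Set V) :=
  X.boundary.dualOn (X.boundary.cells \ X.removed.cells)

/-- The dual of `(K - J)`: its cells are the generalized duals of the cells in `K ∖ J` and the
duals in `∂K` of the cells in `∂K ∖ J`, the latter being its removed cells. -/
noncomputable def dual (X : RelFamily V) : RelFamily (Set V) where
  total := (X.total.bdualOn (X.total.cells \ X.removed.cells)).disjUnion X.outgoingDual
  removed := X.outgoingDual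

/-- `(K - J) ≅ (K' - J')`: an isomorphism `K → K'` that maps `J` onto `J'`. -/
def Isomorphic (X : RelFamily V) (Y : RelFamily W) : Prop :=
  ∃ φ, RankedFamily.IsIso X.total Y.total φ ∧ φ '' X.removed.cells = Y.removed.cells

end RelFamily

/-! ### Cell complexes: ranks, chains, diamonds and intersections. -/

namespace RankedFamily

variable {V : Type*} {K J : RankedFamily V} {x y z w : Set V} {u v : V}

/-! Everything rests on an explicit description of the face order of the dual. Exact collaring is
first put in the working form `RelFamily.Collared`: cutting down to the vertices of `J` is an order
isomorphism from the collar to `J` that lowers rank by one (`ExactlyCollared.collared`, with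
converse `Collared.exactlyCollared`). Since `J` and `∂K` are both closed, a boundary cell then lies
in `J` or misses it (`IsCobordism.subset_of_mem_boundary`). So the data are the cells outside `J`
(`inner`) and the boundary cells disjoint from `J` (`outer`), and the cells of the dual are `tilde
x` for `x` inner and `star x` for `x` outer.

A cell is the intersection of its generalized dual set (`NonSingular.sInter_bdualSet`), and a
boundary cell is the intersection of its dual set in the closed complex `∂K`. Hence each of `tilde x
⊆ tilde y`, `star x ⊆ tilde y`, `star x ⊆ star y` amounts to `y ⊆ x`, while `tilde x ⊆ star y` never
holds. The cell complex axioms for the dual follow by reversing those of `K`, the one new diamond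
being `star x`, `tilde x`, `star y`, `tilde y`.

Connectedness and absence of pinches trade places. Cells of the dual are connected because `K` and
`∂K` have no pinch. Conversely, the dual has no pinch at `tilde x` because `x` stays connected once
the vertices of `J` are deleted. This is the hardest point, `IsCobordism.linkedOn_diff`: a path
through `J` is rerouted along the two-cells given by the cell-connected midsection, and a two-cell
minus its edge in `J` is connected by a parity argument. Parity also shows that `∂K` is closed.

Finally, the boundary of the dual consists of `tilde x` for `x` in the collar, a copy of the dual of
`J`, and of `star x` for `x` outer. The collar of the dual consists of `tilde x` for `x` outer,
lying over `star x`. So dualizing exchanges the two ends, and dualizing twice returns the original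
pair, the inverse being given by iterated intersections. -/

theorem IsCC.finite_cells (h : K.IsCC) : K.cells.Finite :=
  h.finite_verts.finite_subsets.subset h.subset_verts

theorem IsCC.rk_le_rank (h : K.IsCC) (hx : x ∈ K.cells) : K.rk x ≤ K.rank := by
  have hb : ({R | ∀ x ∈ K.cells, K.rk x ≤ R}).Nonempty := by
    obtain ⟨b, hb⟩ := (h.finite_cells.image K.rk).bddAbove
    exact ⟨b, fun x hx => hb ⟨x, hx, rfl⟩⟩
  exact Nat.sInf_mem hb x hx

theorem rank_eq_of_forall_le {n : ℕ} (hx : x ∈ K.cells) (hn : K.rk x = n)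
    (h : ∀ y ∈ K.cells, K.rk y ≤ n) : K.rank = n :=
  le_antisymm (Nat.sInf_le h)
    (le_csInf ⟨n, h⟩ fun _ hR => hn ▸ hR x hx)

theorem rank_eq_zero_of_empty (h : K.cells = ∅) : K.rank = 0 :=
  Nat.eq_zero_of_le_zero (Nat.sInf_le fun x hx => by simp [h] at hx)

theorem IsCC.rk_mono (h : K.IsCC) (hx : x ∈ K.cells) (hy : y ∈ K.cells) (hxy : x ⊆ y) :
    K.rk x ≤ K.rk y := by
  rcases eq_or_ne x y with rfl | hne
  · exact le_rfl
  · exact (h.rk_lt_rk x hx y hy (hxy.ssubset_of_ne hne)).le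

theorem IsCC.eq_of_subset (h : K.IsCC) (hx : x ∈ K.cells) (hy : y ∈ K.cells) (hxy : x ⊆ y)
    (hr : K.rk y ≤ K.rk x) : x = y := by
  by_contra hne
  exact absurd (h.rk_lt_rk x hx y hy (hxy.ssubset_of_ne hne)) (not_lt.2 hr)

theorem IsCC.singleton_mem (h : K.IsCC) (hx : x ∈ K.cells) (hv : v ∈ x) : {v} ∈ K.cells :=
  h.subset_verts x hx hv

theorem IsCC.rk_singleton (h : K.IsCC) (hv : {v} ∈ K.cells) : K.rk {v} = 0 :=
  (h.rk_eq_zero_iff _ hv).2 ⟨v, rfl⟩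

theorem IsCC.exists_coface_of_rk_lt (h : K.IsCC) (hx : x ∈ K.cells) (hy : y ∈ K.cells)
    (hxy : x ⊆ y) (hr : K.rk x < K.rk y) :
    ∃ z ∈ K.cells, x ⊆ z ∧ z ⊆ y ∧ K.rk z = K.rk x + 1 := by
  obtain ⟨z, ⟨hz, hxz, hrz⟩, hzy⟩ := h.exists_coface x hx y hy
    (hxy.ssubset_of_ne (by rintro rfl; exact lt_irrefl _ hr))
  exact ⟨z, hz, hxz, hzy, hrz⟩

theorem IsCC.exists_between (h : K.IsCC) (hx : x ∈ K.cells) (hy : y ∈ K.cells)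
    (hxy : x ⊆ y) {m : ℕ} (h1 : K.rk x ≤ m) (h2 : m ≤ K.rk y) :
    ∃ z ∈ K.cells, x ⊆ z ∧ z ⊆ y ∧ K.rk z = m := by
  induction m, h1 using Nat.le_induction with
  | base => exact ⟨x, hx, le_rfl, hxy, rfl⟩
  | succ m hm ih =>
    obtain ⟨z, hz, hxz, hzy, rfl⟩ := ih (by omega)
    obtain ⟨w, hw, hzw, hwy, hrw⟩ := h.exists_coface_of_rk_lt hz hy hzy (by omega)
    exact ⟨w, hw, hxz.trans hzw, hwy, hrw⟩

theorem IsCC.exists_face (h : K.IsCC) (hx : x ∈ K.cells) (hy : y ∈ K.cells)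
    (hxy : x ⊆ y) (hr : K.rk x < K.rk y) :
    ∃ z ∈ K.cells, x ⊆ z ∧ z ⊆ y ∧ K.rk z + 1 = K.rk y := by
  obtain ⟨z, hz, hxz, hzy, hrz⟩ := h.exists_between hx hy hxy (m := K.rk y - 1)
    (by omega) (by omega)
  exact ⟨z, hz, hxz, hzy, by omega⟩

/-- The diamond property, relative to one of the two middle cells. -/
theorem IsCC.exists_diamond (h : K.IsCC) (hx : x ∈ K.cells) (hy : y ∈ K.cells)
    (hz : z ∈ K.cells) (hxz : x ⊆ z) (hzy : z ⊆ y) (h1 : K.rk z = K.rk x + 1)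
    (h2 : K.rk y = K.rk z + 1) :
    ∃ z' ∈ K.cells, z' ≠ z ∧ x ⊆ z' ∧ z' ⊆ y ∧ K.rk z' = K.rk z ∧
      ∀ w ∈ K.cells, x ⊆ w → w ⊆ y → K.rk w = K.rk z → w = z ∨ w = z' := by
  obtain ⟨z₁, z₂, hne, he⟩ := h.diamond x hx y hy (hxz.trans hzy) (by omega)
  have key : ∀ w, (w = z₁ ∨ w = z₂) ↔ (w ∈ K.cells ∧ x ⊆ w ∧ w ⊆ y ∧ K.rk w = K.rk z) := by
    intro w
    have : w ∈ K.cofaces x ∩ K.faces y ↔ w = z₁ ∨ w = z₂ := by rw [he]; simp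
    rw [← this]
    simp only [cofaces, faces, Set.mem_inter_iff, Set.mem_ofPred_eq]
    constructor
    · rintro ⟨⟨a, b, c⟩, -, d, e⟩
      exact ⟨a, b, d, by omega⟩
    · rintro ⟨a, b, c, d⟩
      exact ⟨⟨a, b, by omega⟩, a, c, by omega⟩
  have h1' := (key z₁).1 (.inl rfl)
  have h2' := (key z₂).1 (.inr rfl)
  rcases (key z).2 ⟨hz, hxz, hzy, rfl⟩ with rfl | rfl
  · exact ⟨z₂, h2'.1, hne.symm, h2'.2.1, h2'.2.2.1, h2'.2.2.2,
      fun w a b c d => (key w).2 ⟨a, b, c, d⟩⟩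
  · exact ⟨z₁, h1'.1, hne, h1'.2.1, h1'.2.2.1, h1'.2.2.2,
      fun w a b c d => ((key w).2 ⟨a, b, c, d⟩).symm⟩

theorem IsCC.inter_mem_of_subset (h : K.IsCC) (hx : x ∈ K.cells) (hz : z ∈ K.cells)
    (hw : w ∈ K.cells) (hxz : x ⊆ z) (hxw : x ⊆ w) : z ∩ w ∈ K.cells :=
  h.inter_mem z hz w hw ((h.nonempty_of_mem x hx).mono (Set.subset_inter hxz hxw))

/-- Two distinct co-faces of a cell meet in that cell. -/
theorem IsCC.inter_cofaces (h : K.IsCC) (hx : x ∈ K.cells) (hz : z ∈ K.cells)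
    (hw : w ∈ K.cells) (hxz : x ⊆ z) (hxw : x ⊆ w) (hne : z ≠ w) (h1 : K.rk z = K.rk x + 1)
    (h2 : K.rk w = K.rk x + 1) : z ∩ w = x := by
  have hm := h.inter_mem_of_subset hx hz hw hxz hxw
  refine (h.eq_of_subset hx hm (Set.subset_inter hxz hxw) ?_).symm
  by_contra hlt
  have hzw : z ∩ w = z := h.eq_of_subset hm hz Set.inter_subset_left (by omega)
  exact hne (h.eq_of_subset hz hw (Set.inter_eq_left.1 hzw) (by omega))

theorem IsCC.inter_faces (h : K.IsCC) (hx : x ∈ K.cells) (hz : z ∈ K.cells)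
    (hw : w ∈ K.cells) (hxz : x ⊆ z) (hxw : x ⊆ w) (hne : z ≠ w) (h1 : K.rk z = K.rk x + 1)
    (h2 : K.rk w = K.rk z) : z ∩ w = x :=
  h.inter_cofaces hx hz hw hxz hxw hne h1 (by omega)

theorem IsCC.sInter_mem (h : K.IsCC) {S : Set (Set V)} (hS : S ⊆ K.cells) (hne : S.Nonempty)
    (hx : x ∈ K.cells) (hxS : ∀ z ∈ S, x ⊆ z) : ⋂₀ S ∈ K.cells := by
  have hf : S.Finite := h.finite_cells.subset hS
  induction S, hf using Set.Finite.induction_on with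
  | empty => exact absurd hne (by simp)
  | @insert a s _ _ ih =>
    rcases s.eq_empty_or_nonempty with rfl | hs
    · simpa using hS (Set.mem_insert _ _)
    · rw [Set.sInter_insert]
      have := ih (fun z hz => hS (Set.mem_insert_of_mem _ hz)) hs
        (fun z hz => hxS z (Set.mem_insert_of_mem _ hz))
      exact h.inter_mem_of_subset hx (hS (Set.mem_insert _ _)) this
        (hxS a (Set.mem_insert _ _))
        (Set.subset_sInter fun z hz => hxS z (Set.mem_insert_of_mem _ hz))

/-- A lower subfamily of a cell complex is a cell complex. -/
theorem IsCC.of_isLower (h : K.IsCC) (hs : J.IsSub K)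
    (hl : ∀ x ∈ K.cells, ∀ y ∈ J.cells, x ⊆ y → x ∈ J.cells) : J.IsCC where
  finite_verts := h.finite_verts.subset fun _ hv => hs.1 hv
  nonempty_of_mem x hx := h.nonempty_of_mem x (hs.1 hx)
  subset_verts x hx v hv := hl _ (h.singleton_mem (hs.1 hx) hv) x hx (by simpa using hv)
  rk_eq_zero_iff x hx := by rw [hs.2 x hx]; exact h.rk_eq_zero_iff x (hs.1 hx)
  rk_lt_rk x hx y hy hxy := by
    rw [hs.2 x hx, hs.2 y hy]; exact h.rk_lt_rk x (hs.1 hx) y (hs.1 hy) hxy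
  inter_mem x hx y hy hxy :=
    hl _ (h.inter_mem x (hs.1 hx) y (hs.1 hy) hxy) x hx Set.inter_subset_left
  exists_coface x hx y hy hxy := by
    obtain ⟨z, ⟨hz, hxz, hr⟩, hzy⟩ := h.exists_coface x (hs.1 hx) y (hs.1 hy) hxy
    have hzJ := hl z hz y hy hzy
    exact ⟨z, ⟨hzJ, hxz, by rw [hs.2 z hzJ, hs.2 x hx, hr]⟩, hzy⟩
  diamond x hx y hy hxy hr := by
    rw [hs.2 x hx, hs.2 y hy] at hr
    obtain ⟨z₁, z₂, hne, he⟩ := h.diamond x (hs.1 hx) y (hs.1 hy) hxy hr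
    refine ⟨z₁, z₂, hne, ?_⟩
    rw [← he]
    ext z
    simp only [cofaces, faces, Set.mem_inter_iff, Set.mem_ofPred_eq]
    constructor
    · rintro ⟨⟨a, b, c⟩, -, d, e⟩
      rw [hs.2 z a, hs.2 x hx] at c
      rw [hs.2 z a, hs.2 y hy] at e
      exact ⟨⟨hs.1 a, b, c⟩, hs.1 a, d, e⟩
    · rintro ⟨⟨a, b, c⟩, -, d, e⟩
      have hzJ := hl z a y hy d
      rw [← hs.2 z hzJ, ← hs.2 x hx] at c
      rw [← hs.2 z hzJ, ← hs.2 y hy] at e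
      exact ⟨⟨hzJ, b, c⟩, hzJ, d, e⟩

/-- A cell `x` of `z` is cut out by faces of `z`. -/
theorem IsCC.exists_face_notMem (h : K.IsCC) (hz : z ∈ K.cells) (hvz : v ∈ z) :
    ∀ x ∈ K.cells, x ⊆ z → v ∉ x →
      ∃ y ∈ K.cells, K.rk y + 1 = K.rk z ∧ x ⊆ y ∧ y ⊆ z ∧ v ∉ y := by
  suffices H : ∀ n, ∀ x ∈ K.cells, x ⊆ z → v ∉ x → K.rk z ≤ K.rk x + n →
      ∃ y ∈ K.cells, K.rk y + 1 = K.rk z ∧ x ⊆ y ∧ y ⊆ z ∧ v ∉ y from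
    fun x hx hxz hv => H (K.rk z) x hx hxz hv (by omega)
  intro n
  induction n with
  | zero =>
    intro x hx hxz hv hr
    exact absurd (h.eq_of_subset hx hz hxz (by omega)) (by rintro rfl; exact hv hvz)
  | succ n ih =>
    intro x hx hxz hv hr
    have hlt : K.rk x < K.rk z := h.rk_lt_rk x hx z hz
      (hxz.ssubset_of_ne (by rintro rfl; exact hv hvz))
    rcases Nat.lt_or_ge (K.rk x + 1) (K.rk z) with hlt2 | hge
    · obtain ⟨w, hw, hxw, hwz, hrw⟩ := h.exists_coface_of_rk_lt hx hz hxz hlt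
      by_cases hvw : v ∈ w
      · obtain ⟨a, ha, hwa, haz, hra⟩ := h.exists_coface_of_rk_lt hw hz hwz (by omega)
        -- If the chosen co-face of `x` contains `v`, the opposite corner of a diamond does not,
        -- since the two corners meet in `x`.
        obtain ⟨w', hw', hne, hxw', hwa', hrw', -⟩ :=
          h.exists_diamond hx ha hw hxw hwa hrw hra
        have hi := h.inter_faces hx hw hw' hxw hxw' hne.symm hrw hrw'
        obtain ⟨y, hy, hry, hwy, hyz, hvy⟩ := ih w' hw' (hwa'.trans haz)
          (fun hvw' => hv (hi ▸ ⟨hvw, hvw'⟩)) (by omega)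
        exact ⟨y, hy, hry, hxw'.trans hwy, hyz, hvy⟩
      · obtain ⟨y, hy, hry, hwy, hyz, hvy⟩ := ih w hw hwz hvw (by omega)
        exact ⟨y, hy, hry, hxw.trans hwy, hyz, hvy⟩
    · exact ⟨x, hx, by omega, le_rfl, hxz, hv⟩

/-- A cell `x` properly containing `w` has a co-face of any given cell of `w` outside `w`. -/
theorem IsCC.exists_coface_not_subset (h : K.IsCC) {a : Set V} (ha : a ∈ K.cells) :
    ∀ w ∈ K.cells, ∀ x ∈ K.cells, a ⊆ w → w ⊂ x →
      ∃ g ∈ K.cells, K.rk g = K.rk a + 1 ∧ a ⊆ g ∧ g ⊆ x ∧ ¬ g ⊆ w := by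
  suffices H : ∀ n, ∀ w ∈ K.cells, ∀ x ∈ K.cells, a ⊆ w → w ⊂ x → K.rk x ≤ n →
      ∃ g ∈ K.cells, K.rk g = K.rk a + 1 ∧ a ⊆ g ∧ g ⊆ x ∧ ¬ g ⊆ w from
    fun w hw x hx h1 h2 => H _ w hw x hx h1 h2 le_rfl
  intro n
  induction n with
  | zero =>
    intro w hw x hx _ hwx hr
    have := h.rk_lt_rk w hw x hx hwx
    omega
  | succ n ih =>
    intro w hw x hx haw hwx hr
    obtain ⟨w', hw', hww', hwx', hrw'⟩ := h.exists_face hw hx hwx.1 (h.rk_lt_rk w hw x hx hwx)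
    suffices ∃ g ∈ K.cells, K.rk g = K.rk a + 1 ∧ a ⊆ g ∧ g ⊆ x ∧ ¬ g ⊆ w' by
      obtain ⟨g, h1, h2, h3, h4, h5⟩ := this
      exact ⟨g, h1, h2, h3, h4, fun h6 => h5 (h6.trans hww')⟩
    have haw' := haw.trans hww'
    rcases eq_or_ne a w' with rfl | hne
    · exact ⟨x, hx, hrw'.symm, hwx', le_rfl, fun h1 => by
        have := h.rk_mono hx hw' h1
        omega⟩
    · obtain ⟨b, hb, hab, hbw, hrb⟩ := h.exists_face ha hw' haw'
        (h.rk_lt_rk a ha w' hw' (haw'.ssubset_of_ne hne))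
      -- The other middle cell `y` meets `w'` exactly in `b`, so a co-face of `a` in `y` that leaves
      -- `b` also leaves `w'`. The rank of `y` is below that of `x`, and the induction applies to `b
      -- ⊂ y`.
      obtain ⟨y, hy, hyne, hby, hyx, hry, -⟩ :=
        h.exists_diamond hb hx hw' hbw hwx' hrb.symm hrw'.symm
      have hi := h.inter_faces hb hw' hy hbw hby hyne.symm hrb.symm hry
      have hby' : b ⊂ y := hby.ssubset_of_ne (by rintro rfl; omega)
      obtain ⟨g, h1, h2, h3, h4, h5⟩ := ih b hb y hy hab hby' (by omega)
      exact ⟨g, h1, h2, h3, h4.trans hyx, fun h6 => h5 (hi ▸ Set.subset_inter h6 h4)⟩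

/-- The vertices of an edge. -/
theorem GraphBased.exists_pair (hg : K.GraphBased) {e : Set V} (he : e ∈ K.cells)
    (hr : K.rk e = 1) (hu : u ∈ e) : ∃ v, v ≠ u ∧ e = {u, v} := by
  obtain ⟨a, b, hab, rfl⟩ := Set.encard_eq_two.1 (hg e he hr)
  rcases hu with rfl | hu
  · exact ⟨b, hab.symm, rfl⟩
  · obtain rfl : u = b := hu
    exact ⟨a, hab, Set.pair_comm _ _⟩

theorem mem_dualSet {A t : Set V} :
    t ∈ K.dualSet A ↔ t ∈ K.cells ∧ K.rk t = K.rank ∧ A ⊆ t := Iff.rfl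

theorem cofaces_eq_dualSet (hr : K.rk y + 1 = K.rank) : K.cofaces y = K.dualSet y := by
  ext z
  simp only [cofaces, dualSet, Set.mem_ofPred_eq, ← hr]
  tauto

theorem Pure.exists_top (hp : K.Pure) (h : K.IsCC) (hx : x ∈ K.cells) :
    ∃ z ∈ K.cells, x ⊆ z ∧ K.rk z = K.rank := by
  have hf : {y | y ∈ K.cells ∧ x ⊆ y}.Finite := h.finite_cells.subset fun y hy => hy.1
  obtain ⟨z, hxz, hz⟩ := hf.exists_le_maximal (a := x) ⟨hx, le_rfl⟩
  refine ⟨z, hz.1.1, hxz, hp z hz.1.1 fun y hy hzy => ?_⟩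
  exact le_antisymm (hz.2 ⟨hy, hxz.trans hzy⟩ hzy) hzy

theorem Pure.of_exists_top (h : ∀ x ∈ K.cells, ∃ z ∈ K.cells, x ⊆ z ∧ K.rk z = K.rank) :
    K.Pure := by
  intro x hx hm
  obtain ⟨z, hz, hxz, hr⟩ := h x hx
  rwa [← hm z hz hxz]

end RankedFamily

/-- Double counting modulo two: an incidence relation between two finite sets cannot have
exactly one element of odd degree. -/
theorem Set.not_existsUnique_odd_ncard {α β : Type*} {s : Set α} {t : Set β} (hs : s.Finite)
    (ht : t.Finite) (r : α → β → Prop) (h : ∀ a ∈ s, Even {b | b ∈ t ∧ r a b}.ncard)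
    {b₀ : β} (hb₀ : b₀ ∈ t) (hodd : Odd {a | a ∈ s ∧ r a b₀}.ncard)
    (h' : ∀ b ∈ t, b ≠ b₀ → Even {a | a ∈ s ∧ r a b}.ncard) : False := by
  classical
  lift s to Finset α using hs
  lift t to Finset β using ht
  have e1 : ∀ a, {b | b ∈ (t : Set β) ∧ r a b}.ncard = (t.bipartiteAbove r a).card := by
    intro a
    rw [← Set.ncard_coe_finset]
    congr 1
    ext b
    simp [Finset.bipartiteAbove]
  have e2 : ∀ b, {a | a ∈ (s : Set α) ∧ r a b}.ncard = (s.bipartiteBelow r b).card := by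
    intro b
    rw [← Set.ncard_coe_finset]
    congr 1
    ext a
    simp [Finset.bipartiteBelow]
  simp only [e1, e2] at h h' hodd
  have hsum := Finset.sum_card_bipartiteAbove_eq_sum_card_bipartiteBelow (s := s) (t := t) r
  have hev : Even (∑ a ∈ s, (t.bipartiteAbove r a).card) :=
    Finset.even_sum _ fun a ha => h a ha
  rw [hsum, ← Finset.add_sum_erase t _ (Finset.mem_coe.1 hb₀)] at hev
  have hev' : Even (∑ b ∈ t.erase b₀, (s.bipartiteBelow r b).card) :=
    Finset.even_sum _ fun b hb =>
      h' b (Finset.mem_of_mem_erase hb) (Finset.ne_of_mem_erase hb)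
  exact (Nat.not_even_iff_odd.2 (hodd.add_even hev')) hev

/-! ### Boundaries and generalized dual sets. -/

namespace RankedFamily

variable {V : Type*} {K : RankedFamily V} {x y z w t : Set V} {u v : V}

theorem boundary_isSub : K.boundary.IsSub K := ⟨fun _ hx => hx.1, fun _ _ => rfl⟩

theorem mem_boundary_of_subset (hx : x ∈ K.cells) (hy : y ∈ K.boundary.cells) (hxy : x ⊆ y) :
    x ∈ K.boundary.cells := by
  obtain ⟨-, w, hw, hr, hz, hyw⟩ := hy
  exact ⟨hx, w, hw, hr, hz, hxy.trans hyw⟩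

theorem IsCC.boundary (h : K.IsCC) : K.boundary.IsCC :=
  h.of_isLower boundary_isSub fun _ hx _ hy => mem_boundary_of_subset hx hy

theorem exists_facet_of_mem_boundary (hx : x ∈ K.boundary.cells) :
    ∃ y ∈ K.boundary.cells, x ⊆ y ∧ K.rk y + 1 = K.rank := by
  obtain ⟨-, y, hy, hr, hz, hxy⟩ := hx
  exact ⟨y, ⟨hy, y, hy, hr, hz, le_rfl⟩, hxy, hr⟩

theorem IsCC.rk_lt_rank_of_mem_boundary (h : K.IsCC) (hx : x ∈ K.boundary.cells) :
    K.rk x + 1 ≤ K.rank := by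
  obtain ⟨y, hy, hxy, hr⟩ := exists_facet_of_mem_boundary hx
  have := h.rk_mono hx.1 hy.1 hxy
  omega

theorem IsCC.boundary_rank (h : K.IsCC) (hne : K.boundary.cells.Nonempty) :
    K.boundary.rank + 1 = K.rank := by
  obtain ⟨x, hx⟩ := hne
  obtain ⟨y, hy, -, hr⟩ := exists_facet_of_mem_boundary hx
  have : K.boundary.rank = K.rank - 1 :=
    rank_eq_of_forall_le hy (show K.rk y = _ by omega) fun z hz => by
      have := h.rk_lt_rank_of_mem_boundary hz
      show K.rk z ≤ _
      omega
  omega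

theorem IsCC.exists_cofaces_eq_of_mem_boundary (h : K.IsCC) (hx : x ∈ K.boundary.cells)
    (hr : K.rk x + 1 = K.rank) : ∃ z, K.cofaces x = {z} := by
  obtain ⟨hxK, y, hy, hry, hz, hxy⟩ := hx
  rwa [h.eq_of_subset hxK hy hxy (by omega)]

theorem boundary_pure (h : K.IsCC) : K.boundary.Pure :=
  .of_exists_top fun x hx => by
    obtain ⟨y, hy, hxy, hr⟩ := exists_facet_of_mem_boundary hx
    have := h.boundary_rank ⟨x, hx⟩
    exact ⟨y, hy, hxy, show K.rk y = _ by omega⟩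

theorem IsCC.mem_boundary_dualSet (h : K.IsCC) {A : Set V} :
    t ∈ K.boundary.dualSet A ↔ t ∈ K.boundary.cells ∧ K.rk t + 1 = K.rank ∧ A ⊆ t := by
  rw [mem_dualSet]
  refine and_congr_right fun ht => and_congr_left fun _ => ?_
  have := h.boundary_rank ⟨t, ht⟩
  show K.rk t = _ ↔ _
  omega

theorem IsCC.mem_bdualSet (h : K.IsCC) {A : Set V} :
    t ∈ K.bdualSet A ↔ A ⊆ t ∧ (t ∈ K.cells ∧ K.rk t = K.rank ∨
      t ∈ K.boundary.cells ∧ K.rk t + 1 = K.rank) := by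
  rw [bdualSet, Set.mem_union, h.mem_boundary_dualSet, mem_dualSet]
  tauto

/-- Take a top cell over `x` and, if it contains `v`, a facet `y` of it that contains `x` but not
`v`. Either `y` has a second co-face, which meets the first in `y` and so omits `v`, or `y` is a
boundary facet and is itself a member. The second case is why boundary facets must be added to the
dual set. -/
theorem NonSingular.exists_mem_bdualSet_notMem (hK : K.NonSingular) (hx : x ∈ K.cells)
    (hv : v ∉ x) : ∃ t ∈ K.bdualSet x, v ∉ t := by
  have h := hK.isCC
  obtain ⟨z, hz, hxz, hrz⟩ := hK.pure.exists_top h hx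
  by_cases hvz : v ∈ z
  · obtain ⟨y, hy, hry, hxy, hyz, hvy⟩ := h.exists_face_notMem hz hvz x hx hxz hv
    by_cases hb : ∃ z, K.cofaces y = {z}
    · exact ⟨y, h.mem_bdualSet.2 ⟨hxy, .inr ⟨⟨hy, y, hy, by omega, hb, le_rfl⟩, by omega⟩⟩, hvy⟩
    · have hzc : z ∈ K.cofaces y := ⟨hz, hyz, by omega⟩
      have : ∃ z' ∈ K.cofaces y, z' ≠ z := by
        by_contra! hall
        exact hb ⟨z, Set.eq_singleton_iff_unique_mem.2 ⟨hzc, hall⟩⟩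
      obtain ⟨z', ⟨hz', hyz', hrz'⟩, hne⟩ := this
      have hi := h.inter_cofaces hy hz hz' hyz hyz' hne.symm hzc.2.2 hrz'
      exact ⟨z', h.mem_bdualSet.2 ⟨hxy.trans hyz', .inl ⟨hz', by omega⟩⟩,
        fun hvz' => hvy (hi ▸ ⟨hvz, hvz'⟩)⟩
  · exact ⟨z, h.mem_bdualSet.2 ⟨hxz, .inl ⟨hz, hrz⟩⟩, hvz⟩

theorem NonSingular.sInter_bdualSet (hK : K.NonSingular) (hx : x ∈ K.cells) :
    ⋂₀ K.bdualSet x = x := by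
  refine subset_antisymm (fun v hv => ?_)
    (Set.subset_sInter fun t ht => (hK.isCC.mem_bdualSet.1 ht).1)
  by_contra hvx
  obtain ⟨t, ht, hvt⟩ := hK.exists_mem_bdualSet_notMem hx hvx
  exact hvt (hv t ht)

theorem bdualSet_anti {A A' : Set V} (h : A ⊆ A') : K.bdualSet A' ⊆ K.bdualSet A :=
  Set.union_subset_union (fun _ ht => ⟨ht.1, ht.2.1, h.trans ht.2.2⟩)
    (fun _ ht => ⟨ht.1, ht.2.1, h.trans ht.2.2⟩)

theorem dualSet_anti {A A' : Set V} (h : A ⊆ A') : K.dualSet A' ⊆ K.dualSet A :=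
  fun _ ht => ⟨ht.1, ht.2.1, h.trans ht.2.2⟩

theorem NonSingular.bdualSet_subset_iff (hK : K.NonSingular) (hx : x ∈ K.cells) :
    K.bdualSet x ⊆ K.bdualSet y ↔ y ⊆ x := by
  refine ⟨fun h => ?_, bdualSet_anti⟩
  rw [← hK.sInter_bdualSet hx]
  exact Set.subset_sInter fun t ht => (hK.isCC.mem_bdualSet.1 (h ht)).1

theorem bdualSet_eq_dualSet (h : K.boundary.cells = ∅) {A : Set V} :
    K.bdualSet A = K.dualSet A := by
  rw [bdualSet, Set.union_eq_left]
  intro t ht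
  have := ht.1
  simp [h] at this

theorem Closed.sInter_dualSet (hK : K.Closed) (hx : x ∈ K.cells) : ⋂₀ K.dualSet x = x := by
  rw [← bdualSet_eq_dualSet hK.2, hK.1.sInter_bdualSet hx]

/-- A sub-maximal boundary cell has a single co-face, so it could never give a pair of distinct top
cells: excluding the boundary is automatic. -/
theorem IsCC.dualGraph_adj_iff (h : K.IsCC) :
    K.dualGraph.Adj z w ↔ z ≠ w ∧ ∃ y ∈ K.cells, K.rk y + 1 = K.rank ∧ K.dualSet y = {z, w} := by
  refine and_congr_right fun hne => exists_congr fun y => ⟨fun ⟨h1, h2⟩ => ⟨h1.1, h2⟩,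
    fun ⟨h1, h2, h3⟩ => ⟨⟨h1, fun hb => ?_⟩, h2, h3⟩⟩
  obtain ⟨a, ha⟩ := h.exists_cofaces_eq_of_mem_boundary hb h2
  rw [cofaces_eq_dualSet h2, h3] at ha
  have h1 : z = a := by simpa using ha.subset (Set.mem_insert _ _)
  have h2 : w = a := by simpa using ha.subset (Set.mem_insert_of_mem _ rfl)
  exact hne (h1.trans h2.symm)

/-- If `y` has two distinct co-faces, a path between them in the dual graph over `y` starts with an
edge from `z` to some `c`, given by a sub-maximal `a`. Both `a` and `y` equal `z ∩ c`, so the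
co-faces of `y` are just `z` and `c`. Applied to `∂K`, where non-branching is not a hypothesis. -/
theorem IsCC.encard_cofaces_le (h : K.IsCC) (hp : ∀ x, ¬ K.IsPinch x) (hy : y ∈ K.cells)
    (hr : K.rk y + 1 = K.rank) : (K.cofaces y).encard ≤ 2 := by
  rw [cofaces_eq_dualSet hr]
  by_cases hs : (K.dualSet y).Subsingleton
  · exact (Set.encard_le_one_iff_subsingleton.2 hs).trans (by norm_num)
  · obtain ⟨z, hz, w, hw, hne⟩ := Set.not_subsingleton_iff.1 hs
    have hc : (K.dualGraph.induce (K.dualSet y)).Preconnected := by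
      by_contra hc
      exact hp y ⟨hy, hc⟩
    obtain ⟨p⟩ := hc ⟨z, hz⟩ ⟨w, hw⟩
    cases p with
    | nil => exact absurd rfl hne
    | @cons _ c _ hadj _ =>
      obtain ⟨c, hc⟩ := c
      obtain ⟨hzc, a, ha, hra, hda⟩ := h.dualGraph_adj_iff.1 (SimpleGraph.comap_adj.1 hadj)
      simp only [Function.Embedding.subtype_apply] at hzc hda
      have haz : z ∈ K.dualSet a := hda ▸ Set.mem_insert _ _
      have hac : c ∈ K.dualSet a := hda ▸ Set.mem_insert_of_mem _ rfl
      have h1 := h.inter_cofaces ha haz.1 hac.1 haz.2.2 hac.2.2 hzc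
        (by rw [haz.2.1, hra]) (by rw [hac.2.1, hra])
      have h2 := h.inter_cofaces hy hz.1 hc.1 hz.2.2 hc.2.2 hzc
        (by rw [haz.2.1, hr]) (by rw [hac.2.1, hr])
      rw [← h2, h1, hda]
      exact (Set.encard_pair hzc).le

theorem GraphBased.boundary (hg : K.GraphBased) : K.boundary.GraphBased :=
  fun e he hr => hg e he.1 hr

/-- Count incidences between top cells and facets of `K` containing `x`. Each top cell has two such
facets by the diamond property; a facet has one co-face if it is in the boundary and two otherwise.
A lone boundary facet over `x` would be the only element of odd degree. -/
theorem NonSingular.cofaces_boundary_ne (hK : K.NonSingular) (hx : x ∈ K.boundary.cells)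
    (hr : K.rk x + 2 = K.rank) (t : Set V) : K.boundary.cofaces x ≠ {t} := by
  intro ht
  have h := hK.isCC
  have hfin := h.finite_cells
  have htm : t ∈ K.boundary.cofaces x := by rw [ht]; rfl
  have hrt : K.rk t = K.rk x + 1 := htm.2.2
  have htb : t ∈ K.boundary.cells := htm.1
  refine Set.not_existsUnique_odd_ncard (s := {z | z ∈ K.cells ∧ x ⊆ z ∧ K.rk z = K.rank})
    (t := {y | y ∈ K.cells ∧ x ⊆ y ∧ K.rk y + 1 = K.rank}) (hfin.subset fun _ h => h.1)
    (hfin.subset fun _ h => h.1) (fun z y => y ⊆ z) ?_ (b₀ := t) ⟨htb.1, htm.2.1, by omega⟩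
    ?_ ?_
  · rintro z ⟨hz, hxz, hrz⟩
    obtain ⟨y, hy, hxy, hyz, hry⟩ := h.exists_coface_of_rk_lt hx.1 hz hxz (by omega)
    obtain ⟨y', hy', hne, hxy', hyz', hry', hall⟩ :=
      h.exists_diamond hx.1 hz hy hxy hyz hry (by omega)
    have : {b | b ∈ {y | y ∈ K.cells ∧ x ⊆ y ∧ K.rk y + 1 = K.rank} ∧ b ⊆ z} = {y, y'} := by
      ext b
      simp only [Set.mem_ofPred_eq, Set.mem_insert_iff, Set.mem_singleton_iff]
      constructor
      · rintro ⟨⟨h1, h2, h3⟩, h4⟩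
        exact hall b h1 h2 h4 (by omega)
      · rintro (rfl | rfl)
        · exact ⟨⟨hy, hxy, by omega⟩, hyz⟩
        · exact ⟨⟨hy', hxy', by omega⟩, hyz'⟩
    rw [this, Set.ncard_pair hne.symm]
    exact even_two
  all_goals
    have hset : ∀ y, x ⊆ y → K.rk y + 1 = K.rank →
        {z | z ∈ {z | z ∈ K.cells ∧ x ⊆ z ∧ K.rk z = K.rank} ∧ y ⊆ z} = K.cofaces y := by
      intro y hxy hry
      rw [cofaces_eq_dualSet hry]
      ext z
      simp only [Set.mem_ofPred_eq, mem_dualSet]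
      exact ⟨fun ⟨⟨a, _, c⟩, d⟩ => ⟨a, c, d⟩, fun ⟨a, c, d⟩ => ⟨⟨a, hxy.trans d, c⟩, d⟩⟩
  · rw [hset t htm.2.1 (by omega)]
    obtain ⟨z, hz⟩ := h.exists_cofaces_eq_of_mem_boundary htb (by omega)
    rw [hz, Set.ncard_singleton]
    exact odd_one
  · rintro y ⟨hy, hxy, hry⟩ hne
    rw [hset y hxy hry]
    have hyb : y ∉ K.boundary.cells := fun hyb => by
      have : y ∈ K.boundary.cofaces x := ⟨hyb, hxy, show K.rk y = K.rk x + 1 by omega⟩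
      rw [ht] at this
      exact hne this
    have hle := hK.nonBranching y hy hry
    obtain ⟨z, hz, hyz, hrz⟩ := hK.pure.exists_top h hy
    have hzc : z ∈ K.cofaces y := ⟨hz, hyz, by omega⟩
    have hn1 : (K.cofaces y).encard ≠ 1 := fun h1 => by
      exact hyb ⟨hy, y, hy, hry, Set.encard_eq_one.1 h1, le_rfl⟩
    have hn0 : (K.cofaces y).encard ≠ 0 := by
      rw [Set.encard_ne_zero]; exact ⟨z, hzc⟩
    have hf : (K.cofaces y).Finite := hfin.subset fun _ h => h.1
    rw [← hf.cast_ncard_eq] at hle hn1 hn0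
    norm_cast at hle hn1 hn0
    have : (K.cofaces y).ncard = 2 := by omega
    rw [this]
    exact even_two

/-- The boundary of a non-singular cell complex without boundary pinch is closed. -/
theorem NonSingular.boundary_closed (hK : K.NonSingular) (hp : ∀ x, ¬ K.boundary.IsPinch x) :
    K.boundary.Closed := by
  refine ⟨⟨hK.isCC.boundary, hK.graphBased.boundary,
    boundary_pure hK.isCC, fun y hy hr => hK.isCC.boundary.encard_cofaces_le hp hy hr⟩, ?_⟩
  by_contra hne
  obtain ⟨x, hx⟩ := Set.nonempty_iff_ne_empty.2 hne
  obtain ⟨-, y, hy, hr, ⟨t, ht⟩, -⟩ := hx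
  have := hK.isCC.boundary_rank ⟨y, hy⟩
  exact hK.cofaces_boundary_ne hy (show K.boundary.rk y + 2 = _ by omega) t ht

/-- In a closed cell complex every sub-maximal cell has exactly two co-faces. -/
theorem Closed.exists_dualSet_eq_pair (hK : K.Closed) (hy : y ∈ K.cells)
    (hr : K.rk y + 1 = K.rank) : ∃ z w, z ≠ w ∧ K.dualSet y = {z, w} := by
  have hle := hK.1.nonBranching y hy hr
  rw [cofaces_eq_dualSet hr] at hle
  have hn0 : (K.dualSet y).encard ≠ 0 := by
    obtain ⟨z, hz, hyz, hrz⟩ := hK.1.pure.exists_top hK.1.isCC hy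
    rw [Set.encard_ne_zero]; exact ⟨z, hz, hrz, hyz⟩
  have hn1 : (K.dualSet y).encard ≠ 1 := fun h1 => by
    rw [← cofaces_eq_dualSet hr] at h1
    have : y ∈ K.boundary.cells := ⟨hy, y, hy, hr, Set.encard_eq_one.1 h1, le_rfl⟩
    simp [hK.2] at this
  have hf : (K.dualSet y).Finite := hK.1.isCC.finite_cells.subset fun _ h => h.1
  refine Set.encard_eq_two.1 ?_
  rw [← hf.cast_ncard_eq] at hle hn1 hn0 ⊢
  norm_cast at hle hn1 hn0 ⊢
  omega

end RankedFamily

/-! ### Paths confined to a set of vertices. -/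

namespace SimpleGraph

variable {α β : Type*} {G : SimpleGraph α} {H : SimpleGraph β} {S T : Set α}

/-- `u` and `v` are joined by a path of `G` that stays in `S`. -/
def LinkIn (G : SimpleGraph α) (S : Set α) : α → α → Prop :=
  Relation.ReflTransGen fun a b => a ∈ S ∧ b ∈ S ∧ G.Adj a b

/-- Any two elements of `S` are joined by a path of `G` that stays in `S`. -/
def LinkedOn (G : SimpleGraph α) (S : Set α) : Prop := ∀ u ∈ S, ∀ v ∈ S, G.LinkIn S u v

theorem LinkIn.symm {u v : α} (h : G.LinkIn S u v) : G.LinkIn S v u := by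
  induction h with
  | refl => exact .refl
  | tail _ hbc ih => exact .head ⟨hbc.2.1, hbc.1, hbc.2.2.symm⟩ ih

theorem LinkIn.trans {u v w : α} (h : G.LinkIn S u v) (h' : G.LinkIn S v w) :
    G.LinkIn S u w := Relation.ReflTransGen.trans h h'

theorem LinkIn.mono {u v : α} (h : G.LinkIn S u v) (hST : S ⊆ T) : G.LinkIn T u v :=
  Relation.ReflTransGen.mono (fun _ _ hab => ⟨hST hab.1, hST hab.2.1, hab.2.2⟩) _ _ h

theorem LinkIn.of_adj {u v : α} (hu : u ∈ S) (hv : v ∈ S) (h : G.Adj u v) :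
    G.LinkIn S u v := .single ⟨hu, hv, h⟩

theorem LinkIn.reachable {u v : α} (h : G.LinkIn S u v) : G.Reachable u v := by
  induction h with
  | refl => exact .refl _
  | tail _ hbc ih => exact ih.trans hbc.2.2.reachable

theorem LinkIn.mem {u v : α} (h : G.LinkIn S u v) (hu : u ∈ S) : v ∈ S := by
  cases h with
  | refl => exact hu
  | tail _ hbc => exact hbc.2.1

theorem LinkIn.map {u v : α} {T : Set β} (h : G.LinkIn S u v) (f : α → β)
    (hf : ∀ a ∈ S, ∀ b ∈ S, G.Adj a b → H.LinkIn T (f a) (f b)) :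
    H.LinkIn T (f u) (f v) := by
  induction h with
  | refl => exact .refl
  | tail _ hbc ih => exact ih.trans (hf _ hbc.1 _ hbc.2.1 hbc.2.2)

/-- Adjacent elements need only have linked images, and the image need not be all of `T` as long as
every element of `T` is linked to it. Connectedness is passed between `K`, `J` and the dual in this
form. -/
theorem LinkedOn.map {T : Set β} (h : G.LinkedOn S) (f : α → β)
    (hf : ∀ a ∈ S, ∀ b ∈ S, G.Adj a b → H.LinkIn T (f a) (f b))
    (hs : ∀ t ∈ T, ∃ a ∈ S, H.LinkIn T (f a) t) : H.LinkedOn T := by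
  intro t ht t' ht'
  obtain ⟨a, ha, hat⟩ := hs t ht
  obtain ⟨b, hb, hbt⟩ := hs t' ht'
  exact hat.symm.trans (((h a ha b hb).map f hf).trans hbt)

theorem LinkedOn.congr {G' : SimpleGraph α} (h : G.LinkedOn S)
    (hG : ∀ a ∈ S, ∀ b ∈ S, G.Adj a b → G'.Adj a b) : G'.LinkedOn S :=
  h.map id (fun a ha b hb hab => .of_adj ha hb (hG a ha b hb hab)) fun t ht => ⟨t, ht, .refl⟩

theorem linkedOn_of_reachable (hG : ∀ a b, G.Adj a b → a ∈ S ∧ b ∈ S)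
    (h : ∀ a ∈ S, ∀ b ∈ S, G.Reachable a b) : G.LinkedOn S := by
  intro a ha b hb
  refine Relation.ReflTransGen.mono (fun x y hxy => ⟨(hG x y hxy).1, (hG x y hxy).2, hxy⟩) _ _
    ((reachable_iff_reflTransGen a b).1 (h a ha b hb))

theorem induce_preconnected_iff : (G.induce S).Preconnected ↔ G.LinkedOn S := by
  constructor
  · intro h a ha b hb
    have := (reachable_iff_reflTransGen _ _).1 (h ⟨a, ha⟩ ⟨b, hb⟩)
    exact Relation.ReflTransGen.lift (Subtype.val : S → α)
      (fun x y hxy => ⟨x.2, y.2, hxy⟩) _ _ this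
  · rintro h ⟨a, ha⟩ ⟨b, hb⟩
    have hab := h a ha b hb
    have key : ∀ c, G.LinkIn S a c → ∀ hc : c ∈ S, (G.induce S).Reachable ⟨a, ha⟩ ⟨c, hc⟩ := by
      intro c hac
      induction hac with
      | refl => exact fun _ => .refl _
      | tail _ hbc ih =>
        intro hc
        exact (ih hbc.1).trans
          (SimpleGraph.Adj.reachable (G := G.induce S) (u := ⟨_, hbc.1⟩) (v := ⟨_, hc⟩) hbc.2.2)
    exact key b hab hb

end SimpleGraph

/-! ### Connectedness, isomorphisms and collar edges. -/

namespace RankedFamily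

variable {V W : Type*} {K J : RankedFamily V} {x y z w t : Set V} {u v : V}

theorem graph_adj : K.graph.Adj u v ↔ u ≠ v ∧ {u, v} ∈ K.cells ∧ K.rk {u, v} = 1 := Iff.rfl

theorem connected_of_linkedOn (hg : K.GraphBased) (h : K.graph.LinkedOn K.verts) :
    K.Connected :=
  ⟨hg, fun v hv w hw => (h v hv w hw).reachable⟩

theorem Connected.linkedOn (hc : K.Connected) (h : K.IsCC) : K.graph.LinkedOn K.verts :=
  SimpleGraph.linkedOn_of_reachable
    (fun a b hab => ⟨h.singleton_mem hab.2.1 (by simp), h.singleton_mem hab.2.1 (by simp)⟩) hc.2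

theorem restrict_isSub (A : Set V) : (K.restrict A).IsSub K := ⟨fun _ h => h.1, fun _ _ => rfl⟩

theorem IsCC.restrict (h : K.IsCC) (A : Set V) : (K.restrict A).IsCC :=
  h.of_isLower (restrict_isSub A) fun _ hx _ hy hxy => ⟨hx, hxy.trans hy.2⟩

theorem restrict_verts (A : Set V) : (K.restrict A).verts = K.verts ∩ A := by
  ext v
  simp [verts, restrict]

theorem IsCC.restrict_verts (h : K.IsCC) (hx : x ∈ K.cells) : (K.restrict x).verts = x := by
  rw [RankedFamily.restrict_verts, Set.inter_eq_right]
  exact h.subset_verts x hx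

theorem restrict_graph_adj {A : Set V} :
    (K.restrict A).graph.Adj u v ↔ K.graph.Adj u v ∧ u ∈ A ∧ v ∈ A := by
  simp only [graph_adj, restrict, Set.mem_ofPred_eq, Set.pair_subset_iff]
  tauto

theorem GraphBased.restrict (h : K.GraphBased) (A : Set V) : (K.restrict A).GraphBased :=
  fun e he hr => h e he.1 hr

theorem restrict_connected {A : Set V} (hg : K.GraphBased)
    (h : K.graph.LinkedOn (K.verts ∩ A)) : (K.restrict A).Connected := by
  refine connected_of_linkedOn (hg.restrict A) ?_
  rw [restrict_verts]
  exact h.congr fun a ha b hb hab => restrict_graph_adj.2 ⟨hab, ha.2, hb.2⟩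

theorem IsCC.cellConnected_iff (h : K.IsCC) :
    K.CellConnected ↔ K.GraphBased ∧ ∀ x ∈ K.cells, K.graph.LinkedOn x := by
  refine and_congr_right fun hg => forall₂_congr fun x hx => ⟨fun hc => ?_, fun hc => ?_⟩
  · have := hc.linkedOn (h.restrict x)
    rw [h.restrict_verts hx] at this
    exact this.congr fun a _ b _ hab => (restrict_graph_adj.1 hab).1
  · refine restrict_connected hg ?_
    rwa [Set.inter_eq_right.2 (h.subset_verts x hx)]

theorem IsSub.graph_adj (hs : J.IsSub K) (h : J.graph.Adj u v) : K.graph.Adj u v :=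
  ⟨h.1, hs.1 h.2.1, by rw [← hs.2 _ h.2.1]; exact h.2.2⟩

theorem not_isPinch_iff (hx : x ∈ K.cells) :
    ¬ K.IsPinch x ↔ K.dualGraph.LinkedOn (K.dualSet x) := by
  simp [IsPinch, hx, SimpleGraph.induce_preconnected_iff]

theorem forall_not_isPinch_iff :
    (∀ x, ¬ K.IsPinch x) ↔ ∀ x ∈ K.cells, K.dualGraph.LinkedOn (K.dualSet x) :=
  ⟨fun h x hx => (not_isPinch_iff hx).1 (h x),
    fun h x hx => (not_isPinch_iff hx.1).2 (h x hx.1) hx⟩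

variable {L : RankedFamily W} {e : Set V}

/-- Reflecting inclusions forces injectivity by antisymmetry, so the inverse exists on cells and
inherits monotonicity and ranks. -/
theorem isIso_of_subset_iff {f : Set V → Set W} (hm : Set.MapsTo f K.cells L.cells)
    (hs : Set.SurjOn f K.cells L.cells)
    (hi : ∀ x ∈ K.cells, ∀ y ∈ K.cells, f x ⊆ f y ↔ x ⊆ y)
    (hr : ∀ x ∈ K.cells, L.rk (f x) = K.rk x) : IsIso K L f := by
  have hinj : Set.InjOn f K.cells := fun x hx y hy hxy =>
    subset_antisymm ((hi x hx y hy).1 hxy.subset) ((hi y hy x hx).1 hxy.symm.subset)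
  have hl := hinj.leftInvOn_invFunOn
  have hri := hs.rightInvOn_invFunOn
  have hmi := hs.mapsTo_invFunOn
  refine ⟨⟨hm, fun x hx y hy => (hi x hx y hy).2, ?_⟩, Function.invFunOn f K.cells,
    ⟨hmi, fun x hx y hy hxy => ?_, ?_⟩, hl, hri⟩
  · rintro _ ⟨x, hx, rfl⟩
    exact ⟨x, hx, (hr x hx).symm, rfl⟩
  · rw [← hi _ (hmi hx) _ (hmi hy), hri hx, hri hy]
    exact hxy
  · rintro _ ⟨y, hy, rfl⟩
    refine ⟨y, hy, ?_, rfl⟩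
    rw [← hr _ (hmi hy), hri hy]

theorem IsIso.injOn {f : Set V → Set W} (h : IsIso K L f) : Set.InjOn f K.cells := by
  obtain ⟨-, g, -, hi⟩ := h
  exact hi.1.injOn

theorem IsIso.surjOn {f : Set V → Set W} (h : IsIso K L f) : Set.SurjOn f K.cells L.cells := by
  obtain ⟨-, g, hg, hi⟩ := h
  exact hi.2.surjOn hg.mapsTo

/-- A homomorphism only promises some preimage of the right rank; injectivity identifies it with
`x`. -/
theorem IsIso.rk_eq {f : Set V → Set W} (h : IsIso K L f) (hx : x ∈ K.cells) :
    L.rk (f x) = K.rk x := by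
  obtain ⟨y, hy, hr, hyx⟩ := h.1.exists_rk_eq _ ⟨x, hx, rfl⟩
  rw [← hr, h.injOn hy hx hyx]

theorem IsIso.subset_of_subset {f : Set V → Set W} (h : IsIso K L f) (hx : x ∈ K.cells)
    (hy : y ∈ K.cells) (hxy : f x ⊆ f y) : x ⊆ y := by
  obtain ⟨hf, g, hg, hi⟩ := h
  have := hg.mono _ (hf.mapsTo x hx) _ (hf.mapsTo y hy) hxy
  rwa [hi.1 hx, hi.1 hy] at this

theorem ofImage_rk {s : Set (Set V)} {f : Set V → Set W} {r : Set V → ℕ} (hx : x ∈ s)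
    (h : ∀ y ∈ s, f y = f x → r y = r x) : (ofImage s f r).rk (f x) = r x := by
  have : {n | ∃ y ∈ s, f y = f x ∧ r y = n} = {r x} := by
    ext n
    simp only [Set.mem_ofPred_eq, Set.mem_singleton_iff]
    constructor
    · rintro ⟨y, hy, hyx, rfl⟩
      exact h y hy hyx
    · rintro rfl
      exact ⟨x, hx, rfl, rfl⟩
  show sInf _ = _
  rw [this, csInf_singleton]

/-- The infimum defining the rank is attained, even when different preimages have different ranks.
Used for the midsection of a component, where injectivity has not been established. -/
theorem exists_of_ofImage_rk {s : Set (Set V)} {f : Set V → Set W} {r : Set V → ℕ} (hx : x ∈ s) :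
    ∃ y ∈ s, f y = f x ∧ r y = (ofImage s f r).rk (f x) :=
  Nat.sInf_mem (s := {n | ∃ y ∈ s, f y = f x ∧ r y = n}) ⟨r x, x, hx, rfl, rfl⟩

theorem mem_collar : x ∈ K.collar J ↔
    x ∈ K.cells ∧ (∃ a ∈ x, a ∈ J.verts) ∧ ∃ b ∈ x, b ∉ J.verts := by
  simp only [collar, Set.mem_ofPred_eq, ne_eq, Set.inter_eq_left, Set.not_subset]
  rfl

theorem GraphBased.mem_collarEdges (hg : K.GraphBased) : e ∈ K.collarEdges J x ↔
    ∃ a b, a ∈ J.verts ∧ b ∉ J.verts ∧ K.graph.Adj a b ∧ a ∈ x ∧ b ∈ x ∧ e = {a, b} := by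
  constructor
  · rintro ⟨he, hr, hex⟩
    obtain ⟨heK, ⟨a, ha, haJ⟩, b, hb, hbJ⟩ := mem_collar.1 he
    obtain ⟨c, hca, rfl⟩ := hg.exists_pair heK hr ha
    obtain rfl : b = c := by
      rcases hb with rfl | hb
      · exact absurd haJ hbJ
      · exact hb
    exact ⟨a, b, haJ, hbJ, ⟨hca.symm, heK, hr⟩, hex ha, hex hb, rfl⟩
  · rintro ⟨a, b, haJ, hbJ, hab, hax, hbx, rfl⟩
    exact ⟨mem_collar.2 ⟨hab.2.1, ⟨a, by simp, haJ⟩, b, by simp, hbJ⟩, hab.2.2,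
      Set.pair_subset hax hbx⟩

/-- A path inside `x` from a vertex of `J` to one outside must cross over somewhere. -/
theorem exists_collarEdge (hl : K.graph.LinkedOn x) (hx : x ∈ K.collar J) :
    ∃ a b, a ∈ J.verts ∧ b ∉ J.verts ∧ K.graph.Adj a b ∧ a ∈ x ∧ b ∈ x := by
  obtain ⟨hxK, ⟨a, ha, haJ⟩, b, hb, hbJ⟩ := mem_collar.1 hx
  have : ∀ c, K.graph.LinkIn x a c → c ∉ J.verts →
      ∃ a b, a ∈ J.verts ∧ b ∉ J.verts ∧ K.graph.Adj a b ∧ a ∈ x ∧ b ∈ x := by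
    intro c hac
    induction hac with
    | refl => exact fun h => absurd haJ h
    | @tail b c _ hbc ih =>
      intro hc
      by_cases hbJ : b ∈ J.verts
      · exact ⟨b, c, hbJ, hc, hbc.2.2, hbc.1, hbc.2.1⟩
      · exact ih hbJ
  exact this b (hl a ha b hb) hbJ

end RankedFamily

open RankedFamily

/-! ### Exactly collared pairs. -/

namespace RelFamily

variable {V : Type*} {X : RelFamily V} {x y z w t c j : Set V} {u v : V} {s : Set (Set V)}

theorem NonDegenerate.mem_removed_iff (h : X.NonDegenerate) :
    x ∈ X.removed.cells ↔ x ∈ X.total.cells ∧ x ⊆ X.removed.verts := by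
  refine ⟨fun hx => ⟨h.isRelCC.isSub.1 hx, h.isRelCC.removed_isCC.subset_verts x hx⟩,
    fun ⟨hx, hxA⟩ => ?_⟩
  by_contra hxJ
  exact h.not_subset x ⟨hx, hxJ⟩ hxA

theorem NonDegenerate.rk_removed (h : X.NonDegenerate) (hx : x ∈ X.removed.cells) :
    X.removed.rk x = X.total.rk x := h.isRelCC.isSub.2 x hx

/-- The cells outside the removed part. -/
def inner (X : RelFamily V) : Set (Set V) :=
  {x | x ∈ X.total.cells ∧ ∃ v ∈ x, v ∉ X.removed.verts}

/-- The boundary cells that have no vertex in the removed part. -/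
def outer (X : RelFamily V) : Set (Set V) :=
  {x | x ∈ X.total.boundary.cells ∧ ∀ v ∈ x, v ∉ X.removed.verts}

theorem NonDegenerate.diff_eq_inner (h : X.NonDegenerate) :
    X.total.cells \ X.removed.cells = X.inner := by
  ext x
  rw [Set.mem_sdiff, h.mem_removed_iff]
  simp only [inner, Set.mem_ofPred_eq, not_and]
  refine and_congr_right fun hx => ⟨fun h => ?_, fun h _ => ?_⟩
  · exact Set.not_subset.1 (h hx)
  · exact Set.not_subset.2 h

/-- The cells of the collar correspond to the cells of `J`, with ranks shifted by one. -/
structure Collared (X : RelFamily V) : Prop where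
  inter_mem : ∀ x ∈ X.total.collar X.removed, x ∩ X.removed.verts ∈ X.removed.cells
  rk_eq : ∀ x ∈ X.total.collar X.removed, X.total.rk x = X.total.rk (x ∩ X.removed.verts) + 1
  exists_inter_eq : ∀ j ∈ X.removed.cells,
    ∃ x ∈ X.total.collar X.removed, x ∩ X.removed.verts = j
  subset_of_inter_subset : ∀ x ∈ X.total.collar X.removed, ∀ y ∈ X.total.collar X.removed,
    x ∩ X.removed.verts ⊆ y ∩ X.removed.verts → x ⊆ y

/-- An inner `y` containing the `J`-part of `x` meets `J`, hence is itself in the collar. -/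
theorem Collared.subset_of_inter_subset' (h : X.Collared)
    (hx : x ∈ X.total.collar X.removed) (hy : y ∈ X.inner)
    (hxy : x ∩ X.removed.verts ⊆ y) : x ⊆ y := by
  obtain ⟨a, ha⟩ := hx.2.1
  exact h.subset_of_inter_subset x hx y
    (mem_collar.2 ⟨hy.1, ⟨a, hxy ha, ha.2⟩, hy.2⟩)
    (Set.subset_inter hxy Set.inter_subset_right)

theorem Collared.eq_of_inter_eq (h : X.Collared)
    (hx : x ∈ X.total.collar X.removed) (hy : y ∈ X.total.collar X.removed)
    (hxy : x ∩ X.removed.verts = y ∩ X.removed.verts) : x = y :=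
  subset_antisymm (h.subset_of_inter_subset x hx y hy hxy.subset)
    (h.subset_of_inter_subset y hy x hx hxy.symm.subset)

/-- The given isomorphism compares cells of the collar only through their sets of collar edges. The
work is to pass from inclusion of `J`-parts to inclusion of the cells themselves. -/
theorem ExactlyCollared.collared (hc : X.ExactlyCollared) (hg : X.total.CellConnected) :
    X.Collared := by
  obtain ⟨φ, hφ, hφx⟩ := hc.exists_iso
  have h := hc.nonDegenerate.isRelCC.total_isCC
  have hsub := hc.nonDegenerate.isRelCC.isSub
  have hmem : ∀ x ∈ X.total.collar X.removed,
      X.total.collarEdges X.removed x ∈ (X.total.midsection X.removed).cells :=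
    fun x hx => ⟨x, hx, rfl⟩
  have hin : ∀ x ∈ X.total.collar X.removed, x ∩ X.removed.verts ∈ X.removed.cells := by
    intro x hx
    rw [← hφx x hx]
    exact hφ.1.mapsTo _ (hmem x hx)
  have hE : ∀ x ∈ X.total.collar X.removed, ∀ y ∈ X.total.collar X.removed,
      x ∩ X.removed.verts ⊆ y ∩ X.removed.verts →
      X.total.collarEdges X.removed x ⊆ X.total.collarEdges X.removed y := by
    intro x hx y hy hxy
    refine hφ.subset_of_subset (hmem x hx) (hmem y hy) ?_
    rwa [hφx x hx, hφx y hy]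
  have hsubset : ∀ x ∈ X.total.collar X.removed, ∀ y ∈ X.total.collar X.removed,
      x ∩ X.removed.verts ⊆ y ∩ X.removed.verts → x ⊆ y := by
    intro x hx y hy hxy
    obtain ⟨a, b, ha, hb, hab, hax, hbx⟩ :=
      exists_collarEdge ((h.cellConnected_iff.1 hg).2 x hx.1) hx
    have hey := (hE x hx y hy hxy (hg.1.mem_collarEdges.2 ⟨a, b, ha, hb, hab, hax, hbx, rfl⟩)).2.2
    have hay : a ∈ y := hey (by simp)
    have hp : x ∩ y ∈ X.total.cells := h.inter_mem x hx.1 y hy.1 ⟨a, hax, hay⟩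
    -- If `x ∩ y` were a proper subcell of `x`, some edge of `x` at `a` would leave it. But the
    -- other end of that edge is in `y` in all cases: within `J` by inclusion of the `J`-parts,
    -- outside `J` by inclusion of the collar edges.
    by_contra hxy'
    have hps : x ∩ y ⊂ x := Set.inter_subset_left.ssubset_of_ne
      fun h => hxy' (Set.inter_eq_left.1 h)
    have hs := h.singleton_mem hx.1 hax
    obtain ⟨g, hgK, hgr, hag, hgx, hgn⟩ := h.exists_coface_not_subset hs (x ∩ y) hp x hx.1
      (Set.singleton_subset_iff.2 ⟨hax, hay⟩) hps
    have hgr1 : X.total.rk g = 1 := by rw [hgr, h.rk_singleton hs]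
    obtain ⟨c, hca, rfl⟩ := hg.1.exists_pair hgK hgr1 (Set.singleton_subset_iff.1 hag)
    have hcx : c ∈ x := hgx (by simp)
    refine hgn (Set.subset_inter hgx (Set.pair_subset hay ?_))
    by_cases hcJ : c ∈ X.removed.verts
    · exact (hxy ⟨hcx, hcJ⟩).1
    · exact (hE x hx y hy hxy (hg.1.mem_collarEdges.2
        ⟨a, c, ha, hcJ, ⟨hca.symm, hgK, hgr1⟩, hax, hcx, rfl⟩)).2.2 (by simp)
  have hinj : ∀ x ∈ X.total.collar X.removed, ∀ y ∈ X.total.collar X.removed,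
      X.total.collarEdges X.removed y = X.total.collarEdges X.removed x → y = x := by
    intro x hx y hy hxy
    have : y ∩ X.removed.verts = x ∩ X.removed.verts := by rw [← hφx x hx, ← hφx y hy, hxy]
    exact subset_antisymm (hsubset y hy x hx this.subset) (hsubset x hx y hy this.symm.subset)
  refine ⟨hin, fun x hx => ?_, fun j hj => ?_, hsubset⟩
  · have hr := hφ.rk_eq (hmem x hx)
    rw [hφx x hx, hsub.2 _ (hin x hx), midsection, ofImage_rk hx
      (fun y hy hyx => by rw [hinj x hx y hy hyx])] at hr
    -- The midsection rank is a truncated subtraction; it loses nothing because a single vertex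
    -- cannot lie in the collar.
    have hpos : X.total.rk x ≠ 0 := fun h0 => by
      obtain ⟨v, rfl⟩ := (h.rk_eq_zero_iff x hx.1).1 h0
      obtain ⟨-, ⟨a, rfl, ha⟩, b, rfl, hb⟩ := mem_collar.1 hx
      exact hb ha
    omega
  · obtain ⟨m, ⟨x, hx, rfl⟩, hm⟩ := hφ.surjOn hj
    exact ⟨x, hx, by rw [← hφx x hx, hm]⟩

/-- The vertex of `J` in a collar edge determines that edge. -/
theorem Collared.exists_edge (h : X.Collared) (hX : X.NonDegenerate) (hg : X.total.GraphBased)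
    {a : V} (ha : a ∈ X.removed.verts) :
    ∃ b, b ∉ X.removed.verts ∧ X.total.graph.Adj a b ∧
      ∀ x ∈ X.inner, a ∈ x → b ∈ x := by
  obtain ⟨e, he, hea⟩ := h.exists_inter_eq {a} ha
  have haK : {a} ∈ X.total.cells := hX.isRelCC.isSub.1 ha
  have hr : X.total.rk e = 1 := by
    rw [h.rk_eq e he, hea, hX.isRelCC.total_isCC.rk_singleton haK]
  have hae : a ∈ e := (hea.symm.subset rfl).1
  obtain ⟨b, hba, rfl⟩ := hg.exists_pair he.1 hr hae
  have hb : b ∉ X.removed.verts := fun hb => hba (hea.subset ⟨by simp, hb⟩)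
  refine ⟨b, hb, ⟨hba.symm, he.1, hr⟩, fun x hx hax => ?_⟩
  exact h.subset_of_inter_subset' he hx (by rw [hea]; simpa using hax) (by simp)

/-- Each vertex of `J` has a collar edge contained in every inner cell through that vertex. Hence
inclusion of collar edges and inclusion of `J`-parts are equivalent, and the map on the midsection
is well defined. -/
theorem Collared.exactlyCollared (h : X.Collared) (hX : X.NonDegenerate)
    (hg : X.total.GraphBased) : X.ExactlyCollared := by
  classical
  refine ⟨hX, ?_⟩
  have hE : ∀ x ∈ X.total.collar X.removed, ∀ y ∈ X.total.collar X.removed,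
      (X.total.collarEdges X.removed x ⊆ X.total.collarEdges X.removed y ↔
        x ∩ X.removed.verts ⊆ y ∩ X.removed.verts) := by
    intro x hx y hy
    constructor
    · rintro hxy a ⟨hax, ha⟩
      obtain ⟨b, hb, hab, hall⟩ := h.exists_edge hX hg ha
      have hbx := hall x ⟨hx.1, (mem_collar.1 hx).2.2⟩ hax
      exact ⟨(hxy (hg.mem_collarEdges.2 ⟨a, b, ha, hb, hab, hax, hbx, rfl⟩)).2.2 (by simp), ha⟩
    · rintro hxy e ⟨he, her, hex⟩
      exact ⟨he, her, hex.trans (h.subset_of_inter_subset x hx y hy hxy)⟩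
  -- The value depends on a chosen representative, but all representatives have the same `J`-part;
  -- the default `∅` is taken only off the midsection.
  let φ : Set (Set V) → Set V := fun m =>
    if hm : ∃ x ∈ X.total.collar X.removed, X.total.collarEdges X.removed x = m then
      hm.choose ∩ X.removed.verts else ∅
  have hφ : ∀ x ∈ X.total.collar X.removed,
      φ (X.total.collarEdges X.removed x) = x ∩ X.removed.verts := by
    intro x hx
    have hm : ∃ y ∈ X.total.collar X.removed,
      X.total.collarEdges X.removed y = X.total.collarEdges X.removed x := ⟨x, hx, rfl⟩
    show dite _ _ _ = _
    rw [dif_pos hm]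
    obtain ⟨h1, h2⟩ := hm.choose_spec
    exact subset_antisymm ((hE _ h1 _ hx).1 h2.subset) ((hE _ hx _ h1).1 h2.symm.subset)
  refine ⟨φ, isIso_of_subset_iff ?_ ?_ ?_ ?_, hφ⟩
  · rintro _ ⟨x, hx, rfl⟩
    rw [hφ x hx]
    exact h.inter_mem x hx
  · intro j hj
    obtain ⟨x, hx, rfl⟩ := h.exists_inter_eq j hj
    exact ⟨_, ⟨x, hx, rfl⟩, hφ x hx⟩
  · rintro _ ⟨x, hx, rfl⟩ _ ⟨y, hy, rfl⟩
    rw [hφ x hx, hφ y hy, hE x hx y hy]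
  · rintro _ ⟨x, hx, rfl⟩
    rw [hφ x hx, hX.rk_removed (h.inter_mem x hx), midsection, ofImage_rk hx, h.rk_eq x hx]
    · rfl
    · intro y hy hyx
      rw [h.eq_of_inter_eq hy hx (subset_antisymm ((hE _ hy _ hx).1 hyx.subset)
        ((hE _ hx _ hy).1 hyx.symm.subset))]

/-! ### Splitting of the boundary, and deleting `J` from a cell. -/

theorem IsCobordism.isCC (hX : X.IsCobordism) : X.total.IsCC := hX.total_mem.nonSingular.isCC

theorem IsCobordism.graphBased (hX : X.IsCobordism) : X.total.GraphBased :=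
  hX.total_mem.nonSingular.graphBased

theorem IsCobordism.linkedOn (hX : X.IsCobordism) (hx : x ∈ X.total.cells) :
    X.total.graph.LinkedOn x :=
  (hX.isCC.cellConnected_iff.1 hX.total_mem.isLocal.cellConnected).2 x hx

theorem IsCobordism.closed_boundary (hX : X.IsCobordism) : X.total.boundary.Closed :=
  hX.total_mem.nonSingular.boundary_closed hX.total_mem.nonPinching.2

theorem IsCobordism.removed_rank_add_one (hX : X.IsCobordism) (hx : x ∈ X.removed.cells) :
    X.removed.rank + 1 = X.total.rank ∧ X.removed.rank = X.total.boundary.rank := by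
  have h1 := hX.removed_rank ⟨x, hx⟩
  have h2 := hX.isCC.boundary_rank ⟨x, hX.removed_isSub.1 hx⟩
  exact ⟨h1, by omega⟩

/-- For an exactly collared cobordism, a boundary cell lies in `J` or is disjoint from it. -/
theorem IsCobordism.subset_of_mem_boundary (hX : X.IsCobordism) (hc : X.Collared)
    (hx : x ∈ X.total.boundary.cells) (hv : v ∈ x) (hvJ : v ∈ X.removed.verts) :
    x ⊆ X.removed.verts := by
  obtain ⟨y, hy, hxy, hr⟩ := exists_facet_of_mem_boundary hx
  refine hxy.trans ?_
  by_contra hyJ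
  have hyc : y ∈ X.total.collar X.removed :=
    mem_collar.2 ⟨hy.1, ⟨v, hxy hv, hvJ⟩, Set.not_subset.1 hyJ⟩
  have hj := hc.inter_mem y hyc
  have hrj := hc.rk_eq y hyc
  have hrk := hX.nonDegenerate.rk_removed hj
  obtain ⟨h1, h2⟩ := hX.removed_rank_add_one hj
  -- The cell `y ∩ J` has two co-faces in `J` because `J` is closed. With `y`, which is not in `J`,
  -- it would have three co-faces in `∂K`, where closedness allows only two.
  obtain ⟨a, b, hab, habe⟩ := hX.removed_mem.closed.exists_dualSet_eq_pair hj (by omega)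
  obtain ⟨a', b', -, habe'⟩ := hX.closed_boundary.exists_dualSet_eq_pair
    (hX.removed_isSub.1 hj) (show X.total.rk _ + 1 = _ by omega)
  have hmem : ∀ t ∈ X.removed.dualSet (y ∩ X.removed.verts),
      t ∈ X.total.boundary.dualSet (y ∩ X.removed.verts) ∧ t ≠ y := fun t ht => by
    refine ⟨⟨hX.removed_isSub.1 ht.1, ?_, ht.2.2⟩, ?_⟩
    · rw [← hX.removed_isSub.2 t ht.1, ht.2.1, h2]
    · rintro rfl
      exact hyJ (hX.nonDegenerate.mem_removed_iff.1 ht.1).2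
  have ha := hmem a (habe ▸ Set.mem_insert _ _)
  have hb := hmem b (habe ▸ Set.mem_insert_of_mem _ rfl)
  have hy' : y ∈ X.total.boundary.dualSet (y ∩ X.removed.verts) :=
    ⟨hy, show X.total.rk y = _ by omega, Set.inter_subset_left⟩
  rw [habe'] at ha hb hy'
  simp only [Set.mem_insert_iff, Set.mem_singleton_iff] at ha hb hy'
  grind

theorem IsCobordism.diff_eq_outer (hX : X.IsCobordism) (hc : X.Collared) :
    X.total.boundary.cells \ X.removed.cells = X.outer := by
  ext x
  rw [Set.mem_sdiff, hX.nonDegenerate.mem_removed_iff]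
  simp only [outer, Set.mem_ofPred_eq, not_and]
  refine and_congr_right fun hx => ⟨fun h v hv hvJ => ?_, fun h _ hs => ?_⟩
  · exact h hx.1 (hX.subset_of_mem_boundary hc hx hv hvJ)
  · obtain ⟨v, hv⟩ := hX.isCC.nonempty_of_mem x hx.1
    exact h v hv (hs hv)

theorem IsCobordism.outer_subset_inner (hX : X.IsCobordism) : X.outer ⊆ X.inner := by
  intro x hx
  obtain ⟨v, hv⟩ := hX.isCC.nonempty_of_mem x hx.1.1
  exact ⟨hx.1.1, v, hv, hx.2 v hv⟩

/-- Removing the edge of `J` from a two-cell of the collar leaves a connected graph. -/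
theorem IsCobordism.linkedOn_diff_of_rk_two (hX : X.IsCobordism) (hc : X.Collared)
    (hx : c ∈ X.total.collar X.removed) (hr : X.total.rk c = 2) :
    X.total.graph.LinkedOn (c \ X.removed.verts) := by
  have h := hX.isCC
  have hg := hX.graphBased
  have hJ := hc.inter_mem c hx
  have hJK := hX.nonDegenerate.isRelCC.isSub.1 hJ
  have hJr : X.total.rk (c ∩ X.removed.verts) = 1 := by have := hc.rk_eq c hx; omega
  -- every vertex of `c` lies in exactly two edges of `c`
  have hdeg : ∀ v ∈ c, ∀ e ∈ X.total.cells, v ∈ e → e ⊆ c → X.total.rk e = 1 →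
      ∃ e' ∈ X.total.cells, e' ≠ e ∧ v ∈ e' ∧ e' ⊆ c ∧ X.total.rk e' = 1 ∧
        ∀ f ∈ X.total.cells, v ∈ f → f ⊆ c → X.total.rk f = 1 → f = e ∨ f = e' := by
    intro v hv e he hve hec her
    have hs := h.singleton_mem hx.1 hv
    have hs0 := h.rk_singleton hs
    obtain ⟨e', h1, h2, h3, h4, h5, h6⟩ := h.exists_diamond hs hx.1 he
      (Set.singleton_subset_iff.2 hve) hec (by omega) (by omega)
    exact ⟨e', h1, h2, Set.singleton_subset_iff.1 h3, h4, by omega, fun f hf hvf hfc hfr =>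
      h6 f hf (Set.singleton_subset_iff.2 hvf) hfc (by omega)⟩
  -- the unique collar edge of `c` at a vertex of `J`
  have hout : ∀ a ∈ c, a ∈ X.removed.verts → ∃ a' ∈ c, a' ∉ X.removed.verts ∧
      X.total.graph.Adj a a' ∧ ∀ u ∈ c, u ∉ X.removed.verts → X.total.graph.Adj a u → u = a' := by
    intro a hac ha
    obtain ⟨f, hf, hfn, haf, hfc, hfr, hall⟩ := hdeg a hac _ hJK ⟨hac, ha⟩
      Set.inter_subset_left hJr
    obtain ⟨a', haa', rfl⟩ := hg.exists_pair hf hfr haf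
    have ha'c : a' ∈ c := hfc (by simp)
    refine ⟨a', ha'c, fun ha'J => hfn ?_, ⟨haa'.symm, hf, hfr⟩, ?_⟩
    · exact h.eq_of_subset hf hJK (Set.pair_subset ⟨hac, ha⟩ ⟨ha'c, ha'J⟩) (by omega)
    · intro u huc huJ hau
      rcases hall _ hau.2.1 (by simp) (Set.pair_subset hac huc) hau.2.2 with he | he
      · exact absurd (he.subset (Set.mem_insert_of_mem _ rfl)).2 huJ
      · have : u ∈ ({a, a'} : Set V) := he ▸ Set.mem_insert_of_mem _ rfl
        exact this.resolve_left hau.1.symm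
  obtain ⟨a, hac, ha⟩ := (mem_collar.1 hx).2.1
  obtain ⟨b, hba, hab⟩ := hg.exists_pair hJK hJr (u := a) ⟨hac, ha⟩
  have hbm : b ∈ c ∩ X.removed.verts := by rw [hab]; simp
  obtain ⟨a', ha'c, ha', haa', haall⟩ := hout a hac ha
  obtain ⟨b', hb'c, hb', hbb', hball⟩ := hout b hbm.1 hbm.2
  suffices H : ∀ p ∈ c \ X.removed.verts,
      X.total.graph.LinkIn (c \ X.removed.verts) p a' from
    fun p hp q hq => (H p hp).trans (H q hq).symm
  intro p hp
  by_contra hpa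
  -- The component of `p` off `J`. Having missed `a'`, it has no neighbour `a`, so the only edge of
  -- `c` that can leave it is the one from `b'` to `b`.
  set C : Set V := {q | X.total.graph.LinkIn (c \ X.removed.verts) p q} with hC
  have hpC : p ∈ C := Relation.ReflTransGen.refl
  have hCsub : C ⊆ c \ X.removed.verts := fun q hq => SimpleGraph.LinkIn.mem hq hp
  have hclosed : ∀ q ∈ C, ∀ r ∈ c, r ∉ X.removed.verts → X.total.graph.Adj q r → r ∈ C :=
    fun q hq r hr hrJ hqr => SimpleGraph.LinkIn.trans hq (.of_adj (hCsub hq) ⟨hr, hrJ⟩ hqr)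
  have hnbr : ∀ q ∈ C, ∀ r ∈ c, X.total.graph.Adj q r → r ∉ C → q = b' ∧ r = b := by
    intro q hq r hrc hqr hrC
    have hrJ : r ∈ X.removed.verts := by
      by_contra hrJ
      exact hrC (hclosed q hq r hrc hrJ hqr)
    have : r ∈ ({a, b} : Set V) := hab ▸ ⟨hrc, hrJ⟩
    rcases this with rfl | hrb
    · exact absurd (haall q (hCsub hq).1 (hCsub hq).2 hqr.symm ▸ hq) hpa
    · obtain rfl : r = b := hrb
      exact ⟨hball q (hCsub hq).1 (hCsub hq).2 hqr.symm, rfl⟩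
  -- If `b'` is in `C`, the edge `{b, b'}` is the only one with an odd number of ends in `C`, which
  -- is impossible as every vertex of `C` has degree two in `c`. If not, no edge leaves `C`,
  -- although `c` is connected and contains `a`.
  by_cases hb'C : b' ∈ C
  · have hVfin : c.Finite := h.finite_verts.subset (h.subset_verts c hx.1)
    refine Set.not_existsUnique_odd_ncard (s := C)
      (t := {e | e ∈ X.total.cells ∧ X.total.rk e = 1 ∧ e ⊆ c})
      (hVfin.subset fun q hq => (hCsub hq).1) (h.finite_cells.subset fun _ h => h.1)
      (fun v e => v ∈ e) ?_ (b₀ := {b, b'})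
      ⟨hbb'.2.1, hbb'.2.2, Set.pair_subset hbm.1 hb'c⟩ ?_ ?_
    · intro q hq
      have hqs := h.singleton_mem hx.1 (hCsub hq).1
      obtain ⟨e, he, hqe, hec, her⟩ := h.exists_coface_of_rk_lt hqs hx.1
        (Set.singleton_subset_iff.2 (hCsub hq).1) (by rw [h.rk_singleton hqs]; omega)
      rw [h.rk_singleton hqs] at her
      have hqe := Set.singleton_subset_iff.1 hqe
      obtain ⟨e', he', hne, hqe', hec', her', hall⟩ := hdeg q (hCsub hq).1 e he hqe hec her
      have : {f | f ∈ {e | e ∈ X.total.cells ∧ X.total.rk e = 1 ∧ e ⊆ c} ∧ q ∈ f} = {e, e'} := by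
        ext f
        simp only [Set.mem_ofPred_eq, Set.mem_insert_iff, Set.mem_singleton_iff]
        constructor
        · rintro ⟨⟨h1, h2, h3⟩, h4⟩
          exact hall f h1 h4 h3 h2
        · rintro (rfl | rfl)
          · exact ⟨⟨he, her, hec⟩, hqe⟩
          · exact ⟨⟨he', her', hec'⟩, hqe'⟩
      rw [this, Set.ncard_pair hne.symm]
      exact even_two
    · have : {q | q ∈ C ∧ q ∈ ({b, b'} : Set V)} = {b'} := by
        ext q
        simp only [Set.mem_ofPred_eq, Set.mem_insert_iff, Set.mem_singleton_iff]
        constructor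
        · rintro ⟨h1, rfl | rfl⟩
          · exact absurd hbm.2 (hCsub h1).2
          · rfl
        · rintro rfl
          exact ⟨hb'C, .inr rfl⟩
      rw [this, Set.ncard_singleton]
      exact odd_one
    · rintro e ⟨he, her, hec⟩ hne
      rcases Set.eq_empty_or_nonempty {q | q ∈ C ∧ q ∈ e} with h0 | ⟨q, hq, hqe⟩
      · rw [h0, Set.ncard_empty]
        exact Even.zero
      · obtain ⟨r, hrq, rfl⟩ := hg.exists_pair he her hqe
        have hr : r ∈ C := by
          by_contra hr
          obtain ⟨rfl, rfl⟩ := hnbr q hq r (hec (by simp)) ⟨hrq.symm, he, her⟩ hr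
          exact hne (Set.pair_comm _ _)
        have : {s | s ∈ C ∧ s ∈ ({q, r} : Set V)} = {q, r} := by
          ext s
          simp only [Set.mem_ofPred_eq, Set.mem_insert_iff, Set.mem_singleton_iff]
          refine ⟨fun h => h.2, fun h => ⟨?_, h⟩⟩
          rcases h with rfl | rfl <;> assumption
        rw [this, Set.ncard_pair hrq.symm]
        exact even_two
  · have : ∀ q, X.total.graph.LinkIn c p q → q ∈ C := by
      intro q hq
      induction hq with
      | refl => exact hpC
      | tail _ hqr ih =>
        by_contra hr
        exact hb'C ((hnbr _ ih _ hqr.2.1 hqr.2.2 hr).1 ▸ ih)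
    exact (hCsub (this a (hX.linkedOn hx.1 p hp.1 a hac))).2 ha

theorem component_verts (v : V) : (X.removed.component v).verts =
    {w | w ∈ X.removed.verts ∧ X.removed.graph.Reachable v w} :=
  restrict_verts _

theorem subset_component_verts (h : X.removed.IsCC) (hcc : X.removed.CellConnected)
    (hx : x ∈ X.removed.cells) {a : V} (ha : a ∈ x)
    (hva : X.removed.graph.Reachable v a) : x ⊆ (X.removed.component v).verts := by
  rw [component_verts]
  intro b hb
  exact ⟨h.subset_verts x hx hb,
    hva.trans ((h.cellConnected_iff.1 hcc).2 x hx a ha b hb).reachable⟩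

/-- Removing the vertices of `J` from a cell leaves a connected graph. -/
theorem IsCobordism.linkedOn_diff (hX : X.IsCobordism) (hc : X.Collared)
    (hx : x ∈ X.total.cells) : X.total.graph.LinkedOn (x \ X.removed.verts) := by
  have h := hX.isCC
  have hg := hX.graphBased
  by_cases hxc : x ∈ X.total.collar X.removed
  swap
  · intro p hp q hq
    have : ∀ a ∈ x, a ∉ X.removed.verts := fun a ha haJ =>
      hxc (mem_collar.2 ⟨hx, ⟨a, ha, haJ⟩, p, hp.1, hp.2⟩)
    exact (hX.linkedOn hx p hp.1 q hq.1).mono fun a ha => ⟨ha, this a ha⟩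
  obtain ⟨v, hvx, hvJ⟩ := (mem_collar.1 hxc).2.1
  have hJc := hX.nonDegenerate.isRelCC.removed_isCC
  set A := X.removed.verts with hA
  set A₀ := (X.removed.component v).verts with hA₀
  have hA₀A : A₀ ⊆ A := by
    rw [hA₀, component_verts]
    exact fun _ h => h.1
  -- Locality is assumed per component of `J`; the `J`-part of `x` is a single connected cell, so
  -- only one component matters.
  have hxA₀ : x ∩ A ⊆ A₀ := subset_component_verts hJc hX.removed_mem.cellConnected
    (hc.inter_mem x hxc) ⟨hvx, hvJ⟩ (.refl _)
  have hvA₀ : v ∈ A₀ := hxA₀ ⟨hvx, hvJ⟩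
  have hxc₀ : x ∈ X.total.collar (X.removed.component v) :=
    mem_collar.2 ⟨hx, ⟨v, hvx, hvA₀⟩, by
      obtain ⟨b, hb, hbA⟩ := (mem_collar.1 hxc).2.2
      exact ⟨b, hb, fun hb' => hbA (hA₀A hb')⟩⟩
  -- collar edges of `x` with respect to the component
  have hE : ∀ e, e ∈ X.total.collarEdges (X.removed.component v) x ↔
      e ∈ X.total.collarEdges X.removed x := by
    intro e
    rw [hg.mem_collarEdges, hg.mem_collarEdges]
    constructor
    · rintro ⟨a, b, ha, hb, hab, hax, hbx, rfl⟩
      exact ⟨a, b, hA₀A ha, fun hb' => hb (hxA₀ ⟨hbx, hb'⟩), hab, hax, hbx, rfl⟩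
    · rintro ⟨a, b, ha, hb, hab, hax, hbx, rfl⟩
      exact ⟨a, b, hxA₀ ⟨hax, ha⟩, fun hb' => hb (hA₀A hb'), hab, hax, hbx, rfl⟩
  -- two-cells of the midsection of the component
  have hstep : ∀ e f, ((X.total.midsection (X.removed.component v)).restrict
      (X.total.collarEdges (X.removed.component v) x)).graph.Adj e f →
      ∃ c ⊆ x, c ∈ X.total.collar X.removed ∧ X.total.rk c = 2 ∧ e ⊆ c ∧ f ⊆ c := by
    intro e f hef
    obtain ⟨⟨-, ⟨c', hc', hce'⟩, hrk⟩, he, hf⟩ := restrict_graph_adj.1 hef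
    -- Replace `c'` by a cell with the same collar edges that realizes the midsection rank one; this
    -- cell has rank two in `K`.
    obtain ⟨c, hcc, hce, hcr⟩ := exists_of_ofImage_rk (f := X.total.collarEdges
      (X.removed.component v)) (r := fun x => X.total.rk x - 1) hc'
    rw [midsection, ← hce', ← hcr] at hrk
    rw [← hce] at hce'
    have hcK := hcc.1
    obtain ⟨a, hac, haA₀⟩ := (mem_collar.1 hcc).2.1
    have haA₀' := haA₀
    rw [component_verts] at haA₀'
    have hcA : ¬ c ⊆ A := fun hcA => by
      have hcJ := hX.nonDegenerate.mem_removed_iff.2 ⟨hcK, hcA⟩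
      obtain ⟨b, hb, hbA₀⟩ := (mem_collar.1 hcc).2.2
      exact hbA₀ (subset_component_verts hJc hX.removed_mem.cellConnected hcJ hac
        haA₀'.2 hb)
    have hcol : c ∈ X.total.collar X.removed :=
      mem_collar.2 ⟨hcK, ⟨a, hac, hA₀A haA₀⟩, Set.not_subset.1 hcA⟩
    have hcA₀ : c ∩ A ⊆ A₀ := subset_component_verts hJc hX.removed_mem.cellConnected
      (hc.inter_mem c hcol) ⟨hac, hA₀A haA₀⟩ haA₀'.2
    have hsub : ({e, f} : Set (Set V)) ⊆ X.total.collarEdges (X.removed.component v) x :=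
      Set.pair_subset he hf
    refine ⟨c, ?_, hcol, by omega, ?_, ?_⟩
    · refine hc.subset_of_inter_subset c hcol x hxc fun a' ⟨ha'c, ha'⟩ => ⟨?_, ha'⟩
      obtain ⟨b, hb, hab, hall⟩ := hc.exists_edge hX.nonDegenerate hg ha'
      have hbc := hall c ⟨hcK, (mem_collar.1 hcol).2.2⟩ ha'c
      have : {a', b} ∈ X.total.collarEdges (X.removed.component v) c :=
        hg.mem_collarEdges.2 ⟨a', b, hcA₀ ⟨ha'c, ha'⟩, fun hb' => hb (hA₀A hb'), hab, ha'c,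
          hbc, rfl⟩
      rw [hce'] at this
      exact (hsub this).2.2 (by simp)
    · have : e ∈ X.total.collarEdges (X.removed.component v) c := by rw [hce']; simp
      exact this.2.2
    · have : f ∈ X.total.collarEdges (X.removed.component v) c := by rw [hce']; simp
      exact this.2.2
  have hMcc := (hX.isLocal.midsection_cellConnected v hvJ).2 _ ⟨x, hxc₀, rfl⟩
  have hvert : ∀ e ∈ X.total.collarEdges X.removed x,
      e ∈ ((X.total.midsection (X.removed.component v)).restrict
      (X.total.collarEdges (X.removed.component v) x)).verts := by
    intro e he
    have he₀ := (hE e).2 he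
    refine ⟨⟨e, he₀.1, ?_⟩, by simpa using he₀⟩
    ext f
    rw [Set.mem_singleton_iff]
    constructor
    · rintro ⟨hf, hfr, hfe⟩
      exact h.eq_of_subset hf.1 he.1.1 hfe (by rw [he.2.1, hfr])
    · rintro rfl
      exact ⟨he₀.1, he₀.2.1, le_rfl⟩
  -- Consecutive collar edges on a midsection path share a two-cell inside `x`, in which their outer
  -- ends can be joined without entering `J`.
  have hlink : ∀ e ∈ X.total.collarEdges X.removed x, ∀ f ∈ X.total.collarEdges X.removed x,
      ∀ p ∈ e, p ∉ A → ∀ q ∈ f, q ∉ A → X.total.graph.LinkIn (x \ A) p q := by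
    intro e he f hf p hpe hpA
    have hr := (SimpleGraph.reachable_iff_reflTransGen _ _).1
      (hMcc.2 e (hvert e he) f (hvert f hf))
    induction hr with
    | refl =>
      intro q hq hqA
      obtain ⟨a, b, ha, hb, hab, hax, hbx, rfl⟩ := hg.mem_collarEdges.1 he
      have hp' : p = b := hpe.resolve_left fun h => hpA (h ▸ ha)
      have hq' : q = b := hq.resolve_left fun h => hqA (h ▸ ha)
      rw [hp', hq']
      exact .refl
    | @tail f g _ hfg ih =>
      intro q hqg hqA
      have hfx : f ∈ X.total.collarEdges X.removed x :=
        (hE f).1 (restrict_graph_adj.1 hfg).2.1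
      obtain ⟨a, b, ha, hb, hab, hax, hbx, rfl⟩ := hg.mem_collarEdges.1 hfx
      obtain ⟨c, hcx, hcol, hcr, hfc, hgc⟩ := hstep _ g hfg
      refine (ih hfx b (by simp) hb).trans ?_
      exact (hX.linkedOn_diff_of_rk_two hc hcol hcr b ⟨hfc (by simp), hb⟩ q
        ⟨hgc hqg, hqA⟩).mono fun s hs => ⟨hcx hs.1, hs.2⟩
  intro p hp q hq
  -- While the path is inside `J`, the invariant remembers the collar edge by which it entered; on
  -- leaving `J`, `hlink` supplies a detour between the two outer ends.
  have key : ∀ u, X.total.graph.LinkIn x p u →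
      (u ∉ A ∧ X.total.graph.LinkIn (x \ A) p u) ∨
      (u ∈ A ∧ ∃ e ∈ X.total.collarEdges X.removed x, ∃ o ∈ e, o ∉ A ∧
        X.total.graph.LinkIn (x \ A) p o) := by
    intro u hu
    induction hu with
    | refl => exact .inl ⟨hp.2, .refl⟩
    | @tail u u' _ huu ih =>
      obtain ⟨hux, hu'x, hadj⟩ := huu
      rcases ih with ⟨huA, hpu⟩ | ⟨huA, e, he, o, hoe, hoA, hpo⟩
      · by_cases hu'A : u' ∈ A
        · exact .inr ⟨hu'A, {u', u}, hg.mem_collarEdges.2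
            ⟨u', u, hu'A, huA, hadj.symm, hu'x, hux, rfl⟩, u, by simp, huA, hpu⟩
        · exact .inl ⟨hu'A, hpu.trans (.of_adj ⟨hux, huA⟩ ⟨hu'x, hu'A⟩ hadj)⟩
      · by_cases hu'A : u' ∈ A
        · exact .inr ⟨hu'A, e, he, o, hoe, hoA, hpo⟩
        · exact .inl ⟨hu'A, hpo.trans (hlink e he {u, u'} (hg.mem_collarEdges.2
            ⟨u, u', huA, hu'A, hadj, hux, hu'x, rfl⟩) o hoe hoA u' (by simp) hu'A)⟩
  rcases key q (hX.linkedOn hx p hp.1 q hq.1) with h1 | h1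
  · exact h1.2
  · exact absurd h1.1 hq.2

/-! ### Inclusions between dual sets. -/

/-- The generalized dual set of `x` with respect to the total complex. -/
def tilde (X : RelFamily V) (x : Set V) : Set (Set V) := X.total.bdualSet x

/-- The dual set of `x` with respect to the boundary. -/
def star (X : RelFamily V) (x : Set V) : Set (Set V) := X.total.boundary.dualSet x

theorem IsCobordism.mem_tilde (hX : X.IsCobordism) : t ∈ X.tilde x ↔
    x ⊆ t ∧ (t ∈ X.total.cells ∧ X.total.rk t = X.total.rank ∨
      t ∈ X.total.boundary.cells ∧ X.total.rk t + 1 = X.total.rank) :=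
  hX.isCC.mem_bdualSet

theorem IsCobordism.mem_star (hX : X.IsCobordism) : t ∈ X.star x ↔
    t ∈ X.total.boundary.cells ∧ X.total.rk t + 1 = X.total.rank ∧ x ⊆ t :=
  hX.isCC.mem_boundary_dualSet

theorem IsCobordism.sInter_tilde (hX : X.IsCobordism) (hx : x ∈ X.total.cells) :
    ⋂₀ X.tilde x = x := hX.total_mem.nonSingular.sInter_bdualSet hx

theorem IsCobordism.sInter_star (hX : X.IsCobordism) (hx : x ∈ X.total.boundary.cells) :
    ⋂₀ X.star x = x := hX.closed_boundary.sInter_dualSet hx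

theorem star_subset_tilde_self : X.star x ⊆ X.tilde x := Set.subset_union_right

theorem IsCobordism.tilde_subset_tilde (hX : X.IsCobordism) (hx : x ∈ X.total.cells) :
    X.tilde x ⊆ X.tilde y ↔ y ⊆ x := hX.total_mem.nonSingular.bdualSet_subset_iff hx

theorem IsCobordism.star_subset_tilde (hX : X.IsCobordism) (hx : x ∈ X.total.boundary.cells) :
    X.star x ⊆ X.tilde y ↔ y ⊆ x := by
  refine ⟨fun h => ?_, fun h => star_subset_tilde_self.trans (bdualSet_anti h)⟩
  rw [← hX.sInter_star hx]
  exact Set.subset_sInter fun t ht => (hX.mem_tilde.1 (h ht)).1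

theorem IsCobordism.star_subset_star (hX : X.IsCobordism) (hx : x ∈ X.total.boundary.cells) :
    X.star x ⊆ X.star y ↔ y ⊆ x :=
  ⟨fun h => (hX.star_subset_tilde hx).1 (h.trans star_subset_tilde_self), dualSet_anti⟩

theorem IsCobordism.exists_top_mem_tilde (hX : X.IsCobordism) (hx : x ∈ X.total.cells) :
    ∃ z ∈ X.tilde x, z ∈ X.total.cells ∧ X.total.rk z = X.total.rank := by
  obtain ⟨z, hz, hxz, hr⟩ := hX.total_mem.nonSingular.pure.exists_top hX.isCC hx
  exact ⟨z, hX.mem_tilde.2 ⟨hxz, .inl ⟨hz, hr⟩⟩, hz, hr⟩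

/-- By purity `tilde x` contains a top cell of `K`, whereas `star y` consists of facets of the
boundary only. -/
theorem IsCobordism.not_tilde_subset_star (hX : X.IsCobordism) (hx : x ∈ X.total.cells) :
    ¬ X.tilde x ⊆ X.star y := by
  obtain ⟨z, hz, -, hr⟩ := hX.exists_top_mem_tilde hx
  intro h
  have := (hX.mem_star.1 (h hz)).2.1
  omega

theorem IsCobordism.tilde_ne_star (hX : X.IsCobordism) (hx : x ∈ X.total.cells) :
    X.tilde x ≠ X.star y := fun h => hX.not_tilde_subset_star hx h.subset

theorem IsCobordism.tilde_inj (hX : X.IsCobordism) (hx : x ∈ X.total.cells)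
    (hy : y ∈ X.total.cells) : X.tilde x = X.tilde y ↔ x = y := by
  refine ⟨fun h => ?_, fun h => h ▸ rfl⟩
  rw [← hX.sInter_tilde hx, h, hX.sInter_tilde hy]

theorem IsCobordism.star_inj (hX : X.IsCobordism) (hx : x ∈ X.total.boundary.cells)
    (hy : y ∈ X.total.boundary.cells) : X.star x = X.star y ↔ x = y := by
  refine ⟨fun h => ?_, fun h => h ▸ rfl⟩
  rw [← hX.sInter_star hx, h, hX.sInter_star hy]

theorem IsCobordism.exists_mem_star (hX : X.IsCobordism) (hx : x ∈ X.total.boundary.cells) :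
    ∃ z, z ∈ X.star x := by
  obtain ⟨z, hz, hxz, hr⟩ := exists_facet_of_mem_boundary hx
  exact ⟨z, hX.mem_star.2 ⟨hz, hr, hxz⟩⟩

theorem IsCobordism.rk_lt (hX : X.IsCobordism) (hx : x ∈ X.total.boundary.cells) :
    X.total.rk x + 1 ≤ X.total.rank := hX.isCC.rk_lt_rank_of_mem_boundary hx

theorem IsCobordism.tilde_eq_singleton (hX : X.IsCobordism) (hx : x ∈ X.total.cells)
    (hr : X.total.rk x = X.total.rank) : X.tilde x = {x} := by
  ext t
  rw [hX.mem_tilde, Set.mem_singleton_iff]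
  constructor
  · rintro ⟨hxt, ⟨ht, -⟩ | ⟨ht, hrt⟩⟩
    · exact (hX.isCC.eq_of_subset hx ht hxt (by rw [hr]; exact hX.isCC.rk_le_rank ht)).symm
    · have := hX.isCC.rk_mono hx ht.1 hxt
      omega
  · rintro rfl
    exact ⟨le_rfl, .inl ⟨hx, hr⟩⟩

theorem IsCobordism.star_eq_singleton (hX : X.IsCobordism) (hx : x ∈ X.total.boundary.cells)
    (hr : X.total.rk x + 1 = X.total.rank) : X.star x = {x} := by
  ext t
  rw [hX.mem_star, Set.mem_singleton_iff]
  constructor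
  · rintro ⟨ht, hrt, hxt⟩
    exact (hX.isCC.eq_of_subset hx.1 ht.1 hxt (by omega)).symm
  · rintro rfl
    exact ⟨hx, hr, le_rfl⟩

theorem inner_of_subset (hx : x ∈ X.inner) (hy : y ∈ X.total.cells) (hxy : x ⊆ y) :
    y ∈ X.inner := by
  obtain ⟨-, v, hv, hvJ⟩ := hx
  exact ⟨hy, v, hxy hv, hvJ⟩

theorem IsCobordism.outer_of_inner (hX : X.IsCobordism) (hc : X.Collared) (hx : x ∈ X.inner)
    (hb : x ∈ X.total.boundary.cells) : x ∈ X.outer := by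
  obtain ⟨-, v, hv, hvJ⟩ := hx
  exact ⟨hb, fun a ha haJ => hvJ (hX.subset_of_mem_boundary hc hb ha haJ hv)⟩

theorem outer_of_subset (hy : y ∈ X.outer) (hx : x ∈ X.total.cells) (hxy : x ⊆ y) :
    x ∈ X.outer :=
  ⟨mem_boundary_of_subset hx hy.1 hxy, fun v hv => hy.2 v (hxy hv)⟩

theorem IsCobordism.outer_of_superset (hX : X.IsCobordism) (hc : X.Collared)
    (hx : x ∈ X.outer) (hy : y ∈ X.total.boundary.cells) (hxy : x ⊆ y) : y ∈ X.outer :=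
  hX.outer_of_inner hc (inner_of_subset (hX.outer_subset_inner hx) hy.1 hxy) hy

theorem IsCobordism.inner_of_rk (hX : X.IsCobordism) (hx : x ∈ X.total.cells)
    (hr : X.total.rk x = X.total.rank) : x ∈ X.inner := by
  refine ⟨hx, Set.not_subset.1 fun h => ?_⟩
  have := hX.rk_lt (hX.removed_isSub.1 (hX.nonDegenerate.mem_removed_iff.2 ⟨hx, h⟩))
  omega

theorem IsCobordism.outer_facet (hX : X.IsCobordism) (hc : X.Collared) (hx : x ∈ X.inner)
    (ht : t ∈ X.total.boundary.cells) (hxt : x ⊆ t) : t ∈ X.outer :=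
  hX.outer_of_inner hc (inner_of_subset hx ht.1 hxt) ht

theorem IsCobordism.singleton_inner (hX : X.IsCobordism) (hx : x ∈ X.total.cells) (hv : v ∈ x)
    (hvJ : v ∉ X.removed.verts) : {v} ∈ X.inner :=
  ⟨hX.isCC.singleton_mem hx hv, v, rfl, hvJ⟩

/-! ### The cells of the dual -/

theorem IsCobordism.mem_dual_removed (hX : X.IsCobordism) (hc : X.Collared) :
    s ∈ X.dual.removed.cells ↔ ∃ x ∈ X.outer, X.star x = s := by
  rw [← hX.diff_eq_outer hc]
  rfl

theorem IsCobordism.mem_dual_total (hX : X.IsCobordism) (hc : X.Collared) :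
    s ∈ X.dual.total.cells ↔ (∃ x ∈ X.inner, X.tilde x = s) ∨ ∃ x ∈ X.outer, X.star x = s := by
  rw [← hX.mem_dual_removed hc, ← hX.nonDegenerate.diff_eq_inner]
  rfl

theorem IsCobordism.tilde_mem (hX : X.IsCobordism) (hc : X.Collared) (hx : x ∈ X.inner) :
    X.tilde x ∈ X.dual.total.cells := (hX.mem_dual_total hc).2 (.inl ⟨x, hx, rfl⟩)

theorem IsCobordism.star_mem (hX : X.IsCobordism) (hc : X.Collared) (hx : x ∈ X.outer) :
    X.star x ∈ X.dual.total.cells := (hX.mem_dual_total hc).2 (.inr ⟨x, hx, rfl⟩)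

theorem IsCobordism.rk_tilde (hX : X.IsCobordism) (hx : x ∈ X.inner) :
    X.dual.total.rk (X.tilde x) + X.total.rk x = X.total.rank := by
  have hxd : x ∈ X.total.cells \ X.removed.cells := by
    rwa [hX.nonDegenerate.diff_eq_inner]
  have h1 : X.dual.total.rk (X.tilde x) = X.total.rank - X.total.rk x := by
    refine (if_pos ⟨x, hxd, rfl⟩).trans ?_
    refine ofImage_rk (f := X.total.bdualSet) (r := fun x => X.total.rank - X.total.rk x) hxd ?_
    intro y hy hyx
    rw [(hX.tilde_inj hy.1 hx.1).1 hyx]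
  have := hX.isCC.rk_le_rank hx.1
  omega

theorem IsCobordism.rk_removed_star (hX : X.IsCobordism) (hc : X.Collared) (hx : x ∈ X.outer) :
    X.dual.removed.rk (X.star x) + X.total.rk x + 1 = X.total.rank := by
  rw [← hX.diff_eq_outer hc] at hx
  have h1 : X.dual.removed.rk (X.star x) = X.total.boundary.rank - X.total.rk x := by
    refine ofImage_rk (f := X.total.boundary.dualSet)
      (r := fun x => X.total.boundary.rank - X.total.boundary.rk x) hx ?_
    intro y hy hyx
    rw [(hX.star_inj hy.1 hx.1).1 hyx]
  have := hX.rk_lt hx.1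
  have := hX.isCC.boundary_rank ⟨x, hx.1⟩
  omega

/-- The rank on a union comes from its first family where that applies, but no `star x` is a
generalized dual set. -/
theorem IsCobordism.rk_star_eq (hX : X.IsCobordism) :
    X.dual.total.rk (X.star x) = X.dual.removed.rk (X.star x) := by
  refine if_neg ?_
  rintro ⟨y, hy, hyx⟩
  exact hX.tilde_ne_star hy.1 hyx

theorem IsCobordism.rk_star (hX : X.IsCobordism) (hc : X.Collared) (hx : x ∈ X.outer) :
    X.dual.total.rk (X.star x) + X.total.rk x + 1 = X.total.rank := by
  rw [hX.rk_star_eq, hX.rk_removed_star hc hx]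

theorem IsCobordism.mem_dual_verts (hX : X.IsCobordism) (hc : X.Collared) :
    t ∈ X.dual.total.verts ↔ (t ∈ X.total.cells ∧ X.total.rk t = X.total.rank) ∨
      (t ∈ X.outer ∧ X.total.rk t + 1 = X.total.rank) := by
  refine (hX.mem_dual_total hc).trans ⟨?_, ?_⟩
  · rintro (⟨x, hx, hxt⟩ | ⟨x, hx, hxt⟩)
    · obtain ⟨z, hz, hzK, hr⟩ := hX.exists_top_mem_tilde hx.1
      rw [hxt, Set.mem_singleton_iff] at hz
      exact .inl (hz ▸ ⟨hzK, hr⟩)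
    · obtain ⟨z, hz⟩ := hX.exists_mem_star hx.1
      obtain ⟨hzb, hr, hxz⟩ := hX.mem_star.1 hz
      rw [hxt, Set.mem_singleton_iff] at hz
      exact .inr (hz ▸ ⟨hX.outer_of_superset hc hx hzb hxz, hr⟩)
  · rintro (⟨ht, hr⟩ | ⟨ht, hr⟩)
    · exact .inl ⟨t, hX.inner_of_rk ht hr, hX.tilde_eq_singleton ht hr⟩
    · exact .inr ⟨t, ht, hX.star_eq_singleton ht.1 hr⟩

theorem IsCobordism.tilde_subset_verts (hX : X.IsCobordism) (hc : X.Collared)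
    (hx : x ∈ X.inner) : X.tilde x ⊆ X.dual.total.verts := by
  intro t ht
  obtain ⟨hxt, h | ⟨h, hr⟩⟩ := hX.mem_tilde.1 ht
  · exact (hX.mem_dual_verts hc).2 (.inl h)
  · exact (hX.mem_dual_verts hc).2 (.inr ⟨hX.outer_facet hc hx h hxt, hr⟩)

/-- The intersection is again a dual set, namely that of the cell obtained by intersecting all its
members: `star` if these are all boundary facets, `tilde` otherwise, both factors then being of the
form `tilde`. -/
theorem IsCobordism.dual_inter_mem (hX : X.IsCobordism) (hc : X.Collared) {s' : Set (Set V)}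
    (hs : s ∈ X.dual.total.cells) (hs' : s' ∈ X.dual.total.cells) (hne : (s ∩ s').Nonempty) :
    s ∩ s' ∈ X.dual.total.cells := by
  have h := hX.isCC
  have hfilter : ∀ r ∈ X.dual.total.cells, ∃ x ∈ X.inner, (∀ t ∈ r, x ⊆ t) ∧
      ∀ t, t ∈ X.total.boundary.cells ∧ X.total.rk t + 1 = X.total.rank → x ⊆ t → t ∈ r := by
    intro r hr
    obtain ⟨x, hx, rfl⟩ | ⟨x, hx, rfl⟩ := (hX.mem_dual_total hc).1 hr
    · exact ⟨x, hx, fun t ht => (hX.mem_tilde.1 ht).1,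
        fun t ht hxt => hX.mem_tilde.2 ⟨hxt, .inr ht⟩⟩
    · exact ⟨x, hX.outer_subset_inner hx, fun t ht => (hX.mem_star.1 ht).2.2,
        fun t ht hxt => hX.mem_star.2 ⟨ht.1, ht.2, hxt⟩⟩
  have hcells : ∀ r ∈ X.dual.total.cells, r ⊆ X.total.cells := by
    intro r hr t ht
    obtain ⟨x, hx, rfl⟩ | ⟨x, hx, rfl⟩ := (hX.mem_dual_total hc).1 hr
    · obtain ⟨-, h | h⟩ := hX.mem_tilde.1 ht
      exacts [h.1, h.1.1]
    · exact (hX.mem_star.1 ht).1.1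
  obtain ⟨x, hx, hxs, hxs'⟩ := hfilter s hs
  obtain ⟨y, hy, hys, hys'⟩ := hfilter s' hs'
  have hjK : ⋂₀ (s ∩ s') ∈ X.total.cells :=
    h.sInter_mem (fun t ht => hcells s hs ht.1) hne hx.1 fun t ht => hxs t ht.1
  have hxj : x ⊆ ⋂₀ (s ∩ s') := Set.subset_sInter fun t ht => hxs t ht.1
  have hyj : y ⊆ ⋂₀ (s ∩ s') := Set.subset_sInter fun t ht => hys t ht.2
  have hj : ⋂₀ (s ∩ s') ∈ X.inner := inner_of_subset hx hjK hxj
  by_cases hb : s ∩ s' ⊆ {t | t ∈ X.total.boundary.cells ∧ X.total.rk t + 1 = X.total.rank}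
  · refine (hX.mem_dual_total hc).2 (.inr ⟨⋂₀ (s ∩ s'), ?_, ?_⟩)
    · obtain ⟨t, ht⟩ := hne
      exact hX.outer_of_inner hc hj
        (mem_boundary_of_subset hjK (hb ht).1 (Set.sInter_subset_of_mem ht))
    · ext t
      rw [hX.mem_star]
      exact ⟨fun ⟨h1, h2, h3⟩ => ⟨hxs' t ⟨h1, h2⟩ (hxj.trans h3), hys' t ⟨h1, h2⟩ (hyj.trans h3)⟩,
        fun ht => ⟨(hb ht).1, (hb ht).2, Set.sInter_subset_of_mem ht⟩⟩
  · obtain ⟨t₀, ht₀, ht₀b⟩ := Set.not_subset.1 hb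
    have htilde : ∀ r ∈ X.dual.total.cells, t₀ ∈ r → ∃ x ∈ X.inner, X.tilde x = r := by
      intro r hr ht
      obtain h | ⟨x, hx, rfl⟩ := (hX.mem_dual_total hc).1 hr
      · exact h
      · have := hX.mem_star.1 ht
        exact absurd ⟨this.1, this.2.1⟩ ht₀b
    obtain ⟨x, hx, rfl⟩ := htilde s hs ht₀.1
    obtain ⟨y, hy, rfl⟩ := htilde s' hs' ht₀.2
    refine (hX.mem_dual_total hc).2 (.inl ⟨_, hj, ?_⟩)
    ext t
    have hxj : x ⊆ ⋂₀ (X.tilde x ∩ X.tilde y) :=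
      Set.subset_sInter fun t ht => (hX.mem_tilde.1 ht.1).1
    have hyj : y ⊆ ⋂₀ (X.tilde x ∩ X.tilde y) :=
      Set.subset_sInter fun t ht => (hX.mem_tilde.1 ht.2).1
    constructor
    · intro ht
      obtain ⟨h1, h2⟩ := hX.mem_tilde.1 ht
      exact ⟨hX.mem_tilde.2 ⟨hxj.trans h1, h2⟩, hX.mem_tilde.2 ⟨hyj.trans h1, h2⟩⟩
    · intro ht
      exact hX.mem_tilde.2 ⟨Set.sInter_subset_of_mem ht, (hX.mem_tilde.1 ht.1).2⟩

/-- Two cells of the same kind reverse a diamond of `K`, and in the `star` case the middle cells are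
outer as faces of an outer cell. The mixed case is the new one. -/
theorem IsCobordism.dual_diamond (hX : X.IsCobordism) (hc : X.Collared) {s' : Set (Set V)}
    (hs : s ∈ X.dual.total.cells) (hs' : s' ∈ X.dual.total.cells) (hss : s ⊆ s')
    (hr : X.dual.total.rk s + 2 = X.dual.total.rk s') :
    ∃ z₁ z₂, z₁ ≠ z₂ ∧ X.dual.total.cofaces s ∩ X.dual.total.faces s' = {z₁, z₂} := by
  have h := hX.isCC
  have hmem : ∀ r, r ∈ X.dual.total.cofaces s ∩ X.dual.total.faces s' ↔
      r ∈ X.dual.total.cells ∧ s ⊆ r ∧ r ⊆ s' ∧ X.dual.total.rk r = X.dual.total.rk s + 1 := by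
    intro r
    simp only [cofaces, faces, Set.mem_inter_iff, Set.mem_ofPred_eq]
    constructor
    · rintro ⟨⟨a, b, c⟩, -, d, -⟩
      exact ⟨a, b, d, c⟩
    · rintro ⟨a, b, c, d⟩
      exact ⟨⟨a, b, d⟩, a, c, by omega⟩
  obtain ⟨x, hx, rfl⟩ | ⟨x, hx, rfl⟩ := (hX.mem_dual_total hc).1 hs <;>
    obtain ⟨y, hy, rfl⟩ | ⟨y, hy, rfl⟩ := (hX.mem_dual_total hc).1 hs'
  · have hyx := (hX.tilde_subset_tilde hx.1).1 hss
    have hrx := hX.rk_tilde hx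
    have hry := hX.rk_tilde hy
    obtain ⟨a, ha, hya, hax, hra⟩ := h.exists_coface_of_rk_lt hy.1 hx.1 hyx (by omega)
    obtain ⟨b, hb, hba, hyb, hbx, hrb, hall⟩ :=
      h.exists_diamond hy.1 hx.1 ha hya hax hra (by omega)
    have hai := inner_of_subset hy ha hya
    have hbi := inner_of_subset hy hb hyb
    have hra' := hX.rk_tilde hai
    have hrb' := hX.rk_tilde hbi
    refine ⟨X.tilde a, X.tilde b, fun hab => hba ((hX.tilde_inj ha hb).1 hab).symm, ?_⟩
    ext r
    rw [hmem, Set.mem_insert_iff, Set.mem_singleton_iff]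
    constructor
    · rintro ⟨hrD, h1, h2, h3⟩
      obtain ⟨d, hd, rfl⟩ | ⟨d, hd, rfl⟩ := (hX.mem_dual_total hc).1 hrD
      · have hrd := hX.rk_tilde hd
        rcases hall d hd.1 ((hX.tilde_subset_tilde hd.1).1 h2)
          ((hX.tilde_subset_tilde hx.1).1 h1) (by omega) with rfl | rfl <;> simp
      · exact absurd h1 (hX.not_tilde_subset_star hx.1)
    · rintro (rfl | rfl)
      · exact ⟨hX.tilde_mem hc hai, (hX.tilde_subset_tilde hx.1).2 hax,
          (hX.tilde_subset_tilde ha).2 hya, by omega⟩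
      · exact ⟨hX.tilde_mem hc hbi, (hX.tilde_subset_tilde hx.1).2 hbx,
          (hX.tilde_subset_tilde hb).2 hyb, by omega⟩
  · exact absurd hss (hX.not_tilde_subset_star hx.1)
  · have hyx := (hX.star_subset_tilde hx.1).1 hss
    have hrx := hX.rk_star hc hx
    have hry := hX.rk_tilde hy
    have hxi := hX.outer_subset_inner hx
    have hyo := outer_of_subset hx hy.1 hyx
    have hrx' := hX.rk_tilde hxi
    have hry' := hX.rk_star hc hyo
    -- The rank gap of two includes the step between `star` and `tilde`, so `y` is a face of `x`. By
    -- rank, a middle cell of type `tilde` comes from `x` and one of type `star` from `y`.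
    refine ⟨X.tilde x, X.star y, hX.tilde_ne_star hxi.1, ?_⟩
    ext r
    rw [hmem, Set.mem_insert_iff, Set.mem_singleton_iff]
    constructor
    · rintro ⟨hrD, h1, h2, h3⟩
      obtain ⟨d, hd, rfl⟩ | ⟨d, hd, rfl⟩ := (hX.mem_dual_total hc).1 hrD
      · have hrd := hX.rk_tilde hd
        left
        rw [h.eq_of_subset hd.1 hx.1.1 ((hX.star_subset_tilde hx.1).1 h1) (by omega)]
      · have hrd := hX.rk_star hc hd
        right
        rw [h.eq_of_subset hy.1 hd.1.1 ((hX.star_subset_tilde hd.1).1 h2) (by omega)]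
    · rintro (rfl | rfl)
      · exact ⟨hX.tilde_mem hc hxi, star_subset_tilde_self,
          (hX.tilde_subset_tilde hxi.1).2 hyx, by omega⟩
      · exact ⟨hX.star_mem hc hyo, (hX.star_subset_star hx.1).2 hyx,
          star_subset_tilde_self, by omega⟩
  · have hyx := (hX.star_subset_star hx.1).1 hss
    have hrx := hX.rk_star hc hx
    have hry := hX.rk_star hc hy
    obtain ⟨a, ha, hya, hax, hra⟩ := h.exists_coface_of_rk_lt hy.1.1 hx.1.1 hyx (by omega)
    obtain ⟨b, hb, hba, hyb, hbx, hrb, hall⟩ :=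
      h.exists_diamond hy.1.1 hx.1.1 ha hya hax hra (by omega)
    have hao := outer_of_subset hx ha hax
    have hbo := outer_of_subset hx hb hbx
    have hra' := hX.rk_star hc hao
    have hrb' := hX.rk_star hc hbo
    refine ⟨X.star a, X.star b, fun hab => hba ((hX.star_inj hao.1 hbo.1).1 hab).symm, ?_⟩
    ext r
    rw [hmem, Set.mem_insert_iff, Set.mem_singleton_iff]
    constructor
    · rintro ⟨hrD, h1, h2, h3⟩
      obtain ⟨d, hd, rfl⟩ | ⟨d, hd, rfl⟩ := (hX.mem_dual_total hc).1 hrD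
      · exact absurd h2 (hX.not_tilde_subset_star hd.1)
      · have hrd := hX.rk_star hc hd
        rcases hall d hd.1.1 ((hX.star_subset_star hd.1).1 h2)
          ((hX.star_subset_star hx.1).1 h1) (by omega) with rfl | rfl <;> simp
    · rintro (rfl | rfl)
      · exact ⟨hX.star_mem hc hao, (hX.star_subset_star hx.1).2 hax,
          (hX.star_subset_star hao.1).2 hya, by omega⟩
      · exact ⟨hX.star_mem hc hbo, (hX.star_subset_star hx.1).2 hbx,
          (hX.star_subset_star hbo.1).2 hyb, by omega⟩

theorem IsCobordism.dual_exists_coface (hX : X.IsCobordism) (hc : X.Collared)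
    {s' : Set (Set V)} (hs : s ∈ X.dual.total.cells) (hs' : s' ∈ X.dual.total.cells)
    (hss : s ⊂ s') : ∃ r ∈ X.dual.total.cofaces s, r ⊆ s' := by
  have h := hX.isCC
  obtain ⟨x, hx, rfl⟩ | ⟨x, hx, rfl⟩ := (hX.mem_dual_total hc).1 hs <;>
    obtain ⟨y, hy, rfl⟩ | ⟨y, hy, rfl⟩ := (hX.mem_dual_total hc).1 hs'
  · have hyx := (hX.tilde_subset_tilde hx.1).1 hss.1
    obtain ⟨a, ha, hya, hax, hra⟩ := h.exists_face hy.1 hx.1 hyx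
      (h.rk_lt_rk _ hy.1 _ hx.1 (hyx.ssubset_of_ne (by rintro rfl; exact hss.2 le_rfl)))
    have hai := inner_of_subset hy ha hya
    have h1 := hX.rk_tilde hx
    have h2 := hX.rk_tilde hai
    exact ⟨X.tilde a, ⟨hX.tilde_mem hc hai, (hX.tilde_subset_tilde hx.1).2 hax, by omega⟩,
      (hX.tilde_subset_tilde ha).2 hya⟩
  · exact absurd hss.1 (hX.not_tilde_subset_star hx.1)
  · have hyx := (hX.star_subset_tilde hx.1).1 hss.1
    have hxi := hX.outer_subset_inner hx
    have h1 := hX.rk_star hc hx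
    have h2 := hX.rk_tilde hxi
    exact ⟨X.tilde x, ⟨hX.tilde_mem hc hxi, star_subset_tilde_self, by omega⟩,
      (hX.tilde_subset_tilde hxi.1).2 hyx⟩
  · have hyx := (hX.star_subset_star hx.1).1 hss.1
    obtain ⟨a, ha, hya, hax, hra⟩ := h.exists_face hy.1.1 hx.1.1 hyx
      (h.rk_lt_rk _ hy.1.1 _ hx.1.1 (hyx.ssubset_of_ne (by rintro rfl; exact hss.2 le_rfl)))
    have hao := outer_of_subset hx ha hax
    have h1 := hX.rk_star hc hx
    have h2 := hX.rk_star hc hao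
    exact ⟨X.star a, ⟨hX.star_mem hc hao, (hX.star_subset_star hx.1).2 hax, by omega⟩,
      (hX.star_subset_star hao.1).2 hya⟩

theorem IsCobordism.dual_isCC (hX : X.IsCobordism) (hc : X.Collared) :
    X.dual.total.IsCC where
  finite_verts := hX.isCC.finite_cells.subset fun t ht => by
    obtain h | h := (hX.mem_dual_verts hc).1 ht
    exacts [h.1, h.1.1.1]
  nonempty_of_mem s hs := by
    obtain ⟨x, hx, rfl⟩ | ⟨x, hx, rfl⟩ := (hX.mem_dual_total hc).1 hs
    · obtain ⟨z, hz, -⟩ := hX.exists_top_mem_tilde hx.1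
      exact ⟨z, hz⟩
    · exact hX.exists_mem_star hx.1
  subset_verts s hs := by
    obtain ⟨x, hx, rfl⟩ | ⟨x, hx, rfl⟩ := (hX.mem_dual_total hc).1 hs
    · exact hX.tilde_subset_verts hc hx
    · exact star_subset_tilde_self.trans (hX.tilde_subset_verts hc (hX.outer_subset_inner hx))
  rk_eq_zero_iff s hs := by
    obtain ⟨x, hx, rfl⟩ | ⟨x, hx, rfl⟩ := (hX.mem_dual_total hc).1 hs
    · have h1 := hX.rk_tilde hx
      refine ⟨fun h0 => ⟨x, hX.tilde_eq_singleton hx.1 (by omega)⟩, fun ⟨t, ht⟩ => ?_⟩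
      obtain ⟨z, hz, -, hr⟩ := hX.exists_top_mem_tilde hx.1
      have h2 := hX.sInter_tilde hx.1
      rw [ht, Set.mem_singleton_iff] at hz
      rw [ht, Set.sInter_singleton] at h2
      subst hz h2
      omega
    · have h1 := hX.rk_star hc hx
      refine ⟨fun h0 => ⟨x, hX.star_eq_singleton hx.1 (by omega)⟩, fun ⟨t, ht⟩ => ?_⟩
      obtain ⟨z, hz⟩ := hX.exists_mem_star hx.1
      have hr := (hX.mem_star.1 hz).2.1
      have h2 := hX.sInter_star hx.1
      rw [ht, Set.mem_singleton_iff] at hz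
      rw [ht, Set.sInter_singleton] at h2
      subst hz h2
      omega
  rk_lt_rk s hs s' hs' hss := by
    obtain ⟨r, ⟨hr, hsr, hrk⟩, hrs⟩ := hX.dual_exists_coface hc hs hs' hss
    have hmono : ∀ s ∈ X.dual.total.cells, ∀ s' ∈ X.dual.total.cells, s ⊆ s' →
        X.dual.total.rk s ≤ X.dual.total.rk s' := by
      intro s hs s' hs' hss
      obtain ⟨x, hx, rfl⟩ | ⟨x, hx, rfl⟩ := (hX.mem_dual_total hc).1 hs <;>
        obtain ⟨y, hy, rfl⟩ | ⟨y, hy, rfl⟩ := (hX.mem_dual_total hc).1 hs'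
      · have := hX.isCC.rk_mono hy.1 hx.1 ((hX.tilde_subset_tilde hx.1).1 hss)
        have h1 := hX.rk_tilde hx
        have h2 := hX.rk_tilde hy
        omega
      · exact absurd hss (hX.not_tilde_subset_star hx.1)
      · have := hX.isCC.rk_mono hy.1 hx.1.1 ((hX.star_subset_tilde hx.1).1 hss)
        have h1 := hX.rk_star hc hx
        have h2 := hX.rk_tilde hy
        omega
      · have := hX.isCC.rk_mono hy.1.1 hx.1.1 ((hX.star_subset_star hx.1).1 hss)
        have h1 := hX.rk_star hc hx
        have h2 := hX.rk_star hc hy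
        omega
    have := hmono r hr s' hs' hrs
    omega
  inter_mem s hs s' hs' := hX.dual_inter_mem hc hs hs'
  exists_coface s hs s' hs' := hX.dual_exists_coface hc hs hs'
  diamond s hs s' hs' := hX.dual_diamond hc hs hs'

/-! ### Top cells, non-singularity and boundary of the dual. -/

theorem IsCobordism.exists_inner_vertex (hX : X.IsCobordism) (hx : x ∈ X.inner) :
    ∃ v ∈ x, {v} ∈ X.inner ∧ X.dual.total.rk (X.tilde {v}) = X.total.rank := by
  obtain ⟨hxK, v, hv, hvJ⟩ := hx
  have hvi := hX.singleton_inner hxK hv hvJ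
  have h1 := hX.rk_tilde hvi
  rw [hX.isCC.rk_singleton hvi.1] at h1
  exact ⟨v, hv, hvi, h1⟩

theorem IsCobordism.dual_rank (hX : X.IsCobordism) (hc : X.Collared) :
    X.dual.total.rank = X.total.rank := by
  rcases X.total.cells.eq_empty_or_nonempty with h0 | ⟨x, hx⟩
  · rw [rank_eq_zero_of_empty h0, rank_eq_zero_of_empty]
    rw [Set.eq_empty_iff_forall_notMem]
    intro s hs
    obtain ⟨x, hx, -⟩ | ⟨x, hx, -⟩ := (hX.mem_dual_total hc).1 hs
    · exact absurd hx.1 (by simp [h0])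
    · exact absurd hx.1.1 (by simp [h0])
  · obtain ⟨z, hz, -, hr⟩ := hX.total_mem.nonSingular.pure.exists_top hX.isCC hx
    obtain ⟨v, -, hv, hvr⟩ := hX.exists_inner_vertex (hX.inner_of_rk hz hr)
    refine rank_eq_of_forall_le (hX.tilde_mem hc hv) hvr fun s hs => ?_
    obtain ⟨x, hx, rfl⟩ | ⟨x, hx, rfl⟩ := (hX.mem_dual_total hc).1 hs
    · have := hX.rk_tilde hx
      omega
    · have := hX.rk_star hc hx
      omega

theorem IsCobordism.mem_dual_dualSet (hX : X.IsCobordism) (hc : X.Collared)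
    {r : Set (Set V)} : r ∈ X.dual.total.dualSet s ↔
      ∃ v, {v} ∈ X.inner ∧ X.tilde {v} = r ∧ s ⊆ r := by
  rw [mem_dualSet, hX.dual_rank hc, hX.mem_dual_total hc]
  constructor
  · rintro ⟨⟨x, hx, rfl⟩ | ⟨x, hx, rfl⟩, h2, h3⟩
    · have := hX.rk_tilde hx
      obtain ⟨v, rfl⟩ := (hX.isCC.rk_eq_zero_iff x hx.1).1 (by omega)
      exact ⟨v, hx, rfl, h3⟩
    · have := hX.rk_star hc hx
      omega
  · rintro ⟨v, hv, rfl, h⟩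
    have := hX.rk_tilde hv
    rw [hX.isCC.rk_singleton hv.1] at this
    exact ⟨.inl ⟨_, hv, rfl⟩, this, h⟩

theorem mem_of_singleton_inner (h : {v} ∈ X.inner) : v ∉ X.removed.verts := by
  obtain ⟨-, w, rfl, hw⟩ := h
  exact hw

/-- Top cells of the dual are vertices of `K` outside `J`, so a pinch of the dual at `tilde x` would
be a disconnection of `x` minus `J`. -/
theorem IsCobordism.dual_dualSet_tilde (hX : X.IsCobordism) (hc : X.Collared)
    (hx : x ∈ X.inner) : X.dual.total.dualSet (X.tilde x) =
      (fun v => X.tilde {v}) '' (x \ X.removed.verts) := by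
  ext r
  rw [hX.mem_dual_dualSet hc]
  constructor
  · rintro ⟨v, hv, rfl, h⟩
    exact ⟨v, ⟨by simpa using (hX.tilde_subset_tilde hx.1).1 h, mem_of_singleton_inner hv⟩, rfl⟩
  · rintro ⟨v, ⟨hv, hvJ⟩, rfl⟩
    exact ⟨v, hX.singleton_inner hx.1 hv hvJ, rfl, (hX.tilde_subset_tilde hx.1).2 (by simpa)⟩

theorem IsCobordism.dual_dualSet_star (hX : X.IsCobordism) (hc : X.Collared)
    (hx : x ∈ X.outer) : X.dual.total.dualSet (X.star x) = (fun v => X.tilde {v}) '' x := by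
  ext r
  rw [hX.mem_dual_dualSet hc]
  constructor
  · rintro ⟨v, hv, rfl, h⟩
    exact ⟨v, by simpa using (hX.star_subset_tilde hx.1).1 h, rfl⟩
  · rintro ⟨v, hv, rfl⟩
    exact ⟨v, hX.singleton_inner hx.1.1 hv (hx.2 v hv), rfl,
      (hX.star_subset_tilde hx.1).2 (by simpa)⟩

/-- For a facet `x` off the boundary the two ends are its two co-faces; for a boundary facet they
are its only co-face and `x` itself. Edges of the form `star x` have two ends because `∂K` is
closed. -/
theorem IsCobordism.dual_graphBased (hX : X.IsCobordism) (hc : X.Collared) :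
    X.dual.total.GraphBased := by
  intro s hs hr
  have h := hX.isCC
  obtain ⟨x, hx, rfl⟩ | ⟨x, hx, rfl⟩ := (hX.mem_dual_total hc).1 hs
  · have h1 := hX.rk_tilde hx
    have hn := hX.total_mem.nonSingular
    by_cases hb : x ∈ X.total.boundary.cells
    · obtain ⟨z, hz⟩ := h.exists_cofaces_eq_of_mem_boundary hb (by omega)
      rw [cofaces_eq_dualSet (by omega)] at hz
      have : X.tilde x = {z, x} := by
        rw [Set.insert_eq, ← hz, ← hX.star_eq_singleton hb (by omega)]
        rfl
      rw [this]
      refine Set.encard_pair ?_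
      rintro rfl
      have : z ∈ X.total.dualSet z := by rw [hz]; rfl
      have := this.2.1
      omega
    · have hs : X.star x = ∅ := by
        rw [Set.eq_empty_iff_forall_notMem]
        intro t ht
        obtain ⟨h1, -, h3⟩ := hX.mem_star.1 ht
        exact hb (mem_boundary_of_subset hx.1 h1 h3)
      have : X.tilde x = X.total.cofaces x := by
        rw [cofaces_eq_dualSet (by omega)]
        show _ ∪ X.star x = _
        rw [hs, Set.union_empty]
      have hle := hn.nonBranching x hx.1 (by omega)
      rw [← this] at hle
      have hn1 : (X.tilde x).encard ≠ 1 := fun h1 => hb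
        ⟨hx.1, x, hx.1, by omega, by rw [← this]; exact Set.encard_eq_one.1 h1, le_rfl⟩
      have hn0 : (X.tilde x).encard ≠ 0 := by
        obtain ⟨z, hz, -⟩ := hX.exists_top_mem_tilde hx.1
        rw [Set.encard_ne_zero]
        exact ⟨z, hz⟩
      have hf : (X.tilde x).Finite := by
        rw [this]
        exact h.finite_cells.subset fun _ h => h.1
      rw [← hf.cast_ncard_eq] at hle hn1 hn0 ⊢
      norm_cast at hle hn1 hn0 ⊢
      omega
  · have h1 := hX.rk_star hc hx
    have := h.boundary_rank ⟨x, hx.1⟩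
    obtain ⟨z, w, hzw, he⟩ := hX.closed_boundary.exists_dualSet_eq_pair hx.1
      (show X.total.rk x + 1 = _ by omega)
    show (X.total.boundary.dualSet x).encard = 2
    rw [he, Set.encard_pair hzw]

theorem IsCobordism.dual_nonSingular (hX : X.IsCobordism) (hc : X.Collared) :
    X.dual.total.NonSingular where
  isCC := hX.dual_isCC hc
  graphBased := hX.dual_graphBased hc
  pure := .of_exists_top fun s hs => by
    rw [hX.dual_rank hc]
    obtain ⟨x, hx, rfl⟩ | ⟨x, hx, rfl⟩ := (hX.mem_dual_total hc).1 hs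
    · obtain ⟨v, hv, hvi, hvr⟩ := hX.exists_inner_vertex hx
      exact ⟨_, hX.tilde_mem hc hvi, (hX.tilde_subset_tilde hx.1).2 (by simpa), hvr⟩
    · obtain ⟨v, hv, hvi, hvr⟩ := hX.exists_inner_vertex (hX.outer_subset_inner hx)
      exact ⟨_, hX.tilde_mem hc hvi, (hX.star_subset_tilde hx.1).2 (by simpa), hvr⟩
  nonBranching s hs hr := by
    rw [cofaces_eq_dualSet hr]
    rw [hX.dual_rank hc] at hr
    obtain ⟨x, hx, rfl⟩ | ⟨x, hx, rfl⟩ := (hX.mem_dual_total hc).1 hs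
    · have h1 := hX.rk_tilde hx
      rw [hX.dual_dualSet_tilde hc hx]
      calc _ ≤ (x \ X.removed.verts).encard := Set.encard_image_le _ _
        _ ≤ x.encard := Set.encard_le_encard Set.sdiff_subset
        _ = 2 := hX.graphBased x hx.1 (by omega)
    · have h1 := hX.rk_star hc hx
      obtain ⟨v, rfl⟩ := (hX.isCC.rk_eq_zero_iff x hx.1.1).1 (by omega)
      rw [hX.dual_dualSet_star hc hx, Set.image_singleton, Set.encard_singleton]
      norm_num

theorem inner_of_collar (hx : x ∈ X.total.collar X.removed) : x ∈ X.inner :=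
  ⟨hx.1, (mem_collar.1 hx).2.2⟩

theorem not_outer_of_collar (hx : x ∈ X.total.collar X.removed) : x ∉ X.outer := fun h => by
  obtain ⟨a, ha, haJ⟩ := (mem_collar.1 hx).2.1
  exact h.2 a ha haJ

/-- The co-faces of `tilde e`, for an inner edge `e`, come from the ends of `e` outside `J`, so
there is just one exactly when `e` is a collar edge. The only co-face of `star {v}` is `tilde {v}`.
A cell of the collar contains a collar edge because it is connected. -/
theorem IsCobordism.mem_dual_boundary (hX : X.IsCobordism) (hc : X.Collared) :
    s ∈ X.dual.total.boundary.cells ↔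
      (∃ x ∈ X.total.collar X.removed, X.tilde x = s) ∨ ∃ x ∈ X.outer, X.star x = s := by
  have h := hX.isCC
  have hrank := hX.dual_rank hc
  constructor
  · rintro ⟨hs, r, hr, hrr, ⟨q, hq⟩, hsr⟩
    obtain ⟨x, hx, rfl⟩ | hx := (hX.mem_dual_total hc).1 hs
    · left
      obtain ⟨e, he, rfl⟩ | ⟨e, he, rfl⟩ := (hX.mem_dual_total hc).1 hr
      · have h1 := hX.rk_tilde he
        have hex := (hX.tilde_subset_tilde hx.1).1 hsr
        obtain ⟨a, b, hab, rfl⟩ := Set.encard_eq_two.1 (hX.graphBased e he.1 (by omega))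
        rw [cofaces_eq_dualSet hrr, hX.dual_dualSet_tilde hc he] at hq
        refine ⟨x, mem_collar.2 ⟨hx.1, ?_, hx.2⟩, rfl⟩
        by_contra! hall
        have ha : a ∉ X.removed.verts := hall a (hex (by simp))
        have hb : b ∉ X.removed.verts := hall b (hex (by simp))
        have h1 : X.tilde {a} = q := hq.subset ⟨a, ⟨by simp, ha⟩, rfl⟩
        have h2 : X.tilde {b} = q := hq.subset ⟨b, ⟨by simp, hb⟩, rfl⟩
        have := (hX.tilde_inj (h.singleton_mem he.1 (by simp))
          (h.singleton_mem he.1 (by simp))).1 (h1.trans h2.symm)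
        exact hab (Set.singleton_injective this)
      · exact absurd hsr (hX.not_tilde_subset_star hx.1)
    · exact .inr hx
  · rintro (⟨x, hx, rfl⟩ | ⟨x, hx, rfl⟩)
    · obtain ⟨a, b, ha, hb, hab, hax, hbx⟩ := exists_collarEdge (hX.linkedOn hx.1) hx
      have he : {a, b} ∈ X.inner := ⟨hab.2.1, b, by simp, hb⟩
      have h1 := hX.rk_tilde he
      rw [hab.2.2] at h1
      refine ⟨hX.tilde_mem hc (inner_of_collar hx), _, hX.tilde_mem hc he, by omega,
        ⟨X.tilde {b}, ?_⟩, (hX.tilde_subset_tilde hx.1).2 (Set.pair_subset hax hbx)⟩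
      rw [cofaces_eq_dualSet (by omega), hX.dual_dualSet_tilde hc he]
      have : ({a, b} : Set V) \ X.removed.verts = {b} := by
        ext v
        simp only [Set.mem_sdiff, Set.mem_insert_iff, Set.mem_singleton_iff]
        constructor
        · rintro ⟨rfl | rfl, hv⟩
          · exact absurd ha hv
          · rfl
        · rintro rfl
          exact ⟨.inr rfl, hb⟩
      rw [this, Set.image_singleton]
    · obtain ⟨v, hv⟩ := h.nonempty_of_mem x hx.1.1
      have hvK := h.singleton_mem hx.1.1 hv
      have hvo : {v} ∈ X.outer := outer_of_subset hx hvK (by simpa)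
      have h1 := hX.rk_star hc hvo
      rw [h.rk_singleton hvK] at h1
      refine ⟨hX.star_mem hc hx, _, hX.star_mem hc hvo, by omega, ⟨X.tilde {v}, ?_⟩,
        (hX.star_subset_star hx.1).2 (by simpa)⟩
      rw [cofaces_eq_dualSet (by omega), hX.dual_dualSet_star hc hvo, Set.image_singleton]

/-! ### Absence of pinches in the dual and in its boundary. -/

theorem IsCobordism.dual_dualGraph_adj (hX : X.IsCobordism) (hc : X.Collared)
    (huv : X.total.graph.Adj u v) (hu : u ∉ X.removed.verts) (hv : v ∉ X.removed.verts) :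
    X.dual.total.dualGraph.Adj (X.tilde {u}) (X.tilde {v}) := by
  have h := hX.isCC
  have he : {u, v} ∈ X.inner := ⟨huv.2.1, u, by simp, hu⟩
  have h1 := hX.rk_tilde he
  rw [huv.2.2, ← hX.dual_rank hc] at h1
  rw [(hX.dual_isCC hc).dualGraph_adj_iff, ne_eq, hX.tilde_inj
    (h.singleton_mem huv.2.1 (by simp)) (h.singleton_mem huv.2.1 (by simp))]
  refine ⟨fun h => huv.1 (Set.singleton_injective h), _, hX.tilde_mem hc he, h1, ?_⟩
  rw [hX.dual_dualSet_tilde hc he, sdiff_eq_left.2, Set.image_pair]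
  rw [Set.disjoint_left]
  rintro a (rfl | rfl)
  exacts [hu, hv]

/-- Over `tilde x` this is connectedness of `x` minus `J`, from `linkedOn_diff`; over `star x` it is
connectedness of `x`, which misses `J`. -/
theorem IsCobordism.dual_not_isPinch (hX : X.IsCobordism) (hc : X.Collared) :
    ∀ s, ¬ X.dual.total.IsPinch s := by
  rw [forall_not_isPinch_iff]
  intro s hs
  obtain ⟨x, hx, rfl⟩ | ⟨x, hx, rfl⟩ := (hX.mem_dual_total hc).1 hs
  · rw [hX.dual_dualSet_tilde hc hx]
    refine (hX.linkedOn_diff hc hx.1).map (fun v => X.tilde {v}) (fun a ha b hb hab => ?_) ?_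
    · exact .of_adj ⟨a, ha, rfl⟩ ⟨b, hb, rfl⟩ (hX.dual_dualGraph_adj hc hab ha.2 hb.2)
    · rintro _ ⟨a, ha, rfl⟩
      exact ⟨a, ha, .refl⟩
  · rw [hX.dual_dualSet_star hc hx]
    refine (hX.linkedOn hx.1.1).map (fun v => X.tilde {v}) (fun a ha b hb hab => ?_) ?_
    · exact .of_adj ⟨a, ha, rfl⟩ ⟨b, hb, rfl⟩
        (hX.dual_dualGraph_adj hc hab (hx.2 a ha) (hx.2 b hb))
    · rintro _ ⟨a, ha, rfl⟩
      exact ⟨a, ha, .refl⟩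

/-- The top cells of the boundary of the dual. -/
theorem IsCobordism.mem_dual_boundary_dualSet (hX : X.IsCobordism) (hc : X.Collared)
    {r : Set (Set V)} : r ∈ X.dual.total.boundary.dualSet s ↔
      ((∃ e ∈ X.total.collar X.removed, X.total.rk e = 1 ∧ X.tilde e = r) ∨
        ∃ v, {v} ∈ X.outer ∧ X.star {v} = r) ∧ s ⊆ r := by
  rw [(hX.dual_isCC hc).mem_boundary_dualSet, hX.mem_dual_boundary hc, hX.dual_rank hc,
    ← and_assoc]
  refine and_congr_left fun _ => ?_
  constructor
  · rintro ⟨⟨x, hx, rfl⟩ | ⟨x, hx, rfl⟩, hr⟩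
    · have := hX.rk_tilde (inner_of_collar hx)
      exact .inl ⟨x, hx, by omega, rfl⟩
    · have := hX.rk_star hc hx
      obtain ⟨v, rfl⟩ := (hX.isCC.rk_eq_zero_iff x hx.1.1).1 (by omega)
      exact .inr ⟨v, hx, rfl⟩
  · rintro (⟨x, hx, hr, rfl⟩ | ⟨v, hv, rfl⟩)
    · have := hX.rk_tilde (inner_of_collar hx)
      exact ⟨.inl ⟨x, hx, rfl⟩, by omega⟩
    · have := hX.rk_star hc hv
      rw [hX.isCC.rk_singleton hv.1.1] at this
      exact ⟨.inr ⟨_, hv, rfl⟩, by omega⟩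

theorem IsCobordism.dual_boundary_dualSet_star (hX : X.IsCobordism) (hc : X.Collared)
    (hx : x ∈ X.outer) :
    X.dual.total.boundary.dualSet (X.star x) = (fun v => X.star {v}) '' x := by
  ext r
  rw [hX.mem_dual_boundary_dualSet hc]
  constructor
  · rintro ⟨⟨e, he, -, rfl⟩ | ⟨v, hv, rfl⟩, hs⟩
    · exact absurd (outer_of_subset hx he.1 ((hX.star_subset_tilde hx.1).1 hs))
        (not_outer_of_collar he)
    · exact ⟨v, by simpa using (hX.star_subset_star hx.1).1 hs, rfl⟩
  · rintro ⟨v, hv, rfl⟩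
    have hvs : ({v} : Set V) ⊆ x := by simpa
    exact ⟨.inr ⟨v, outer_of_subset hx (hX.isCC.singleton_mem hx.1.1 hv) hvs, rfl⟩,
      (hX.star_subset_star hx.1).2 hvs⟩

theorem IsCobordism.dual_boundary_adj_star (hX : X.IsCobordism) (hc : X.Collared)
    (hx : x ∈ X.outer) (hu : u ∈ x) (hv : v ∈ x) (huv : X.total.graph.Adj u v) :
    X.dual.total.boundary.dualGraph.Adj (X.star {u}) (X.star {v}) := by
  have h := hX.isCC
  have he : {u, v} ∈ X.outer := outer_of_subset hx huv.2.1 (Set.pair_subset hu hv)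
  have hus := h.singleton_mem huv.2.1 (v := u) (by simp)
  have hvs := h.singleton_mem huv.2.1 (v := v) (by simp)
  have h1 := hX.rk_star hc he
  rw [huv.2.2, ← hX.dual_rank hc] at h1
  have hmem : X.star {u, v} ∈ X.dual.total.boundary.cells :=
    (hX.mem_dual_boundary hc).2 (.inr ⟨_, he, rfl⟩)
  have h2 := (hX.dual_isCC hc).boundary_rank ⟨_, hmem⟩
  rw [(hX.dual_isCC hc).boundary.dualGraph_adj_iff, ne_eq, hX.star_inj
    (mem_boundary_of_subset hus he.1 (by simp)) (mem_boundary_of_subset hvs he.1 (by simp))]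
  refine ⟨fun h => huv.1 (Set.singleton_injective h), _, hmem,
    show X.dual.total.rk _ + 1 = _ by omega, ?_⟩
  rw [hX.dual_boundary_dualSet_star hc he, Set.image_pair]

/-- Over `tilde x` with `x` in the collar, the top boundary cells are the collar edges at the
vertices of `x ∩ J`, made adjacent by the collar two-cells over edges of `J`; so cell-connectedness
of `J` suffices. Over `star x` the connectedness of `x` suffices. -/
theorem IsCobordism.dual_boundary_not_isPinch (hX : X.IsCobordism) (hc : X.Collared) :
    ∀ s, ¬ X.dual.total.boundary.IsPinch s := by
  rw [forall_not_isPinch_iff]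
  intro s hs
  have h := hX.isCC
  obtain ⟨x, hx, rfl⟩ | ⟨x, hx, rfl⟩ := (hX.mem_dual_boundary hc).1 hs
  · have hJcc := hX.nonDegenerate.isRelCC.removed_isCC
    -- `f j` is the collar cell over the cell `j` of `J`.
    choose! f hf hfa using hc.exists_inter_eq
    have hfe : ∀ a ∈ X.removed.verts, f {a} ∈ X.total.collar X.removed ∧
        f {a} ∩ X.removed.verts = {a} := fun a ha => ⟨hf _ ha, hfa _ ha⟩
    have hsub : ∀ a ∈ X.removed.verts, ∀ y ∈ X.inner, a ∈ y → f {a} ⊆ y := by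
      intro a ha y hy hay
      refine hc.subset_of_inter_subset' (hfe a ha).1 hy ?_
      rw [(hfe a ha).2]
      simpa
    have hdual : ∀ y ∈ X.total.collar X.removed,
        X.dual.total.boundary.dualSet (X.tilde y) =
          (fun a => X.tilde (f {a})) '' (y ∩ X.removed.verts) := by
      intro y hy
      ext r
      rw [hX.mem_dual_boundary_dualSet hc]
      constructor
      · rintro ⟨⟨e, he, her, rfl⟩ | ⟨v, hv, rfl⟩, hs⟩
        · have h1 := hc.inter_mem e he
          have h2 := hc.rk_eq e he
          obtain ⟨a, ha⟩ := (h.rk_eq_zero_iff _ (hX.nonDegenerate.isRelCC.isSub.1 h1)).1 (by omega)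
          have hae : a ∈ e ∩ X.removed.verts := by rw [ha]; rfl
          refine ⟨a, ⟨(hX.tilde_subset_tilde hy.1).1 hs hae.1, hae.2⟩, ?_⟩
          show X.tilde (f {a}) = _
          rw [hc.eq_of_inter_eq (hfe a hae.2).1 he (by rw [ha, (hfe a hae.2).2])]
        · exact absurd hs (hX.not_tilde_subset_star hy.1)
      · rintro ⟨a, ⟨hay, ha⟩, rfl⟩
        have hrk := hc.rk_eq _ (hfe a ha).1
        rw [(hfe a ha).2, h.rk_singleton (h.singleton_mem hy.1 hay)] at hrk
        exact ⟨.inl ⟨_, (hfe a ha).1, hrk, rfl⟩,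
          (hX.tilde_subset_tilde hy.1).2 (hsub a ha y (inner_of_collar hy) hay)⟩
    have hlink := (hJcc.cellConnected_iff.1 hX.removed_mem.cellConnected).2 _ (hc.inter_mem x hx)
    rw [hdual x hx]
    refine hlink.map (fun a => X.tilde (f {a})) (fun a ha b hb hab => ?_) ?_
    · refine .of_adj ⟨a, ha, rfl⟩ ⟨b, hb, rfl⟩ ?_
      have hy := hf _ hab.2.1
      have hya := hfa _ hab.2.1
      set y := f {a, b} with hydef
      have hyr := hc.rk_eq y hy
      rw [hya, ← hX.nonDegenerate.rk_removed hab.2.1, hab.2.2] at hyr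
      have hmem : X.tilde y ∈ X.dual.total.boundary.cells :=
        (hX.mem_dual_boundary hc).2 (.inl ⟨y, hy, rfl⟩)
      have h1 := hX.rk_tilde (inner_of_collar hy)
      have h2 := (hX.dual_isCC hc).boundary_rank ⟨_, hmem⟩
      rw [hX.dual_rank hc] at h2
      rw [(hX.dual_isCC hc).boundary.dualGraph_adj_iff]
      refine ⟨fun he => hab.1 ?_, X.tilde y, hmem, show X.dual.total.rk _ + 1 = _ by omega, ?_⟩
      · have := (hX.tilde_inj (hfe a ha.2).1.1 (hfe b hb.2).1.1).1 he
        apply Set.singleton_injective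
        rw [← (hfe a ha.2).2, ← (hfe b hb.2).2, this]
      · rw [hdual y hy, hya, Set.image_pair]
    · rintro _ ⟨a, ha, rfl⟩
      exact ⟨a, ha, .refl⟩
  · rw [hX.dual_boundary_dualSet_star hc hx]
    refine (hX.linkedOn hx.1.1).map (fun v => X.star {v}) (fun a ha b hb hab => ?_) ?_
    · exact .of_adj ⟨a, ha, rfl⟩ ⟨b, hb, rfl⟩ (hX.dual_boundary_adj_star hc hx ha hb hab)
    · rintro _ ⟨a, ha, rfl⟩
      exact ⟨a, ha, .refl⟩

/-! ### Connectedness of the dual -/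

theorem IsCobordism.inner_of_notMem_boundary (hX : X.IsCobordism) (hx : x ∈ X.total.cells)
    (hb : x ∉ X.total.boundary.cells) : x ∈ X.inner := by
  rw [← hX.nonDegenerate.diff_eq_inner]
  exact ⟨hx, fun h => hb (hX.removed_isSub.1 h)⟩

theorem IsCobordism.dual_graph_adj_of_dualGraph (hX : X.IsCobordism) (hc : X.Collared)
    (hzw : X.total.dualGraph.Adj z w) : X.dual.total.graph.Adj z w := by
  obtain ⟨hne, y, ⟨hy, hyb⟩, hr, hd⟩ := hzw
  have hyi := hX.inner_of_notMem_boundary hy hyb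
  have h1 := hX.rk_tilde hyi
  have hs : X.star y = ∅ := by
    rw [Set.eq_empty_iff_forall_notMem]
    intro t ht
    obtain ⟨h1, -, h3⟩ := hX.mem_star.1 ht
    exact hyb (mem_boundary_of_subset hy h1 h3)
  have : X.tilde y = {z, w} := by
    show X.total.dualSet y ∪ X.star y = _
    rw [hs, hd, Set.union_empty]
  rw [graph_adj, ← this]
  exact ⟨hne, hX.tilde_mem hc hyi, by omega⟩

theorem IsCobordism.exists_adj_facet (hX : X.IsCobordism) (hc : X.Collared)
    (ht : t ∈ X.outer) (hr : X.total.rk t + 1 = X.total.rank) :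
    ∃ z ∈ X.total.dualSet t, X.dual.total.graph.Adj z t := by
  obtain ⟨z, hz⟩ := hX.isCC.exists_cofaces_eq_of_mem_boundary ht.1 hr
  rw [cofaces_eq_dualSet hr] at hz
  have hzt : z ∈ X.total.dualSet t := by rw [hz]; rfl
  have hti := hX.outer_subset_inner ht
  have h1 := hX.rk_tilde hti
  have : X.tilde t = {z, t} := by
    rw [Set.insert_eq, ← hz, ← hX.star_eq_singleton ht.1 hr]
    rfl
  refine ⟨z, hzt, ?_⟩
  rw [graph_adj, ← this]
  refine ⟨?_, hX.tilde_mem hc hti, by omega⟩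
  rintro rfl
  have := hzt.2.1
  omega

theorem IsCobordism.removed_graph_adj (hX : X.IsCobordism) (hc : X.Collared)
    (hz : z ∈ X.outer) (hzw : X.total.boundary.dualGraph.Adj z w) :
    X.dual.removed.graph.Adj z w := by
  obtain ⟨hne, y, hy, hr, hd⟩ := hzw
  have hzy : z ∈ X.star y := by
    show z ∈ X.total.boundary.dualSet y
    rw [hd]
    simp
  have hyo := outer_of_subset hz hy.1.1 (hX.mem_star.1 hzy).2.2
  have h1 := hX.rk_removed_star hc hyo
  have h2 := hX.isCC.boundary_rank ⟨y, hy.1⟩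
  have hr' : X.total.rk y + 1 = X.total.boundary.rank := hr
  have : X.star y = {z, w} := hd
  rw [graph_adj, ← this]
  exact ⟨hne, (hX.mem_dual_removed hc).2 ⟨y, hyo, rfl⟩, by omega⟩

/-- Absence of a `K`-pinch at `x` joins the top cells in `tilde x`, and each boundary facet hangs on
its unique co-face by an edge. -/
theorem IsCobordism.dual_linkedOn_tilde (hX : X.IsCobordism) (hc : X.Collared)
    (hx : x ∈ X.inner) : X.dual.total.graph.LinkedOn (X.tilde x) := by
  have hK := (forall_not_isPinch_iff.1 hX.total_mem.nonPinching.1) x hx.1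
  refine hK.map id (fun a ha b hb hab => ?_) fun t ht => ?_
  · exact .of_adj (Or.inl ha) (Or.inl hb) (hX.dual_graph_adj_of_dualGraph hc hab)
  · obtain ⟨hxt, h | ⟨h, hr⟩⟩ := hX.mem_tilde.1 ht
    · exact ⟨t, ⟨h.1, h.2, hxt⟩, .refl⟩
    · obtain ⟨z, hz, hadj⟩ := hX.exists_adj_facet hc (hX.outer_facet hc hx h hxt) hr
      have hzx : z ∈ X.total.dualSet x := ⟨hz.1, hz.2.1, hxt.trans hz.2.2⟩
      exact ⟨z, hzx, .of_adj (Or.inl hzx) ht hadj⟩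

theorem IsCobordism.removed_linkedOn_star (hX : X.IsCobordism) (hc : X.Collared)
    (hx : x ∈ X.outer) : X.dual.removed.graph.LinkedOn (X.star x) := by
  have hK := (forall_not_isPinch_iff.1 hX.total_mem.nonPinching.2) x hx.1
  refine SimpleGraph.LinkedOn.congr hK fun a ha b hb hab => ?_
  exact hX.removed_graph_adj hc (hX.outer_of_superset hc hx ha.1 ha.2.2) hab

/-- The dual set of `∅` is the set of all top cells. Follow a path of vertices of `K`: consecutive
vertices share a top cell over their edge, and the top cells at each vertex are linked since it is
not a pinch. -/
theorem IsCobordism.dualGraph_linkedOn_top (hX : X.IsCobordism) :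
    X.total.dualGraph.LinkedOn (X.total.dualSet ∅) := by
  have h := hX.isCC
  have hK := forall_not_isPinch_iff.1 hX.total_mem.nonPinching.1
  have hmono : ∀ A : Set V, X.total.dualSet A ⊆ X.total.dualSet ∅ :=
    fun A => dualSet_anti (Set.empty_subset A)
  intro z hz z' hz'
  obtain ⟨v, hv⟩ := h.nonempty_of_mem z hz.1
  obtain ⟨v', hv'⟩ := h.nonempty_of_mem z' hz'.1
  have key : ∀ u, X.total.graph.LinkIn X.total.verts v u → ∀ w ∈ X.total.dualSet {u},
      X.total.dualGraph.LinkIn (X.total.dualSet ∅) z w := by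
    intro u hu
    induction hu with
    | refl =>
      intro w hw
      exact (hK {v} (h.singleton_mem hz.1 hv) z ⟨hz.1, hz.2.1, by simpa⟩ w hw).mono (hmono _)
    | @tail u u' _ huu ih =>
      intro w hw
      obtain ⟨t, ht, het, htr⟩ := hX.total_mem.nonSingular.pure.exists_top h huu.2.2.2.1
      exact (ih t ⟨ht, htr, by simpa using het (by simp)⟩).trans
        ((hK {u'} huu.2.1 t ⟨ht, htr, by simpa using het (by simp)⟩ w hw).mono (hmono _))
  exact key v' (hX.total_mem.isLocal.connected.linkedOn h v (h.singleton_mem hz.1 hv) v'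
    (h.singleton_mem hz'.1 hv')) z' ⟨hz'.1, hz'.2.1, by simpa⟩

theorem IsCobordism.removed_isSub_dual (hX : X.IsCobordism) (hc : X.Collared) :
    X.dual.removed.IsSub X.dual.total := by
  refine ⟨fun s hs => Or.inr hs, fun s hs => ?_⟩
  obtain ⟨x, hx, rfl⟩ := (hX.mem_dual_removed hc).1 hs
  exact hX.rk_star_eq.symm

theorem IsCobordism.dual_isLocal (hX : X.IsCobordism) (hc : X.Collared) :
    X.dual.total.IsLocal := by
  refine ⟨hX.dual_isCC hc, connected_of_linkedOn (hX.dual_graphBased hc) ?_,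
    (hX.dual_isCC hc).cellConnected_iff.2 ⟨hX.dual_graphBased hc, fun s hs => ?_⟩⟩
  · have hsub : ∀ a ∈ X.total.dualSet ∅, a ∈ X.dual.total.verts := fun a ha =>
      (hX.mem_dual_verts hc).2 (.inl ⟨ha.1, ha.2.1⟩)
    refine hX.dualGraph_linkedOn_top.map id (fun a ha b hb hab => ?_) fun t ht => ?_
    · exact .of_adj (hsub a ha) (hsub b hb) (hX.dual_graph_adj_of_dualGraph hc hab)
    · obtain h | ⟨h, hr⟩ := (hX.mem_dual_verts hc).1 ht
      · exact ⟨t, ⟨h.1, h.2, Set.empty_subset _⟩, .refl⟩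
      · obtain ⟨z, hz, hadj⟩ := hX.exists_adj_facet hc h hr
        have hzx : z ∈ X.total.dualSet ∅ := ⟨hz.1, hz.2.1, Set.empty_subset _⟩
        exact ⟨z, hzx, .of_adj (hsub z hzx) ht hadj⟩
  · obtain ⟨x, hx, rfl⟩ | ⟨x, hx, rfl⟩ := (hX.mem_dual_total hc).1 hs
    · exact hX.dual_linkedOn_tilde hc hx
    · exact (hX.removed_linkedOn_star hc hx).congr fun a _ b _ hab =>
        (hX.removed_isSub_dual hc).graph_adj hab

theorem IsCobordism.dual_inC (hX : X.IsCobordism) (hc : X.Collared) : X.dual.total.InC :=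
  ⟨hX.dual_nonSingular hc, ⟨hX.dual_not_isPinch hc, hX.dual_boundary_not_isPinch hc⟩,
    hX.dual_isLocal hc⟩

/-! ### The dual pair: non-degeneracy, collar and removed part. -/

theorem IsCobordism.dual_isRelCC (hX : X.IsCobordism) (hc : X.Collared) : X.dual.IsRelCC := by
  refine ⟨hX.dual_isCC hc, (hX.dual_isCC hc).of_isLower (hX.removed_isSub_dual hc) ?_,
    hX.removed_isSub_dual hc⟩
  intro s hs r hr hsr
  obtain ⟨y, hy, rfl⟩ := (hX.mem_dual_removed hc).1 hr
  obtain ⟨x, hx, rfl⟩ | hx := (hX.mem_dual_total hc).1 hs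
  · exact absurd hsr (hX.not_tilde_subset_star hx.1)
  · exact (hX.mem_dual_removed hc).2 hx

theorem IsCobordism.mem_dual_removed_verts (hX : X.IsCobordism) (hc : X.Collared) :
    t ∈ X.dual.removed.verts ↔ t ∈ X.outer ∧ X.total.rk t + 1 = X.total.rank := by
  refine (hX.mem_dual_removed hc).trans ⟨?_, ?_⟩
  · rintro ⟨x, hx, hxt⟩
    obtain ⟨z, hz⟩ := hX.exists_mem_star hx.1
    obtain ⟨hzb, hr, hxz⟩ := hX.mem_star.1 hz
    rw [hxt, Set.mem_singleton_iff] at hz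
    exact hz ▸ ⟨hX.outer_of_superset hc hx hzb hxz, hr⟩
  · rintro ⟨ht, hr⟩
    exact ⟨t, ht, hX.star_eq_singleton ht.1 hr⟩

theorem IsCobordism.tilde_diff_removed_nonempty (hX : X.IsCobordism) (hc : X.Collared)
    (hx : x ∈ X.inner) : ∃ z ∈ X.tilde x, z ∉ X.dual.removed.verts := by
  obtain ⟨z, hz, -, hr⟩ := hX.exists_top_mem_tilde hx.1
  refine ⟨z, hz, fun h => ?_⟩
  have := ((hX.mem_dual_removed_verts hc).1 h).2
  omega

theorem IsCobordism.dual_nonDegenerate (hX : X.IsCobordism) (hc : X.Collared) :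
    X.dual.NonDegenerate := by
  refine ⟨hX.dual_isRelCC hc, ?_⟩
  rintro s ⟨hs, hsr⟩ hsub
  obtain ⟨x, hx, rfl⟩ | hx := (hX.mem_dual_total hc).1 hs
  · obtain ⟨z, hz, hzn⟩ := hX.tilde_diff_removed_nonempty hc hx
    exact hzn (hsub hz)
  · exact hsr ((hX.mem_dual_removed hc).2 hx)

theorem IsCobordism.star_subset_removed_verts (hX : X.IsCobordism) (hc : X.Collared)
    (hx : x ∈ X.outer) : X.star x ⊆ X.dual.removed.verts := fun t ht => by
  obtain ⟨h1, h2, h3⟩ := hX.mem_star.1 ht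
  exact (hX.mem_dual_removed_verts hc).2 ⟨hX.outer_of_superset hc hx h1 h3, h2⟩

theorem IsCobordism.tilde_inter_removed_verts (hX : X.IsCobordism) (hc : X.Collared)
    (hx : x ∈ X.outer) : X.tilde x ∩ X.dual.removed.verts = X.star x := by
  refine subset_antisymm ?_
    (Set.subset_inter star_subset_tilde_self (hX.star_subset_removed_verts hc hx))
  rintro t ⟨ht, hto⟩
  obtain ⟨h1, h2⟩ := (hX.mem_dual_removed_verts hc).1 hto
  exact hX.mem_star.2 ⟨h1.1, h2, (hX.mem_tilde.1 ht).1⟩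

/-- Vertices of the removed part are outer facets, so `tilde x` meets it only when `x` is a face of
one, that is, when `x` is outer. -/
theorem IsCobordism.mem_dual_collar (hX : X.IsCobordism) (hc : X.Collared) :
    s ∈ X.dual.total.collar X.dual.removed ↔ ∃ x ∈ X.outer, X.tilde x = s := by
  rw [mem_collar]
  constructor
  · rintro ⟨hs, ⟨t, hts, ht⟩, r, hrs, hr⟩
    obtain ⟨x, hx, rfl⟩ | ⟨x, hx, rfl⟩ := (hX.mem_dual_total hc).1 hs
    · exact ⟨x, outer_of_subset ((hX.mem_dual_removed_verts hc).1 ht).1 hx.1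
        (hX.mem_tilde.1 hts).1, rfl⟩
    · exact absurd (hX.star_subset_removed_verts hc hx hrs) hr
  · rintro ⟨x, hx, rfl⟩
    have hxi := hX.outer_subset_inner hx
    obtain ⟨t, ht⟩ := hX.exists_mem_star hx.1
    exact ⟨hX.tilde_mem hc hxi, ⟨t, star_subset_tilde_self ht,
      hX.star_subset_removed_verts hc hx ht⟩, hX.tilde_diff_removed_nonempty hc hxi⟩

/-- The collar correspondence is `tilde x` over `star x`, for `x` outer: both reverse inclusion of
cells and their ranks differ by one. -/
theorem IsCobordism.dual_collared (hX : X.IsCobordism) (hc : X.Collared) :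
    X.dual.Collared where
  inter_mem s hs := by
    obtain ⟨x, hx, rfl⟩ := (hX.mem_dual_collar hc).1 hs
    rw [hX.tilde_inter_removed_verts hc hx, hX.mem_dual_removed hc]
    exact ⟨x, hx, rfl⟩
  rk_eq s hs := by
    obtain ⟨x, hx, rfl⟩ := (hX.mem_dual_collar hc).1 hs
    rw [hX.tilde_inter_removed_verts hc hx]
    have h1 := hX.rk_tilde (hX.outer_subset_inner hx)
    have h2 := hX.rk_star hc hx
    omega
  exists_inter_eq r hr := by
    obtain ⟨x, hx, rfl⟩ := (hX.mem_dual_removed hc).1 hr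
    exact ⟨_, (hX.mem_dual_collar hc).2 ⟨x, hx, rfl⟩, hX.tilde_inter_removed_verts hc hx⟩
  subset_of_inter_subset s hs r hr hsr := by
    obtain ⟨x, hx, rfl⟩ := (hX.mem_dual_collar hc).1 hs
    obtain ⟨y, hy, rfl⟩ := (hX.mem_dual_collar hc).1 hr
    rw [hX.tilde_inter_removed_verts hc hx, hX.tilde_inter_removed_verts hc hy,
      hX.star_subset_star hx.1] at hsr
    exact (hX.tilde_subset_tilde hx.1.1).2 hsr

theorem IsCobordism.dual_removed_isSub_boundary (hX : X.IsCobordism) (hc : X.Collared) :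
    X.dual.removed.IsSub X.dual.total.boundary := by
  refine ⟨fun s hs => ?_, (hX.removed_isSub_dual hc).2⟩
  exact (hX.mem_dual_boundary hc).2 (.inr ((hX.mem_dual_removed hc).1 hs))

theorem IsCobordism.dual_removed_rank (hX : X.IsCobordism) (hc : X.Collared)
    (hne : X.dual.removed.cells.Nonempty) : X.dual.removed.rank + 1 = X.total.rank := by
  obtain ⟨s, hs⟩ := hne
  obtain ⟨x, hx, rfl⟩ := (hX.mem_dual_removed hc).1 hs
  obtain ⟨v, hv⟩ := hX.isCC.nonempty_of_mem x hx.1.1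
  have hvK := hX.isCC.singleton_mem hx.1.1 hv
  have hvo : {v} ∈ X.outer := outer_of_subset hx hvK (by simpa)
  have h1 := hX.rk_removed_star hc hvo
  rw [hX.isCC.rk_singleton hvK] at h1
  rw [rank_eq_of_forall_le (n := X.total.rank - 1)
    ((hX.mem_dual_removed hc).2 ⟨_, hvo, rfl⟩) (by omega)]
  · omega
  · intro r hr
    obtain ⟨y, hy, rfl⟩ := (hX.mem_dual_removed hc).1 hr
    have := hX.rk_removed_star hc hy
    omega

theorem IsCobordism.dual_removed_dualSet (hX : X.IsCobordism) (hc : X.Collared)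
    (hx : x ∈ X.outer) : X.dual.removed.dualSet (X.star x) = (fun v => X.star {v}) '' x := by
  have hrank := hX.dual_removed_rank hc ⟨_, (hX.mem_dual_removed hc).2 ⟨x, hx, rfl⟩⟩
  ext r
  rw [mem_dualSet]
  constructor
  · rintro ⟨hr, hrr, hs⟩
    obtain ⟨y, hy, rfl⟩ := (hX.mem_dual_removed hc).1 hr
    have := hX.rk_removed_star hc hy
    obtain ⟨v, rfl⟩ := (hX.isCC.rk_eq_zero_iff y hy.1.1).1 (by omega)
    exact ⟨v, by simpa using (hX.star_subset_star hx.1).1 hs, rfl⟩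
  · rintro ⟨v, hv, rfl⟩
    have hvs : ({v} : Set V) ⊆ x := by simpa
    have hvK := hX.isCC.singleton_mem hx.1.1 hv
    have hvo : {v} ∈ X.outer := outer_of_subset hx hvK hvs
    have h1 := hX.rk_removed_star hc hvo
    rw [hX.isCC.rk_singleton hvK] at h1
    show X.star {v} ∈ _ ∧ X.dual.removed.rk (X.star {v}) = _ ∧ _ ⊆ X.star {v}
    exact ⟨(hX.mem_dual_removed hc).2 ⟨_, hvo, rfl⟩, by omega, (hX.star_subset_star hx.1).2 hvs⟩

theorem IsCobordism.dual_removed_graphBased (hX : X.IsCobordism) (hc : X.Collared) :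
    X.dual.removed.GraphBased := fun s hs hr =>
  hX.dual_graphBased hc s ((hX.removed_isSub_dual hc).1 hs)
    (by rw [← (hX.removed_isSub_dual hc).2 s hs, hr])

theorem IsCobordism.dual_removed_closed (hX : X.IsCobordism) (hc : X.Collared) :
    X.dual.removed.Closed := by
  have h := hX.isCC
  have hedge : ∀ s ∈ X.dual.removed.cells, X.dual.removed.rk s + 1 = X.dual.removed.rank →
      (X.dual.removed.cofaces s).encard = 2 := by
    intro s hs hr
    have hrank := hX.dual_removed_rank hc ⟨s, hs⟩
    rw [cofaces_eq_dualSet hr]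
    obtain ⟨x, hx, rfl⟩ := (hX.mem_dual_removed hc).1 hs
    have h1 := hX.rk_removed_star hc hx
    rw [hX.dual_removed_dualSet hc hx, Set.InjOn.encard_image, hX.graphBased x hx.1.1 (by omega)]
    intro u hu v hv huv
    exact Set.singleton_injective ((hX.star_inj
      (mem_boundary_of_subset (h.singleton_mem hx.1.1 hu) hx.1 (by simpa))
      (mem_boundary_of_subset (h.singleton_mem hx.1.1 hv) hx.1 (by simpa))).1 huv)
  refine ⟨⟨(hX.dual_isRelCC hc).removed_isCC, hX.dual_removed_graphBased hc,
    .of_exists_top fun s hs => ?_, fun s hs hr => (hedge s hs hr).le⟩, ?_⟩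
  · obtain ⟨x, hx, rfl⟩ := (hX.mem_dual_removed hc).1 hs
    obtain ⟨v, hv⟩ := h.nonempty_of_mem x hx.1.1
    have : X.star {v} ∈ X.dual.removed.dualSet (X.star x) := by
      rw [hX.dual_removed_dualSet hc hx]
      exact ⟨v, hv, rfl⟩
    exact ⟨_, this.1, this.2.2, this.2.1⟩
  · rw [Set.eq_empty_iff_forall_notMem]
    rintro s ⟨-, r, hr, hrr, ⟨q, hq⟩, -⟩
    have := hedge r hr hrr
    rw [hq, Set.encard_singleton] at this
    norm_num at this

/-- Non-pinching comes from connectedness of the outer cells, and cell-connectedness from the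
absence of `∂K`-pinches. -/
theorem IsCobordism.dual_removed_inB (hX : X.IsCobordism) (hc : X.Collared) :
    X.dual.removed.InB := by
  have h := hX.isCC
  have hcl := hX.dual_removed_closed hc
  refine ⟨hcl, ⟨?_, fun s hs => ?_⟩, hcl.1.isCC.cellConnected_iff.2
    ⟨hX.dual_removed_graphBased hc, fun s hs => ?_⟩⟩
  · rw [forall_not_isPinch_iff]
    intro s hs
    obtain ⟨x, hx, rfl⟩ := (hX.mem_dual_removed hc).1 hs
    rw [hX.dual_removed_dualSet hc hx]
    refine (hX.linkedOn hx.1.1).map (fun v => X.star {v}) (fun a ha b hb hab => ?_) ?_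
    · refine .of_adj ⟨a, ha, rfl⟩ ⟨b, hb, rfl⟩ ?_
      have he : {a, b} ∈ X.outer := outer_of_subset hx hab.2.1 (Set.pair_subset ha hb)
      have hem := (hX.mem_dual_removed hc).2 ⟨_, he, rfl⟩
      have h1 := hX.rk_removed_star hc he
      have hrank := hX.dual_removed_rank hc ⟨_, hem⟩
      rw [hab.2.2] at h1
      rw [hcl.1.isCC.dualGraph_adj_iff]
      refine ⟨fun heq => hab.1 (Set.singleton_injective ((hX.star_inj
        (mem_boundary_of_subset (h.singleton_mem hx.1.1 ha) hx.1 (by simpa))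
        (mem_boundary_of_subset (h.singleton_mem hx.1.1 hb) hx.1 (by simpa))).1 heq)),
        _, hem, by omega, ?_⟩
      rw [hX.dual_removed_dualSet hc he, Set.image_pair]
    · rintro _ ⟨a, ha, rfl⟩
      exact ⟨a, ha, .refl⟩
  · have := hs.1
    simp [hcl.2] at this
  · obtain ⟨x, hx, rfl⟩ := (hX.mem_dual_removed hc).1 hs
    exact hX.removed_linkedOn_star hc hx

/-! ### Locality of the dual pair -/

theorem component_verts_subset (v : V) : (X.removed.component v).verts ⊆ X.removed.verts := by
  rw [component_verts]
  exact fun _ h => h.1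

theorem component_graph_adj {a b : V} (hab : X.removed.graph.Adj a b)
    (ha : a ∈ (X.removed.component v).verts) (hb : b ∈ (X.removed.component v).verts) :
    (X.removed.component v).graph.Adj a b := by
  rw [component_verts] at ha hb
  exact restrict_graph_adj.2 ⟨hab, ha.2, hb.2⟩

theorem IsCobordism.star_subset_component (hX : X.IsCobordism) (hc : X.Collared)
    (hx : x ∈ X.outer) {t₀ : Set V} (ht : t ∈ X.star x)
    (ht₀ : t ∈ (X.dual.removed.component t₀).verts) :
    X.star x ⊆ (X.dual.removed.component t₀).verts := by
  rw [component_verts] at ht₀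
  exact subset_component_verts (hX.dual_isRelCC hc).removed_isCC
    (hX.dual_removed_inB hc).cellConnected ((hX.mem_dual_removed hc).2 ⟨x, hx, rfl⟩) ht ht₀.2

theorem IsCobordism.mem_dual_collar_component (hX : X.IsCobordism) (hc : X.Collared)
    {t₀ : Set V} : s ∈ X.dual.total.collar (X.dual.removed.component t₀) ↔
      ∃ x ∈ X.outer, X.star x ⊆ (X.dual.removed.component t₀).verts ∧ X.tilde x = s := by
  constructor
  · intro hs
    obtain ⟨hsD, ⟨t, hts, ht⟩, r, hrs, hr⟩ := mem_collar.1 hs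
    obtain ⟨hto, htr⟩ := (hX.mem_dual_removed_verts hc).1 (component_verts_subset _ ht)
    obtain ⟨x, hx, rfl⟩ | ⟨x, hx, rfl⟩ := (hX.mem_dual_total hc).1 hsD
    · have hxt := (hX.mem_tilde.1 hts).1
      have hxo := outer_of_subset hto hx.1 hxt
      exact ⟨x, hxo, hX.star_subset_component hc hxo (hX.mem_star.2 ⟨hto.1, htr, hxt⟩) ht, rfl⟩
    · exact absurd (hX.star_subset_component hc hx hts ht hrs) hr
  · rintro ⟨x, hx, hxs, rfl⟩
    have hxi := hX.outer_subset_inner hx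
    obtain ⟨t, ht⟩ := hX.exists_mem_star hx.1
    obtain ⟨z, hz, hzn⟩ := hX.tilde_diff_removed_nonempty hc hxi
    exact mem_collar.2 ⟨hX.tilde_mem hc hxi, ⟨t, star_subset_tilde_self ht, hxs ht⟩, z, hz,
      fun h => hzn (component_verts_subset _ h)⟩

theorem IsCobordism.dual_collarEdges_component (hX : X.IsCobordism) (hc : X.Collared)
    {t₀ : Set V} (hx : x ∈ X.outer)
    (hxs : X.star x ⊆ (X.dual.removed.component t₀).verts) :
    X.dual.total.collarEdges (X.dual.removed.component t₀) (X.tilde x) =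
      X.tilde '' X.star x := by
  ext s
  constructor
  · rintro ⟨hs, hr, hsx⟩
    obtain ⟨y, hy, -, rfl⟩ := (hX.mem_dual_collar_component hc).1 hs
    have h1 := hX.rk_tilde (hX.outer_subset_inner hy)
    exact ⟨y, hX.mem_star.2 ⟨hy.1, by omega, (hX.tilde_subset_tilde hy.1.1).1 hsx⟩, rfl⟩
  · rintro ⟨t, ht, rfl⟩
    obtain ⟨htb, htr, hxt⟩ := hX.mem_star.1 ht
    have hto := hX.outer_of_superset hc hx htb hxt
    have h1 := hX.rk_tilde (hX.outer_subset_inner hto)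
    refine ⟨(hX.mem_dual_collar_component hc).2 ⟨t, hto, ?_, rfl⟩, by omega,
      (hX.tilde_subset_tilde htb.1).2 hxt⟩
    exact (dualSet_anti hxt).trans hxs

theorem IsCobordism.tilde_injOn (hX : X.IsCobordism) : Set.InjOn X.tilde X.outer :=
  fun _ hx _ hy => (hX.tilde_inj hx.1.1 hy.1.1).1

theorem IsCobordism.star_subset_outer (hX : X.IsCobordism) (hc : X.Collared)
    (hx : x ∈ X.outer) : X.star x ⊆ X.outer := fun _ ht =>
  hX.outer_of_superset hc hx (hX.mem_star.1 ht).1 (hX.mem_star.1 ht).2.2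

theorem IsCobordism.dual_midsection_rk (hX : X.IsCobordism) (hc : X.Collared)
    {t₀ : Set V} (hx : x ∈ X.outer)
    (hxs : X.star x ⊆ (X.dual.removed.component t₀).verts) :
    (X.dual.total.midsection (X.dual.removed.component t₀)).rk (X.tilde '' X.star x) =
      X.dual.removed.rk (X.star x) := by
  have hxc : X.tilde x ∈ X.dual.total.collar (X.dual.removed.component t₀) :=
    (hX.mem_dual_collar_component hc).2 ⟨x, hx, hxs, rfl⟩
  rw [← hX.dual_collarEdges_component hc hx hxs, midsection, ofImage_rk hxc]
  · have h1 := hX.rk_tilde (hX.outer_subset_inner hx)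
    have h2 := hX.rk_removed_star hc hx
    omega
  · intro s hs hsx
    obtain ⟨y, hy, hys, rfl⟩ := (hX.mem_dual_collar_component hc).1 hs
    rw [hX.dual_collarEdges_component hc hx hxs, hX.dual_collarEdges_component hc hy hys,
      hX.tilde_injOn.image_eq_image_iff (hX.star_subset_outer hc hy)
        (hX.star_subset_outer hc hx), hX.star_inj hy.1 hx.1] at hsx
    rw [hsx]

theorem IsCobordism.image_star_mem_midsection (hX : X.IsCobordism) (hc : X.Collared)
    {t₀ : Set V} (hx : x ∈ X.outer)
    (hxs : X.star x ⊆ (X.dual.removed.component t₀).verts) :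
    X.tilde '' X.star x ∈ (X.dual.total.midsection (X.dual.removed.component t₀)).cells :=
  ⟨X.tilde x, (hX.mem_dual_collar_component hc).2 ⟨x, hx, hxs, rfl⟩,
    hX.dual_collarEdges_component hc hx hxs⟩

/-- The collar edges in `tilde x` are the `tilde t` with `t` in `star x`. So the midsection is a
relabelled copy of the component of the removed part, whose cells are already known to be connected.
-/
theorem IsCobordism.dual_midsection_cellConnected (hX : X.IsCobordism) (hc : X.Collared)
    (t₀ : Set V) :
    (X.dual.total.midsection (X.dual.removed.component t₀)).CellConnected := by
  have hcells : ∀ m ∈ (X.dual.total.midsection (X.dual.removed.component t₀)).cells,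
      ∃ x ∈ X.outer, X.star x ⊆ (X.dual.removed.component t₀).verts ∧
        X.tilde '' X.star x = m := by
    rintro _ ⟨s, hs, rfl⟩
    obtain ⟨x, hx, hxs, rfl⟩ := (hX.mem_dual_collar_component hc).1 hs
    exact ⟨x, hx, hxs, (hX.dual_collarEdges_component hc hx hxs).symm⟩
  have hg : (X.dual.total.midsection (X.dual.removed.component t₀)).GraphBased := by
    intro m hm hr
    obtain ⟨x, hx, hxs, rfl⟩ := hcells m hm
    rw [hX.dual_midsection_rk hc hx hxs] at hr
    rw [(hX.tilde_injOn.mono (hX.star_subset_outer hc hx)).encard_image]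
    exact hX.dual_removed_graphBased hc _ ((hX.mem_dual_removed hc).2 ⟨x, hx, rfl⟩) hr
  refine ⟨hg, fun m hm => restrict_connected hg ?_⟩
  obtain ⟨x, hx, hxs, rfl⟩ := hcells m hm
  have hv : ∀ t ∈ X.star x, X.tilde t ∈
      (X.dual.total.midsection (X.dual.removed.component t₀)).verts ∩ X.tilde '' X.star x := by
    intro t ht
    obtain ⟨htb, htr, hxt⟩ := hX.mem_star.1 ht
    have hto := hX.star_subset_outer hc hx ht
    have := hX.image_star_mem_midsection hc hto ((dualSet_anti hxt).trans hxs)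
    rw [hX.star_eq_singleton htb htr, Set.image_singleton] at this
    exact ⟨this, t, ht, rfl⟩
  refine (hX.removed_linkedOn_star hc hx).map X.tilde (fun a ha b hb hab => ?_) ?_
  · refine .of_adj (hv a ha) (hv b hb) ?_
    obtain ⟨y, hy, hys⟩ := (hX.mem_dual_removed hc).1 hab.2.1
    have hyx : X.star y ⊆ (X.dual.removed.component t₀).verts := by
      rw [hys]
      exact Set.pair_subset (hxs ha) (hxs hb)
    have hm := hX.image_star_mem_midsection hc hy hyx
    have hr := hX.dual_midsection_rk hc hy hyx
    rw [hys, Set.image_pair] at hm hr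
    refine ⟨fun h => hab.1 ?_, hm, by rw [hr]; exact hab.2.2⟩
    exact hX.tilde_injOn (hX.star_subset_outer hc hx ha) (hX.star_subset_outer hc hx hb) h
  · rintro _ ⟨-, t, ht, rfl⟩
    exact ⟨t, ht, .refl⟩

theorem IsCobordism.dual_isLocal_pair (hX : X.IsCobordism) (hc : X.Collared) :
    X.dual.IsLocal where
  nonDegenerate := hX.dual_nonDegenerate hc
  total_isLocal := hX.dual_isLocal hc
  inter_connected t₀ _ s hs := by
    obtain ⟨x, hx, hxs, rfl⟩ := (hX.mem_dual_collar_component hc).1 hs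
    refine restrict_connected ((hX.dual_removed_graphBased hc).restrict _) ?_
    have : (X.dual.removed.component t₀).verts ∩ X.tilde x = X.star x := by
      rw [← hX.tilde_inter_removed_verts hc hx] at hxs ⊢
      refine subset_antisymm (fun t ht => ⟨ht.2, component_verts_subset _ ht.1⟩)
        fun t ht => ⟨hxs ht, ht.1⟩
    rw [this]
    exact (hX.removed_linkedOn_star hc hx).congr fun a ha b hb hab =>
      component_graph_adj hab (hxs ha) (hxs hb)
  midsection_cellConnected t₀ _ := hX.dual_midsection_cellConnected hc t₀

/-- The dual of an exactly collared cobordism is a cobordism. -/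
theorem IsCobordism.dual (hX : X.IsCobordism) (hc : X.Collared) : X.dual.IsCobordism where
  total_mem := hX.dual_inC hc
  removed_isSub := hX.dual_removed_isSub_boundary hc
  removed_mem := hX.dual_removed_inB hc
  removed_rank hne := by rw [hX.dual_removed_rank hc hne, hX.dual_rank hc]
  nonDegenerate := hX.dual_nonDegenerate hc
  isLocal := hX.dual_isLocal_pair hc

/-! ### The boundary of the dual and the double dual. -/

/-- A boundary cell containing a cell of `J` lies in `J`, and `J` has the same rank as `∂K`, so dual
sets in `J` and in `∂K` agree. -/
theorem IsCobordism.removed_dualSet (hX : X.IsCobordism) (hc : X.Collared)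
    (hj : j ∈ X.removed.cells) : X.removed.dualSet j = X.star j := by
  obtain ⟨h1, h2⟩ := hX.removed_rank_add_one hj
  have hjA := (hX.nonDegenerate.mem_removed_iff.1 hj).2
  ext t
  rw [hX.mem_star, mem_dualSet]
  constructor
  · rintro ⟨ht, hr, hjt⟩
    rw [hX.nonDegenerate.rk_removed ht] at hr
    exact ⟨hX.removed_isSub.1 ht, by omega, hjt⟩
  · rintro ⟨ht, hr, hjt⟩
    obtain ⟨v, hv⟩ := hX.isCC.nonempty_of_mem j (hX.removed_isSub.1 hj).1
    have htJ := hX.nonDegenerate.mem_removed_iff.2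
      ⟨ht.1, hX.subset_of_mem_boundary hc ht (hjt hv) (hjA hv)⟩
    exact ⟨htJ, by rw [hX.nonDegenerate.rk_removed htJ]; omega, hjt⟩

theorem IsCobordism.mem_removed_dual (hX : X.IsCobordism) (hc : X.Collared) :
    s ∈ X.removed.dual.cells ↔ ∃ j ∈ X.removed.cells, X.star j = s := by
  constructor
  · rintro ⟨j, hj, rfl⟩
    exact ⟨j, hj, (hX.removed_dualSet hc hj).symm⟩
  · rintro ⟨j, hj, rfl⟩
    exact ⟨j, hj, hX.removed_dualSet hc hj⟩

theorem IsCobordism.rk_removed_dual (hX : X.IsCobordism) (hc : X.Collared)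
    (hj : j ∈ X.removed.cells) :
    X.removed.dual.rk (X.star j) + X.total.rk j + 1 = X.total.rank := by
  have h1 : X.removed.dual.rk (X.removed.dualSet j) = X.removed.rank - X.removed.rk j := by
    refine ofImage_rk (f := X.removed.dualSet)
      (r := fun x => X.removed.rank - X.removed.rk x) hj ?_
    intro y hy hyj
    rw [hX.removed_dualSet hc hy, hX.removed_dualSet hc hj,
      hX.star_inj (hX.removed_isSub.1 hy) (hX.removed_isSub.1 hj)] at hyj
    rw [hyj]
  rw [hX.removed_dualSet hc hj, hX.nonDegenerate.rk_removed hj] at h1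
  have h2 := (hX.removed_rank_add_one hj).1
  have h3 := hX.rk_lt (hX.removed_isSub.1 hj)
  omega

theorem IsCobordism.not_subset_of_removed_of_outer (hX : X.IsCobordism)
    (hj : j ∈ X.removed.cells) (hx : x ∈ X.outer) : ¬ j ⊆ x := fun h => by
  obtain ⟨hjK, hjA⟩ := hX.nonDegenerate.mem_removed_iff.1 hj
  obtain ⟨v, hv⟩ := hX.isCC.nonempty_of_mem j hjK
  exact hx.2 v (h hv) (hjA hv)

theorem IsCobordism.not_subset_of_inner_of_removed (hX : X.IsCobordism)
    (hj : j ∈ X.removed.cells) (hx : x ∈ X.inner) : ¬ x ⊆ j := fun h => by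
  obtain ⟨-, v, hv, hvJ⟩ := hx
  exact hvJ ((hX.nonDegenerate.mem_removed_iff.1 hj).2 (h hv))

theorem IsCobordism.disjoint_removed_dual (hX : X.IsCobordism) (hc : X.Collared) :
    Disjoint X.removed.dual.cells X.outgoingDual.cells := by
  rw [Set.disjoint_left]
  intro s hs hs'
  obtain ⟨j, hj, rfl⟩ := (hX.mem_removed_dual hc).1 hs
  obtain ⟨x, hx, hxj⟩ := (hX.mem_dual_removed hc).1 hs'
  exact hX.not_subset_of_removed_of_outer hj hx
    ((hX.star_subset_star hx.1).1 hxj.subset)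

theorem IsCobordism.dual_boundary_isomorphic (hX : X.IsCobordism) (hc : X.Collared) :
    X.dual.boundary.Isomorphic (X.removed.dual.disjUnion X.outgoingDual) := by
  classical
  -- The outgoing part is fixed; on the rest, `tilde x` with `x` in the collar goes to `star (x ∩
  -- J)`, where intersecting the members of `tilde x` recovers `x`.
  let f : Set (Set V) → Set (Set V) := fun s =>
    if s ∈ X.dual.removed.cells then s else X.star (⋂₀ s ∩ X.removed.verts)
  have hfo : ∀ x ∈ X.outer, f (X.star x) = X.star x := fun x hx =>
    if_pos ((hX.mem_dual_removed hc).2 ⟨x, hx, rfl⟩)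
  have hfc : ∀ x ∈ X.total.collar X.removed,
      f (X.tilde x) = X.star (x ∩ X.removed.verts) := by
    intro x hx
    refine (if_neg fun h => ?_).trans ?_
    · obtain ⟨y, -, hy⟩ := (hX.mem_dual_removed hc).1 h
      exact hX.tilde_ne_star hx.1 hy.symm
    · rw [hX.sInter_tilde hx.1]
  have hJb : ∀ x ∈ X.total.collar X.removed,
      x ∩ X.removed.verts ∈ X.total.boundary.cells :=
    fun x hx => hX.removed_isSub.1 (hc.inter_mem x hx)
  refine ⟨f, isIso_of_subset_iff ?_ ?_ ?_ ?_⟩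
  · intro s hs
    obtain ⟨x, hx, rfl⟩ | ⟨x, hx, rfl⟩ := (hX.mem_dual_boundary hc).1 hs
    · rw [hfc x hx]
      exact .inl ((hX.mem_removed_dual hc).2 ⟨_, hc.inter_mem x hx, rfl⟩)
    · rw [hfo x hx]
      exact .inr ((hX.mem_dual_removed hc).2 ⟨x, hx, rfl⟩)
  · rintro s (hs | hs)
    · obtain ⟨j, hj, rfl⟩ := (hX.mem_removed_dual hc).1 hs
      obtain ⟨x, hx, rfl⟩ := hc.exists_inter_eq j hj
      exact ⟨_, (hX.mem_dual_boundary hc).2 (.inl ⟨x, hx, rfl⟩), hfc x hx⟩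
    · obtain ⟨x, hx, rfl⟩ := (hX.mem_dual_removed hc).1 hs
      exact ⟨_, (hX.mem_dual_boundary hc).2 (.inr ⟨x, hx, rfl⟩), hfo x hx⟩
  · intro s hs r hr
    obtain ⟨x, hx, rfl⟩ | ⟨x, hx, rfl⟩ := (hX.mem_dual_boundary hc).1 hs <;>
      obtain ⟨y, hy, rfl⟩ | ⟨y, hy, rfl⟩ := (hX.mem_dual_boundary hc).1 hr
    · rw [hfc x hx, hfc y hy, hX.star_subset_star (hJb x hx), hX.tilde_subset_tilde hx.1]
      exact ⟨fun h => hc.subset_of_inter_subset y hy x hx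
        h, fun h => Set.inter_subset_inter_left _ h⟩
    · rw [hfc x hx, hfo y hy, hX.star_subset_star (hJb x hx)]
      exact iff_of_false
        (hX.not_subset_of_inner_of_removed (hc.inter_mem x hx) (hX.outer_subset_inner hy))
        (hX.not_tilde_subset_star hx.1)
    · rw [hfo x hx, hfc y hy, hX.star_subset_star hx.1, hX.star_subset_tilde hx.1]
      exact iff_of_false (hX.not_subset_of_removed_of_outer (hc.inter_mem y hy) hx)
        fun h => not_outer_of_collar hy (outer_of_subset hx hy.1 h)
    · rw [hfo x hx, hfo y hy]
  · intro s hs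
    obtain ⟨x, hx, rfl⟩ | ⟨x, hx, rfl⟩ := (hX.mem_dual_boundary hc).1 hs
    · rw [hfc x hx]
      have hj := hc.inter_mem x hx
      have h1 := hX.rk_removed_dual hc hj
      have h2 := hX.rk_tilde (inner_of_collar hx)
      have h3 := hc.rk_eq x hx
      have h4 : (X.removed.dual.disjUnion X.outgoingDual).rk
          (X.star (x ∩ X.removed.verts)) = X.removed.dual.rk (X.star (x ∩ X.removed.verts)) :=
        if_pos ((hX.mem_removed_dual hc).2 ⟨_, hj, rfl⟩)
      have h5 : X.dual.boundary.rk (X.tilde x) = X.dual.total.rk (X.tilde x) := rfl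
      omega
    · rw [hfo x hx]
      have h1 := hX.rk_removed_star hc hx
      have h2 := hX.rk_star hc hx
      have h4 : (X.removed.dual.disjUnion X.outgoingDual).rk (X.star x) =
          X.dual.removed.rk (X.star x) :=
        if_neg (Set.disjoint_right.1 (hX.disjoint_removed_dual hc)
          ((hX.mem_dual_removed hc).2 ⟨x, hx, rfl⟩))
      have h5 : X.dual.boundary.rk (X.star x) = X.dual.total.rk (X.star x) := rfl
      omega

theorem IsCobordism.mem_dual_inner (hX : X.IsCobordism) (hc : X.Collared) :
    s ∈ X.dual.inner ↔ ∃ x ∈ X.inner, X.tilde x = s := by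
  rw [← (hX.dual hc).nonDegenerate.diff_eq_inner, Set.mem_sdiff, hX.mem_dual_total hc,
    hX.mem_dual_removed hc]
  constructor
  · exact fun h => h.1.resolve_right h.2
  · rintro ⟨x, hx, rfl⟩
    exact ⟨.inl ⟨x, hx, rfl⟩, fun ⟨y, _, hy⟩ => hX.tilde_ne_star hx.1 hy.symm⟩

/-- The end that the dual does not remove is indexed by the collar of `J`: this is how `J` comes
back when dualizing again. -/
theorem IsCobordism.mem_dual_outer (hX : X.IsCobordism) (hc : X.Collared) :
    s ∈ X.dual.outer ↔ ∃ x ∈ X.total.collar X.removed, X.tilde x = s := by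
  rw [← (hX.dual hc).diff_eq_outer (hX.dual_collared hc), Set.mem_sdiff,
    hX.mem_dual_boundary hc, hX.mem_dual_removed hc]
  constructor
  · exact fun h => h.1.resolve_right h.2
  · rintro ⟨x, hx, rfl⟩
    exact ⟨.inl ⟨x, hx, rfl⟩, fun ⟨y, _, hy⟩ => hX.tilde_ne_star hx.1 hy.symm⟩

theorem IsCobordism.dual_dual_isomorphic (hX : X.IsCobordism) (hc : X.Collared) :
    X.dual.dual.Isomorphic X := by
  classical
  have hY := hX.dual hc
  have hcY := hX.dual_collared hc
  have hrank := hX.dual_rank hc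
  -- Intersecting twice undoes both dualizations and returns an inner cell; a removed cell of the
  -- double dual yields a collar cell, which is then cut down to its `J`-part.
  let f : Set (Set (Set V)) → Set V := fun s =>
    if s ∈ X.dual.dual.removed.cells then ⋂₀ (⋂₀ s) ∩ X.removed.verts else ⋂₀ (⋂₀ s)
  have hin : ∀ x ∈ X.inner, X.tilde x ∈ X.dual.inner := fun x hx =>
    (hX.mem_dual_inner hc).2 ⟨x, hx, rfl⟩
  have hout : ∀ x ∈ X.total.collar X.removed, X.tilde x ∈ X.dual.outer := fun x hx =>
    (hX.mem_dual_outer hc).2 ⟨x, hx, rfl⟩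
  have htot : ∀ s, s ∈ X.dual.dual.total.cells ↔
      (∃ x ∈ X.inner, X.dual.tilde (X.tilde x) = s) ∨
        ∃ x ∈ X.total.collar X.removed, X.dual.star (X.tilde x) = s := by
    intro s
    rw [hY.mem_dual_total hcY]
    simp only [hX.mem_dual_inner hc, hX.mem_dual_outer hc, exists_exists_and_eq_and]
  have hrem : ∀ s, s ∈ X.dual.dual.removed.cells ↔
      ∃ x ∈ X.total.collar X.removed, X.dual.star (X.tilde x) = s := by
    intro s
    rw [hY.mem_dual_removed hcY]
    simp only [hX.mem_dual_outer hc, exists_exists_and_eq_and]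
  have hft : ∀ x ∈ X.inner, f (X.dual.tilde (X.tilde x)) = x := by
    intro x hx
    refine (if_neg fun h => ?_).trans ?_
    · obtain ⟨y, -, hy⟩ := (hrem _).1 h
      exact hY.tilde_ne_star (hin x hx).1 hy.symm
    · rw [hY.sInter_tilde (hin x hx).1, hX.sInter_tilde hx.1]
  have hfs : ∀ x ∈ X.total.collar X.removed,
      f (X.dual.star (X.tilde x)) = x ∩ X.removed.verts := by
    intro x hx
    refine (if_pos ((hrem _).2 ⟨x, hx, rfl⟩)).trans ?_
    rw [hY.sInter_star (hout x hx).1, hX.sInter_tilde hx.1]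
  have hJK := hX.nonDegenerate.isRelCC.isSub
  refine ⟨f, isIso_of_subset_iff ?_ ?_ ?_ ?_, ?_⟩
  · intro s hs
    obtain ⟨x, hx, rfl⟩ | ⟨x, hx, rfl⟩ := (htot s).1 hs
    · rw [hft x hx]
      exact hx.1
    · rw [hfs x hx]
      exact hJK.1 (hc.inter_mem x hx)
  · intro x hx
    by_cases hxJ : x ∈ X.removed.cells
    · obtain ⟨y, hy, rfl⟩ := hc.exists_inter_eq x hxJ
      exact ⟨_, (htot _).2 (.inr ⟨y, hy, rfl⟩), hfs y hy⟩
    · have hxi : x ∈ X.inner := by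
        rw [← hX.nonDegenerate.diff_eq_inner]
        exact ⟨hx, hxJ⟩
      exact ⟨_, (htot _).2 (.inl ⟨x, hxi, rfl⟩), hft x hxi⟩
  · intro s hs r hr
    obtain ⟨x, hx, rfl⟩ | ⟨x, hx, rfl⟩ := (htot s).1 hs <;>
      obtain ⟨y, hy, rfl⟩ | ⟨y, hy, rfl⟩ := (htot r).1 hr
    · rw [hft x hx, hft y hy, hY.tilde_subset_tilde (hin x hx).1, hX.tilde_subset_tilde hy.1]
    · rw [hft x hx, hfs y hy]
      exact iff_of_false (hX.not_subset_of_inner_of_removed (hc.inter_mem y hy) hx)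
        (hY.not_tilde_subset_star (hin x hx).1)
    · rw [hfs x hx, hft y hy, hY.star_subset_tilde (hout x hx).1, hX.tilde_subset_tilde hy.1]
      exact ⟨fun h => hc.subset_of_inter_subset' hx hy h,
        fun h => Set.inter_subset_left.trans h⟩
    · rw [hfs x hx, hfs y hy, hY.star_subset_star (hout x hx).1, hX.tilde_subset_tilde hy.1]
      exact ⟨fun h => hc.subset_of_inter_subset x hx y hy h,
        fun h => Set.inter_subset_inter_left _ h⟩
  · intro s hs
    obtain ⟨x, hx, rfl⟩ | ⟨x, hx, rfl⟩ := (htot s).1 hs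
    · rw [hft x hx]
      have h1 := hX.rk_tilde hx
      have h2 := hY.rk_tilde (hin x hx)
      omega
    · rw [hfs x hx]
      have h1 := hX.rk_tilde (inner_of_collar hx)
      have h2 := hY.rk_star hcY (hout x hx)
      have h3 := hc.rk_eq x hx
      omega
  · ext j
    constructor
    · rintro ⟨s, hs, rfl⟩
      obtain ⟨x, hx, rfl⟩ := (hrem s).1 hs
      rw [hfs x hx]
      exact hc.inter_mem x hx
    · intro hj
      obtain ⟨x, hx, rfl⟩ := hc.exists_inter_eq j hj
      exact ⟨_, (hrem _).2 ⟨x, hx, rfl⟩, hfs x hx⟩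

end RelFamily

theorem mainTheorem7 {V : Type*} (X : RelFamily V) (hX : X.IsCobordism)
    (hc : X.ExactlyCollared) :
    (X.dual.IsCobordism ∧ X.dual.ExactlyCollared) ∧
    (Disjoint X.removed.dual.cells X.outgoingDual.cells ∧
      X.dual.boundary.Isomorphic (X.removed.dual.disjUnion X.outgoingDual)) ∧
    X.dual.dual.Isomorphic X := by
  have hcol := hc.collared hX.total_mem.isLocal.cellConnected
  exact ⟨⟨hX.dual hcol, (hX.dual_collared hcol).exactlyCollared (hX.dual_nonDegenerate hcol)
    (hX.dual_graphBased hcol)⟩, ⟨hX.disjoint_removed_dual hcol,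
    hX.dual_boundary_isomorphic hcol⟩, hX.dual_dual_isomorphic hcol⟩
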